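/- Let $\gamma\in(0,1]$, $\varepsilon_0>0$, $\sigma>\sqrt{1+\gamma^{-1/2}}$, and consider, for $|x|,|y|<\sigma$ and $\varepsilon\in[0,\varepsilon_0]$, the autonomous system $$\dot x=\gamma(y^3-y)+\varepsilon X,\quad \dot y=-(x^3-x)+\varepsilon Y,\qquad X=X_0(x,y)+\varepsilon X_1(x,y,\varepsilon),\quad Y=Y_0(x,y)+\varepsilon Y_1(x,y,\varepsilon),\tag{1}$$ where $X_0,Y_0$ are real-analytic on $\{|x|,|y|<\sigma\}$ and $X_1,Y_1$ are $C^1$ on $\{|x|,|y|\le\sigma,\ 0\le\varepsilon\le\varepsilon_0\}$. Let $k,l\in\{-1,0,1\}$, $(k,l)\ne(0,\pm1)$, and let $b\in\mathbb R$ satisfy the condition of its class: * $k=l=0$: $0<b<\sqrt{1-\sqrt{1-\gamma}}$ or $\sqrt{1+\sqrt{1-\gamma}}<b<\sqrt{1+\sqrt{\gamma\sigma^2(\sigma^2-2)}}$; * $k=\pm1$, $l=0$: $1<kb<\sqrt{1+\sqrt{1-\gamma}}$, and moreover $\gamma\le0.8$ and $1.15-0.16\sqrt{0.8-\gamma}<kb<1.15+0.28\sqrt{0.8-\gamma}$;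 * $k=\pm1$, $l=\pm1$: $1<kb<\sqrt{1+\sqrt\gamma}$. Let $(C,S)$ be the solution of $C'=\gamma(S^3-S)$, $S'=-(C^3-C)$, $C(0)=b$, $S(0)=l$, let $\omega$ be its least period, and write $\overline f=\frac1\omega\int_0^\omega f\,d\varphi$. Put $$\alpha=C'(S-l)-(C-k)S',\qquad q=\alpha^{-2}\big((C-k)^3(2C+k)+\gamma(S-l)^3(2S+l)\big),$$ $$p=3\gamma\alpha^{-1}CS\big((S^2-1)(C-k)^2-(C^2-1)(S-l)^2\big),\qquad \xi=\alpha^{-1}(\alpha'q-p),\qquad \beta(\varphi)=\int_0^\varphi(\xi-\overline\xi)\,ds,$$ and, with $X_0,Y_0$ and their partial derivatives taken at $(C,S)$, $$R=C'Y_0-S'X_0,\qquad \Phi=\alpha^{-1}\big((S-l)X_0-(C-k)Y_0\big),$$ $$R_r=\alpha^{-1}\Big(C'\big((C-k)\partial_xY_0+(S-l)\partial_yY_0\big)-S'\big((C-k)\partial_xX_0+(S-l)\partial_yX_0\big)\Big)+\alpha^{-1}\alpha'\Phi-2\beta R,\qquad K_\star=\overline{R_r}-\overline{Rq}.$$ Assume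 that $b$ is an admissible solution of the generating equation, that is, $\overline R=0$ and $K_\star\ne0$. Then there are $\varepsilon_*\in(0,\varepsilon_0]$, $c>0$ and functions $\Upsilon_\varepsilon:\mathbb R\to(-1,1)$, $\varepsilon\in(0,\varepsilon_*]$, such that, with $$x_\varepsilon=C+(C-k)\Upsilon_\varepsilon,\qquad y_\varepsilon=S+(S-l)\Upsilon_\varepsilon,\qquad LC_\varepsilon=\{(x_\varepsilon(\varphi),y_\varepsilon(\varphi)):\varphi\in\mathbb R\},$$ the following holds. 1. For every $\varepsilon\in(0,\varepsilon_*]$ the functions $\Upsilon_\varepsilon$, $x_\varepsilon$, $y_\varepsilon$ are $C^1$ and $\omega$-periodic, and $LC_\varepsilon$ is a cycle of (1), i.e. the orbit of a nonconstant periodic solution. 2. For every $\varepsilon\in(0,\varepsilon_*]$ the cycle $LC_\varepsilon$ is asymptotically stable as $t\to-\infty$ if $K_\star>0$, and as $t\to+\infty$ if $K_\star<0$: it is Lyapunov stable in that direction of time, and through every point at distance less than $c\,\varepsilon^{3/2}$ from $LC_\varepsilon$ there passes a solution that exists for all $t\le0$ (respectively $t\ge0$) and whose distance to $LC_\varepsilon$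 tends to $0$. 3. $(x_\varepsilon(\varphi),y_\varepsilon(\varphi))$ is continuous in $(\varepsilon,\varphi)$ for $\varepsilon\in(0,\varepsilon_*)$, and converges to $(C(\varphi),S(\varphi))$ uniformly in $\varphi$ as $\varepsilon\to0$. -/

import Mathlib

open Set Filter Topology

namespace GenCycle

/-- The perturbed autonomous system
`x' = γ (y³ - y) + ε X`, `y' = -(x³ - x) + ε Y` with `X = X₀(x,y) + ε X₁(x,y,ε)` and
`Y = Y₀(x,y) + ε Y₁(x,y,ε)`, for `|x|, |y| < σ` and `ε ∈ [0, ε₀]`. -/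
structure PerturbedSystem where
  γ : ℝ
  σ : ℝ
  ε₀ : ℝ
  X₀ : ℝ → ℝ → ℝ
  Y₀ : ℝ → ℝ → ℝ
  X₁ : ℝ → ℝ → ℝ → ℝ
  Y₁ : ℝ → ℝ → ℝ → ℝ
  γ_pos : 0 < γ
  γ_le_one : γ ≤ 1
  ε₀_pos : 0 < ε₀
  lt_σ : √(1 + 1 / √γ) < σ
  analytic_X₀ : AnalyticOnNhd ℝ (fun p : ℝ × ℝ => X₀ p.1 p.2) (Ioo (-σ) σ ×ˢ Ioo (-σ) σ)
  analytic_Y₀ : AnalyticOnNhd ℝ (fun p : ℝ × ℝ => Y₀ p.1 p.2) (Ioo (-σ) σ ×ˢ Ioo (-σ) σ)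
  contDiff_X₁ : ContDiffOn ℝ 1 (fun p : ℝ × ℝ × ℝ => X₁ p.1 p.2.1 p.2.2)
    (Icc (-σ) σ ×ˢ Icc (-σ) σ ×ˢ Icc 0 ε₀)
  contDiff_Y₁ : ContDiffOn ℝ 1 (fun p : ℝ × ℝ × ℝ => Y₁ p.1 p.2.1 p.2.2)
    (Icc (-σ) σ ×ˢ Icc (-σ) σ ×ˢ Icc 0 ε₀)

/-- The solution `(C, S)` of the unperturbed problem `C' = γ (S³ - S)`, `S' = -(C³ - C)`,
`C(0) = b`, `S(0) = l`, together with its least period `ω`. -/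
structure CycleParam (γ : ℝ) (k l : ℤ) (b : ℝ) where
  C : ℝ → ℝ
  S : ℝ → ℝ
  ω : ℝ
  hasDerivAt_C : ∀ φ, HasDerivAt C (γ * (S φ ^ 3 - S φ)) φ
  hasDerivAt_S : ∀ φ, HasDerivAt S (-(C φ ^ 3 - C φ)) φ
  C_zero : C 0 = b
  S_zero : S 0 = l
  isLeast_ω : IsLeast {T : ℝ | 0 < T ∧ Function.Periodic C T ∧ Function.Periodic S T} ω

/-- The ranges of the initial value `b` for the classes of cycles: the inner and the outer cycles
around the origin (`k = l = 0`), the cycles around `(k, 0)` and both `(k, ±1)`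
(`k = ±1`, `l = 0`), and the cycles around the single centre `(k, l)` (`k, l = ±1`). For the
cycles with `k = ±1`, `l = 0` the range is the restricted one, on which the cycles are
star-shaped about `(k, 0)`. -/
def InitialRange (γ σ : ℝ) (k l : ℤ) (b : ℝ) : Prop :=
  (k = 0 ∧ l = 0 ∧
    ((0 < b ∧ b < √(1 - √(1 - γ))) ∨
      (√(1 + √(1 - γ)) < b ∧ b < √(1 + √(γ * σ ^ 2 * (σ ^ 2 - 2)))))) ∨
  ((k = 1 ∨ k = -1) ∧ l = 0 ∧
    (1 < k * b ∧ k * b < √(1 + √(1 - γ))) ∧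
    γ ≤ 0.8 ∧ 1.15 - 0.16 * √(0.8 - γ) < k * b ∧ k * b < 1.15 + 0.28 * √(0.8 - γ)) ∨
  ((k = 1 ∨ k = -1) ∧ (l = 1 ∨ l = -1) ∧
    1 < k * b ∧ k * b < √(1 + √γ))

namespace CycleParam

variable {γ : ℝ} {k l : ℤ} {b : ℝ}

/-- The mean value over the period. -/
noncomputable def avg (G : CycleParam γ k l b) (f : ℝ → ℝ) : ℝ :=
  (1 / G.ω) * ∫ φ in (0 : ℝ)..G.ω, f φ

/-- `α = C' (S - l) - (C - k) S'`. -/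
noncomputable def α (G : CycleParam γ k l b) (φ : ℝ) : ℝ :=
  deriv G.C φ * (G.S φ - l) - (G.C φ - k) * deriv G.S φ

/-- `q = α⁻² ((C - k)³ (2C + k) + γ (S - l)³ (2S + l))`. -/
noncomputable def q (G : CycleParam γ k l b) (φ : ℝ) : ℝ :=
  ((G.C φ - k) ^ 3 * (2 * G.C φ + k) + γ * (G.S φ - l) ^ 3 * (2 * G.S φ + l)) / G.α φ ^ 2

/-- `p = 3 γ α⁻¹ C S ((S² - 1)(C - k)² - (C² - 1)(S - l)²)`. -/
noncomputable def p (G : CycleParam γ k l b) (φ : ℝ) : ℝ :=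
  3 * γ / G.α φ * G.C φ * G.S φ *
    ((G.S φ ^ 2 - 1) * (G.C φ - k) ^ 2 - (G.C φ ^ 2 - 1) * (G.S φ - l) ^ 2)

/-- `ξ = α⁻¹ (α' q - p)`. -/
noncomputable def ξ (G : CycleParam γ k l b) (φ : ℝ) : ℝ :=
  (deriv G.α φ * G.q φ - G.p φ) / G.α φ

/-- `β(φ) = ∫₀^φ (ξ - mean of ξ)`. -/
noncomputable def β (G : CycleParam γ k l b) (φ : ℝ) : ℝ :=
  ∫ s in (0 : ℝ)..φ, (G.ξ s - G.avg G.ξ)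

/-- The parametrized generating cycle. -/
def cycle (G : CycleParam γ k l b) (φ : ℝ) : ℝ × ℝ := (G.C φ, G.S φ)

/-- The curve given in the polar coordinates about `(k, l)` by the function `ρ = ρ(φ)`:
`x = C + (C - k) ρ`, `y = S + (S - l) ρ`. -/
def curve (G : CycleParam γ k l b) (ρ : ℝ → ℝ) (φ : ℝ) : ℝ × ℝ :=
  (G.C φ + (G.C φ - k) * ρ φ, G.S φ + (G.S φ - l) * ρ φ)

end CycleParam

namespace PerturbedSystem

/-- The open square in which the system is considered. -/
def domain (P : PerturbedSystem) : Set (ℝ × ℝ) := Ioo (-P.σ) P.σ ×ˢ Ioo (-P.σ) P.σ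

/-- The right-hand side of the perturbed system. -/
def field (P : PerturbedSystem) (ε : ℝ) (z : ℝ × ℝ) : ℝ × ℝ :=
  (P.γ * (z.2 ^ 3 - z.2) + ε * (P.X₀ z.1 z.2 + P.X₁ z.1 z.2 ε * ε),
    -(z.1 ^ 3 - z.1) + ε * (P.Y₀ z.1 z.2 + P.Y₁ z.1 z.2 ε * ε))

/-- `z` is a solution of the perturbed system on the time interval `J`. -/
def IsSolutionOn (P : PerturbedSystem) (ε : ℝ) (J : Set ℝ) (z : ℝ → ℝ × ℝ) : Prop :=
  ∀ t ∈ J, z t ∈ P.domain ∧ HasDerivWithinAt z (P.field ε (z t)) J t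

/-- `Γ` is a cycle: the orbit of a nonconstant periodic solution. -/
def IsCycle (P : PerturbedSystem) (ε : ℝ) (Γ : Set (ℝ × ℝ)) : Prop :=
  ∃ (z : ℝ → ℝ × ℝ) (T : ℝ), P.IsSolutionOn ε univ z ∧ 0 < T ∧ Function.Periodic z T ∧
    (∃ t, z t ≠ z 0) ∧ range z = Γ

/-- Asymptotic stability of `Γ` as `t → +∞`: stability in the sense of Lyapunov, and attraction
of all solutions that start in the `δ`-neighbourhood of `Γ`; these solutions exist for all
`t ≥ 0`. -/
def IsAsymptoticallyStableForward (P : PerturbedSystem) (ε : ℝ) (Γ : Set (ℝ × ℝ)) (δ : ℝ) :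
    Prop :=
  (∀ z₀, Metric.infDist z₀ Γ < δ → ∃ z, z 0 = z₀ ∧ P.IsSolutionOn ε (Ici 0) z) ∧
  (∀ z, P.IsSolutionOn ε (Ici 0) z → Metric.infDist (z 0) Γ < δ →
    Tendsto (fun t => Metric.infDist (z t) Γ) atTop (𝓝 0)) ∧
  (∀ η > 0, ∃ δ' > 0, ∀ z, P.IsSolutionOn ε (Ici 0) z → Metric.infDist (z 0) Γ < δ' →
    ∀ t ≥ 0, Metric.infDist (z t) Γ < η)

/-- Asymptotic stability of `Γ` as `t → -∞`. -/
def IsAsymptoticallyStableBackward (P : PerturbedSystem) (ε : ℝ) (Γ : Set (ℝ × ℝ)) (δ : ℝ) :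
    Prop :=
  (∀ z₀, Metric.infDist z₀ Γ < δ → ∃ z, z 0 = z₀ ∧ P.IsSolutionOn ε (Iic 0) z) ∧
  (∀ z, P.IsSolutionOn ε (Iic 0) z → Metric.infDist (z 0) Γ < δ →
    Tendsto (fun t => Metric.infDist (z t) Γ) atBot (𝓝 0)) ∧
  (∀ η > 0, ∃ δ' > 0, ∀ z, P.IsSolutionOn ε (Iic 0) z → Metric.infDist (z 0) Γ < δ' →
    ∀ t ≤ 0, Metric.infDist (z t) Γ < η)

variable (P : PerturbedSystem) {k l : ℤ} {b : ℝ} (G : CycleParam P.γ k l b)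

/-- `R = C' Y₀(C, S) - S' X₀(C, S)`. -/
noncomputable def R (φ : ℝ) : ℝ :=
  deriv G.C φ * P.Y₀ (G.C φ) (G.S φ) - deriv G.S φ * P.X₀ (G.C φ) (G.S φ)

/-- `Φ = α⁻¹ ((S - l) X₀(C, S) - (C - k) Y₀(C, S))`. -/
noncomputable def Φ (φ : ℝ) : ℝ :=
  ((G.S φ - l) * P.X₀ (G.C φ) (G.S φ) - (G.C φ - k) * P.Y₀ (G.C φ) (G.S φ)) / G.α φ

/-- The derivative `(C - k) ∂Z/∂x + (S - l) ∂Z/∂y` at the point `(C, S)`. -/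
noncomputable def radialDeriv (Z : ℝ → ℝ → ℝ) (φ : ℝ) : ℝ :=
  (G.C φ - k) * deriv (fun x => Z x (G.S φ)) (G.C φ) +
    (G.S φ - l) * deriv (fun y => Z (G.C φ) y) (G.S φ)

/-- The radial derivative at `r = ε = 0` of `C' Y - S' X`. -/
noncomputable def Pr (φ : ℝ) : ℝ :=
  (deriv G.C φ * radialDeriv P G P.Y₀ φ - deriv G.S φ * radialDeriv P G P.X₀ φ) / G.α φ

/-- The coefficient of `ε r` in the radial equation. -/
noncomputable def Rr (φ : ℝ) : ℝ :=
  P.Pr G φ + deriv G.α φ / G.α φ * P.Φ G φ - 2 * G.β φ * P.R G φ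

/-- The constant `K` of the nondegeneracy condition `K ≠ 0`. -/
noncomputable def K : ℝ := G.avg (P.Rr G) - G.avg (fun φ => P.R G φ * G.q φ)

/-- `b` is an admissible solution of the generating equation `mean of R = 0`. -/
def IsAdmissible : Prop :=
  InitialRange P.γ P.σ k l b ∧ G.avg (P.R G) = 0 ∧ P.K G ≠ 0

end PerturbedSystem

end GenCycle

/-! The unperturbed system is Hamiltonian with energy `H = ((x² - 1)² + γ (y² - 1)²) / 4`, and the
generating cycle is a closed level curve of `H`. The range of `b` makes the curve star-shaped about
`(k, l)`: the angular momentum `α` of the field about that point has no zero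
(`CycleParam.star_shaped`). Hence `x = C + (C - k) ρ`, `y = S + (S - l) ρ` are regular coordinates
near the cycle, the angular velocity is close to `1`, and the system becomes one scalar equation
`dρ/dφ = slope`, periodic in `φ`.

Since `∂H/∂ρ = α ≠ 0` on the cycle, the energy difference `h` can replace `ρ`. It changes only
through the perturbation: `dh/dφ = ε (R + κ h + ...)`. Because `R` has mean zero, the term `ε R` is
removed by subtracting `ε ∫ R`; because `κ` has mean `K`, the factor `exp (-ε ∫ (κ - K))` replaces
`κ` by `K`. That the mean of `κ` is the prescribed constant rests on the identity `(q + 1/α)' = -2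
ξ` (`hasDerivAt_q_add`, `integral_κ`). The resulting `normalizedEnergy` `w` satisfies `w' = ε (K w +
remainder)`. On a strip `|ρ| ≤ r` with `r` independent of `ε`, the remainder is Lipschitz in `w`
with constant `|K| / 2`, and it is `O(ε)` at `ρ = 0`.

So, when `φ` runs in the direction chosen by the sign of `K`, the differences of `w` decay
exponentially and a region `|w| ≤ δ` is invariant (`exists_isTrapping`). The abstract theory of
`TrappingField` then gives a periodic solution of size `O(ε)`, its attraction of the whole region,
and its continuity in `ε`. Restoring the time (`exists_time_change`) and using that the polar
coordinates are open (`map_nhds_point`) carries this back to the plane. The neighbourhood of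
attraction so obtained has a radius independent of `ε`, which more than covers `c ε^(3/2)`. -/

namespace GenCycle

/-! ### Inequalities excluding tangency for cycles around three equilibria. -/

/-- A quadratic polynomial whose discriminant is negative is positive. -/
lemma quadratic_pos {A B m γ x : ℝ} (hγ : 0 < γ) (hm : 0 < m) (hA : m < A)
    (h : γ * ((A - B) ^ 2 + 4 * B * m) < 4 * B * m * (A - m)) :
    γ * (m + x) ^ 2 < γ * (A * (m + x) - B * x) + B * x ^ 2 := by
  have hD : 0 < m * (A - m) := mul_pos hm (by linarith)
  by_cases hx : x = 0
  · subst hx; nlinarith [mul_pos hγ hD]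
  · have hx2 : 0 < x ^ 2 := by positivity
    have key : 0 < 4 * m * (A - m) * (γ * (A * (m + x) - B * x) + B * x ^ 2 - γ * (m + x) ^ 2) := by
      have : 4 * m * (A - m) * (γ * (A * (m + x) - B * x) + B * x ^ 2 - γ * (m + x) ^ 2)
          = γ * (2 * m * (A - m) + (A - B - 2 * m) * x) ^ 2
            + x ^ 2 * (4 * B * m * (A - m) - γ * ((A - B) ^ 2 + 4 * B * m)) := by ring
      rw [this]
      have := mul_pos hx2 (sub_pos.2 h)
      positivity
    have := pos_of_mul_pos_right key (by nlinarith)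
    linarith

/-- If the cubic `(1 - h)² (1 + h)` is minorized by a suitable line `A - B h` at the relevant `h`,
then the point is not a tangency point of a ray through the centre. -/
lemma lt_mul_of_line {m γ t c : ℝ} (hγ : 0 < γ) (hm : 0 < m)
    (ht : 0 < t) (ht1 : t < 1) (hc : 0 < c)
    (hline : ∀ h : ℝ, 0 < h → ∃ A B : ℝ, 0 < B ∧ A - B * h ≤ (1 - h) ^ 2 * (1 + h) ∧
      γ * ((A - B) ^ 2 + 4 * B * m) < 4 * B * m * (A - m))
    (hE : (c ^ 2 - 1) ^ 2 = m + γ * t * (2 - t)) :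
    γ * t * (1 - t) < c * (m + γ * t) := by
  have hγt : 0 < γ * t := mul_pos hγ ht
  have hden : 0 < m + γ * t := by positivity
  -- At `c = η` the asserted inequality is an equality. If `c ≤ η`, the energy relation `hE` gives
  -- `(1 - η²)² ≤ (m + γ t) (1 + η)`, that is, `(1 - η)² (1 + η) ≤ m + γ t`, which the line is to
  -- contradict.
  set η := γ * t * (1 - t) / (m + γ * t) with hη
  have hηm : η * (m + γ * t) = γ * t * (1 - t) := by rw [hη]; field_simp
  have hη0 : 0 < η := by
    have : 0 < 1 - t := by linarith
    rw [hη]; positivity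
  have hη1 : η < 1 := by rw [hη, div_lt_one hden]; nlinarith
  obtain ⟨A, B, hB, hl, h⟩ := hline η hη0
  have hA : m < A := by
    have h1 : 0 < 4 * B * m * (A - m) := lt_of_le_of_lt (by positivity) h
    have := pos_of_mul_pos_right h1 (by positivity)
    linarith
  by_contra hcon
  push Not at hcon
  have hcη : c ≤ η := by rw [hη, le_div_iff₀ hden]; exact hcon
  have h1 : 1 - η ^ 2 ≤ 1 - c ^ 2 := by nlinarith
  have h2 : 0 < 1 - η ^ 2 := by nlinarith
  have h3 : (1 - η ^ 2) ^ 2 ≤ m + γ * t * (2 - t) := by rw [← hE]; nlinarith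
  have h4 : m + γ * t * (2 - t) = (m + γ * t) * (1 + η) := by linarith
  have h5 : (1 - η) ^ 2 * (1 + η) ≤ m + γ * t := by
    have : ((1 - η) ^ 2 * (1 + η)) * (1 + η) ≤ (m + γ * t) * (1 + η) := by nlinarith
    exact le_of_mul_le_mul_right this (by linarith)
  have h6 := quadratic_pos (x := γ * t) hγ hm hA h
  -- As `η (m + γ t) = γ t (1 - t)`, the line inequality multiplied by `γ (m + γ t)` is quadratic in
  -- `x = γ t`; `quadratic_pos` settles it.
  have h7 : γ * (m + γ * t) ^ 2 < γ * ((A - B * η) * (m + γ * t)) := by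
    have : γ * ((A - B * η) * (m + γ * t))
        = γ * (A * (m + γ * t) - B * (γ * t)) + B * (γ * t) ^ 2 := by
      linear_combination (-γ * B) * hηm
    rw [this]; exact h6
  have h8 := lt_of_mul_lt_mul_left h7 hγ.le
  have h9 : m + γ * t < A - B * η := by
    rw [pow_two] at h8
    exact lt_of_mul_lt_mul_right h8 hden.le
  linarith

/-- The line is the tangent to the cubic at `h₀`. The difference has the double root `h₀`, and the
three roots sum to `1`, so the remaining one is `1 - 2 h₀`; to the right of it the tangent lies
below. -/
lemma tangent_le (h₀ h : ℝ) (h2 : 1 - 2 * h₀ ≤ h) :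
    (1 - h₀) * (1 + h₀ + 2 * h₀ ^ 2) - (1 - h₀) * (1 + 3 * h₀) * h ≤ (1 - h) ^ 2 * (1 + h) := by
  have : (1 - h) ^ 2 * (1 + h) - ((1 - h₀) * (1 + h₀ + 2 * h₀ ^ 2) - (1 - h₀) * (1 + 3 * h₀) * h)
    = (h - h₀) ^ 2 * (h - (1 - 2 * h₀)) := by ring
  have h3 : 0 ≤ (h - h₀) ^ 2 * (h - (1 - 2 * h₀)) := by
    have : 0 ≤ h - (1 - 2 * h₀) := by linarith
    positivity
  linarith

/-- The range of initial values of the cycles around three equilibria, without the square root. -/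
lemma initial_range_sq {γ b : ℝ} (hγ : γ ≤ 0.8)
    (h1 : 1.15 - 0.16 * √(0.8 - γ) < b) (h2 : b < 1.15 + 0.28 * √(0.8 - γ)) :
    (b ≤ 23 / 20 → γ < 4 / 5 - ((23 / 20 - b) / (4 / 25)) ^ 2) ∧
      (23 / 20 ≤ b → γ < 4 / 5 - ((b - 23 / 20) / (7 / 25)) ^ 2) := by
  have hs := Real.sq_sqrt (by linarith : 0 ≤ 0.8 - γ)
  have h0 := Real.sqrt_nonneg (0.8 - γ)
  norm_num at hs h0 h1 h2
  set d := √(4 / 5 - γ)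
  have e1 : (23 / 20 - b) / (4 / 25) < d := by rw [div_lt_iff₀ (by norm_num)]; linarith
  have e2 : (b - 23 / 20) / (7 / 25) < d := by rw [div_lt_iff₀ (by norm_num)]; linarith
  constructor
  · intro hb
    have : 0 ≤ (23 / 20 - b) / (4 / 25) := div_nonneg (by linarith) (by norm_num)
    nlinarith
  · intro hb
    have : 0 ≤ (b - 23 / 20) / (7 / 25) := div_nonneg (by linarith) (by norm_num)
    nlinarith

/-- The `range_bound_*` lemmas check the discriminant condition of `lt_mul_of_line` for `m = (b² -
1)²`, with `γ` replaced by the bound that the range imposes at `b`. With `b` = left end + length ·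
`u` and `v = 1 - u`, the difference of the two sides is a form of degree `8` in `u, v` (Bernstein
form) with positive coefficients. Here `A`, `B` belong to the tangent at `h₀ = 0.6`. -/
lemma range_bound_near_one {b : ℝ} (h1 : 1 ≤ b) (h2 : b ≤ (51 / 50)) :
    (4 / 5 - ((23 / 20 - b) / (4 / 25)) ^ 2) *
        (((116 / 125) - (28 / 25)) ^ 2 + 4 * (28 / 25) * (b ^ 2 - 1) ^ 2)
      ≤ 4 * (28 / 25) * (b ^ 2 - 1) ^ 2 * ((116 / 125) - (b ^ 2 - 1) ^ 2) := by
  obtain ⟨u, rfl⟩ : ∃ u, b = 1 + (1 / 50) * u := ⟨(b - 1) / (1 / 50), by ring⟩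
  obtain ⟨v, hv⟩ : ∃ v, v = 1 - u := ⟨_, rfl⟩
  have hu : 0 ≤ u := by linarith
  have hv0 : 0 ≤ v := by linarith
  have key : 0 ≤ 909 / 312500 * v ^ 8
      + 1143 / 78125 * u ^ 1 * v ^ 7
      + 898747 / 31250000 * u ^ 2 * v ^ 6
      + 41684647 / 1562500000 * u ^ 3 * v ^ 5
      + 3283738547 / 312500000000 * u ^ 4 * v ^ 4
      + 49945541 / 39062500000 * u ^ 5 * v ^ 3
      + 1533767629 / 781250000000 * u ^ 6 * v ^ 2
      + 1311422447 / 610351562500 * u ^ 7 * v ^ 1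
      + 581957569463 / 976562500000000 * u ^ 8 := by positivity
  rw [hv] at key
  rw [← sub_nonneg]
  refine key.trans_eq ?_
  ring

lemma range_bound_near_one' {b : ℝ} (h1 : (51 / 50) ≤ b) (h2 : b ≤ (26 / 25)) :
    (4 / 5 - ((23 / 20 - b) / (4 / 25)) ^ 2) *
        (((116 / 125) - (28 / 25)) ^ 2 + 4 * (28 / 25) * (b ^ 2 - 1) ^ 2)
      ≤ 4 * (28 / 25) * (b ^ 2 - 1) ^ 2 * ((116 / 125) - (b ^ 2 - 1) ^ 2) := by
  obtain ⟨u, rfl⟩ : ∃ u, b = (51 / 50) + (1 / 50) * u := ⟨(b - (51 / 50)) / (1 / 50), by ring⟩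
  obtain ⟨v, hv⟩ : ∃ v, v = 1 - u := ⟨_, rfl⟩
  have hu : 0 ≤ u := by linarith
  have hv0 : 0 ≤ v := by linarith
  have key : 0 ≤ 581957569463 / 976562500000000 * v ^ 8
      + 450815324763 / 61035156250000 * u ^ 1 * v ^ 7
      + 18860297251653 / 488281250000000 * u ^ 2 * v ^ 6
      + 6638730634539 / 61035156250000 * u ^ 3 * v ^ 5
      + 35416618285387 / 195312500000000 * u ^ 4 * v ^ 4
      + 5646312377053 / 30517578125000 * u ^ 5 * v ^ 3
      + 13889320586037 / 122070312500000 * u ^ 6 * v ^ 2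
      + 296132556879 / 7629394531250 * u ^ 7 * v ^ 1
      + 344968156683 / 61035156250000 * u ^ 8 := by positivity
  rw [hv] at key
  rw [← sub_nonneg]
  refine key.trans_eq ?_
  ring

/-- The line is the tangent at `h₀ = 0.5`, which lies below the cubic for all `h ≥ 0`. -/
lemma range_bound_left {b : ℝ} (h1 : (26 / 25) ≤ b) (h2 : b ≤ (229 / 200)) :
    (4 / 5 - ((23 / 20 - b) / (4 / 25)) ^ 2) *
        ((1 - (5 / 4)) ^ 2 + 4 * (5 / 4) * (b ^ 2 - 1) ^ 2)
      ≤ 4 * (5 / 4) * (b ^ 2 - 1) ^ 2 * (1 - (b ^ 2 - 1) ^ 2) := by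
  obtain ⟨u, rfl⟩ : ∃ u, b = (26 / 25) + (21 / 200) * u := ⟨(b - (26 / 25)) / (21 / 200), by ring⟩
  obtain ⟨v, hv⟩ : ∃ v, v = 1 - u := ⟨_, rfl⟩
  have hu : 0 ≤ u := by linarith
  have hv0 : 0 ≤ v := by linarith
  have key : 0 ≤ 214242939829 / 125000000000000 * v ^ 8
      + 5597155152941 / 125000000000000 * u ^ 1 * v ^ 7
      + 151360687894087 / 500000000000000 * u ^ 2 * v ^ 6
      + 411825369113837 / 500000000000000 * u ^ 3 * v ^ 5
      + 7014093146916821 / 6400000000000000 * u ^ 4 * v ^ 4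
      + 23612804110951517 / 32000000000000000 * u ^ 5 * v ^ 3
      + 28939784895237517 / 128000000000000000 * u ^ 6 * v ^ 2
      + 1320418562986903 / 64000000000000000 * u ^ 7 * v ^ 1
      + 245827115895139 / 512000000000000000 * u ^ 8 := by positivity
  rw [hv] at key
  rw [← sub_nonneg]
  refine key.trans_eq ?_
  ring

/-- The line is the tangent at `h₀ = 0.43`, usable only for `h ≥ 7/50`; the smaller `h` are left to
a chord. -/
lemma range_bound_middle_tangent {b : ℝ} (h1 : (229 / 200) ≤ b) (h2 : b ≤ (23 / 20)) :
    (4 / 5 - ((23 / 20 - b) / (4 / 25)) ^ 2) *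
        (((512943 / 500000) - (13053 / 10000)) ^ 2 + 4 * (13053 / 10000) * (b ^ 2 - 1) ^ 2)
      ≤ 4 * (13053 / 10000) * (b ^ 2 - 1) ^ 2 * ((512943 / 500000) - (b ^ 2 - 1) ^ 2) := by
  obtain ⟨u, rfl⟩ : ∃ u, b = (229 / 200) + (1 / 200) * u := ⟨(b - (229 / 200)) / (1 / 200), by ring⟩
  obtain ⟨v, hv⟩ : ∃ v, v = 1 - u := ⟨_, rfl⟩
  have hu : 0 ≤ u := by linarith
  have hv0 : 0 ≤ v := by linarith
  have key : 0 ≤ 21392998363514326167 / 6400000000000000000000 * v ^ 8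
      + 4295033523480115863 / 160000000000000000000 * u ^ 1 * v ^ 7
      + 6052537525138835937 / 64000000000000000000 * u ^ 2 * v ^ 6
      + 1527319934189449659 / 8000000000000000000 * u ^ 3 * v ^ 5
      + 483129454466540079 / 2000000000000000000 * u ^ 4 * v ^ 4
      + 78470848884445509 / 400000000000000000 * u ^ 5 * v ^ 3
      + 7988657650642149 / 80000000000000000 * u ^ 6 * v ^ 2
      + 58255897962573 / 2000000000000000 * u ^ 7 * v ^ 1
      + 5964031675107 / 1600000000000000 * u ^ 8 := by positivity
  rw [hv] at key
  rw [← sub_nonneg]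
  refine key.trans_eq ?_
  ring

lemma range_bound_middle_chord {b : ℝ} (h1 : (229 / 200) ≤ b) (h2 : b ≤ (23 / 20)) :
    (4 / 5 - ((23 / 20 - b) / (4 / 25)) ^ 2) *
        ((1 - (2801 / 2500)) ^ 2 + 4 * (2801 / 2500) * (b ^ 2 - 1) ^ 2)
      ≤ 4 * (2801 / 2500) * (b ^ 2 - 1) ^ 2 * (1 - (b ^ 2 - 1) ^ 2) := by
  obtain ⟨u, rfl⟩ : ∃ u, b = (229 / 200) + (1 / 200) * u := ⟨(b - (229 / 200)) / (1 / 200), by ring⟩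
  obtain ⟨v, hv⟩ : ∃ v, v = 1 - u := ⟨_, rfl⟩
  have hu : 0 ≤ u := by linarith
  have hv0 : 0 ≤ v := by linarith
  have key : 0 ≤ 53774195951622284339 / 1600000000000000000000 * v ^ 8
      + 10729417234197751811 / 40000000000000000000 * u ^ 1 * v ^ 7
      + 14988037674648576373 / 16000000000000000000 * u ^ 2 * v ^ 6
      + 747874993387452963 / 400000000000000000 * u ^ 3 * v ^ 5
      + 18662172866505089 / 8000000000000000 * u ^ 4 * v ^ 4
      + 3726230943936711 / 2000000000000000 * u ^ 5 * v ^ 3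
      + 1488323039248653 / 1600000000000000 * u ^ 6 * v ^ 2
      + 5308869816637 / 20000000000000 * u ^ 7 * v ^ 1
      + 530354274319 / 16000000000000 * u ^ 8 := by positivity
  rw [hv] at key
  rw [← sub_nonneg]
  refine key.trans_eq ?_
  ring

lemma range_bound_right_tangent {b : ℝ} (h1 : (23 / 20) ≤ b) (h2 : b ≤ (5 / 4)) :
    (4 / 5 - ((b - 23 / 20) / (7 / 25)) ^ 2) *
        (((512943 / 500000) - (13053 / 10000)) ^ 2 + 4 * (13053 / 10000) * (b ^ 2 - 1) ^ 2)
      ≤ 4 * (13053 / 10000) * (b ^ 2 - 1) ^ 2 * ((512943 / 500000) - (b ^ 2 - 1) ^ 2) := by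
  obtain ⟨u, rfl⟩ : ∃ u, b = (23 / 20) + (1 / 10) * u := ⟨(b - (23 / 20)) / (1 / 10), by ring⟩
  obtain ⟨v, hv⟩ : ∃ v, v = 1 - u := ⟨_, rfl⟩
  have hu : 0 ≤ u := by linarith
  have hv0 : 0 ≤ v := by linarith
  have key : 0 ≤ 5964031675107 / 1600000000000000 * v ^ 8
      + 8732869252101 / 200000000000000 * u ^ 1 * v ^ 7
      + 479177782860531 / 2800000000000000 * u ^ 2 * v ^ 6
      + 3193666530064179 / 9800000000000000 * u ^ 3 * v ^ 5
      + 13474644860752569 / 39200000000000000 * u ^ 4 * v ^ 4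
      + 61422331137201 / 280000000000000 * u ^ 5 * v ^ 3
      + 391785114303777 / 3920000000000000 * u ^ 6 * v ^ 2
      + 75088555377201 / 1960000000000000 * u ^ 7 * v ^ 1
      + 136040069532951 / 15680000000000000 * u ^ 8 := by positivity
  rw [hv] at key
  rw [← sub_nonneg]
  refine key.trans_eq ?_
  ring

lemma range_bound_right_chord {b : ℝ} (h1 : (23 / 20) ≤ b) (h2 : b ≤ (5 / 4)) :
    (4 / 5 - ((b - 23 / 20) / (7 / 25)) ^ 2) *
        ((1 - (2801 / 2500)) ^ 2 + 4 * (2801 / 2500) * (b ^ 2 - 1) ^ 2)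
      ≤ 4 * (2801 / 2500) * (b ^ 2 - 1) ^ 2 * (1 - (b ^ 2 - 1) ^ 2) := by
  obtain ⟨u, rfl⟩ : ∃ u, b = (23 / 20) + (1 / 10) * u := ⟨(b - (23 / 20)) / (1 / 10), by ring⟩
  obtain ⟨v, hv⟩ : ∃ v, v = 1 - u := ⟨_, rfl⟩
  have hu : 0 ≤ u := by linarith
  have hv0 : 0 ≤ v := by linarith
  have key : 0 ≤ 530354274319 / 16000000000000 * v ^ 8
      + 20788005097 / 80000000000 * u ^ 1 * v ^ 7
      + 6674755201521 / 7840000000000 * u ^ 2 * v ^ 6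
      + 237291558807 / 156800000000 * u ^ 3 * v ^ 5
      + 4963002183457 / 3136000000000 * u ^ 4 * v ^ 4
      + 772979832963 / 784000000000 * u ^ 5 * v ^ 3
      + 79238716859 / 224000000000 * u ^ 6 * v ^ 2
      + 53136346709 / 784000000000 * u ^ 7 * v ^ 1
      + 37979632459 / 6272000000000 * u ^ 8 := by positivity
  rw [hv] at key
  rw [← sub_nonneg]
  refine key.trans_eq ?_
  ring

lemma range_bound_right_tangent' {b : ℝ} (h1 : (5 / 4) ≤ b) (h2 : b ≤ (141 / 100)) :
    (4 / 5 - ((b - 23 / 20) / (7 / 25)) ^ 2) *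
        (((512943 / 500000) - (13053 / 10000)) ^ 2 + 4 * (13053 / 10000) * (b ^ 2 - 1) ^ 2)
      ≤ 4 * (13053 / 10000) * (b ^ 2 - 1) ^ 2 * ((512943 / 500000) - (b ^ 2 - 1) ^ 2) := by
  obtain ⟨u, rfl⟩ : ∃ u, b = (5 / 4) + (4 / 25) * u := ⟨(b - (5 / 4)) / (4 / 25), by ring⟩
  obtain ⟨v, hv⟩ : ∃ v, v = 1 - u := ⟨_, rfl⟩
  have hu : 0 ≤ u := by linarith
  have hv0 : 0 ≤ v := by linarith
  have key : 0 ≤ 136040069532951 / 15680000000000000 * v ^ 8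
      + 233562492182151 / 1960000000000000 * u ^ 1 * v ^ 7
      + 15336142588743621 / 19600000000000000 * u ^ 2 * v ^ 6
      + 143600795116852329 / 49000000000000000 * u ^ 3 * v ^ 5
      + 160767949582721449449 / 24500000000000000000 * u ^ 4 * v ^ 4
      + 54504069976895006949 / 6125000000000000000 * u ^ 5 * v ^ 3
      + 87596455414604825397 / 12250000000000000000 * u ^ 6 * v ^ 2
      + 19172052720747000339 / 6125000000000000000 * u ^ 7 * v ^ 1
      + 704038165190063316363 / 1225000000000000000000 * u ^ 8 := by positivity
  rw [hv] at key
  rw [← sub_nonneg]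
  refine key.trans_eq ?_
  ring

lemma range_bound_right_chord' {b : ℝ} (h1 : (5 / 4) ≤ b) (h2 : b ≤ (141 / 100)) :
    (4 / 5 - ((b - 23 / 20) / (7 / 25)) ^ 2) *
        ((1 - (2801 / 2500)) ^ 2 + 4 * (2801 / 2500) * (b ^ 2 - 1) ^ 2)
      ≤ 4 * (2801 / 2500) * (b ^ 2 - 1) ^ 2 * (1 - (b ^ 2 - 1) ^ 2) := by
  obtain ⟨u, rfl⟩ : ∃ u, b = (5 / 4) + (4 / 25) * u := ⟨(b - (5 / 4)) / (4 / 25), by ring⟩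
  obtain ⟨v, hv⟩ : ∃ v, v = 1 - u := ⟨_, rfl⟩
  have hu : 0 ≤ u := by linarith
  have hv0 : 0 ≤ v := by linarith
  have key : 0 ≤ 37979632459 / 6272000000000 * v ^ 8
      + 13728889659 / 784000000000 * u ^ 1 * v ^ 7
      + 17499025963 / 224000000000 * u ^ 2 * v ^ 6
      + 2565391932337 / 3920000000000 * u ^ 3 * v ^ 5
      + 4625383231382257 / 1960000000000000 * u ^ 4 * v ^ 4
      + 2047062518772109 / 490000000000000 * u ^ 5 * v ^ 3
      + 68992232376863567 / 17500000000000000 * u ^ 6 * v ^ 2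
      + 586049922660093051 / 306250000000000000 * u ^ 7 * v ^ 1
      + 115388379351028516671 / 306250000000000000000 * u ^ 8 := by positivity
  rw [hv] at key
  rw [← sub_nonneg]
  refine key.trans_eq ?_
  ring

/-- The cycles around three equilibria are not tangent to the rays through the central one. -/
lemma not_tangent_of_range {γ b t c : ℝ} (hγ : 0 < γ) (hγ8 : γ ≤ 0.8) (hb : 1 < b)
    (h1 : 1.15 - 0.16 * √(0.8 - γ) < b) (h2 : b < 1.15 + 0.28 * √(0.8 - γ))
    (ht : 0 < t) (ht1 : t < 1) (hc : 0 < c)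
    (hE : (c ^ 2 - 1) ^ 2 = (b ^ 2 - 1) ^ 2 + γ * t * (2 - t)) :
    γ * t * (1 - t) < c * ((b ^ 2 - 1) ^ 2 + γ * t) := by
  have hm : 0 < (b ^ 2 - 1) ^ 2 := by
    have : 0 < b ^ 2 - 1 := by nlinarith
    positivity
  obtain ⟨hL, hR⟩ := initial_range_sq hγ8 h1 h2
  refine lt_mul_of_line hγ hm ht ht1 hc ?_ hE
  intro h hh
  -- The chord joins the points of the cubic at `0` and `7/50`; the third intersection is at
  -- `43/50`. It covers exactly the `h` at which the tangent at `0.43` fails.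
  have chord : h ≤ (7 / 50) → 1 - (2801 / 2500) * h ≤ (1 - h) ^ 2 * (1 + h) := by
    intro hh1
    have : (1 - h) ^ 2 * (1 + h) - (1 - (2801 / 2500) * h) = h * (((7 / 50) - h) * ((43 / 50) - h)) := by
      ring
    have : 0 ≤ h * (((7 / 50) - h) * ((43 / 50) - h)) :=
      mul_nonneg hh.le (mul_nonneg (by linarith) (by linarith))
    linarith
  rcases le_total b (23 / 20) with hb15 | hb15
  · have hg := hL hb15
    rcases le_total b (26 / 25) with hb04 | hb04
    · refine ⟨(116 / 125), (28 / 25), by norm_num, ?_,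
        (mul_lt_mul_of_pos_right hg (by positivity)).trans_le ?_⟩
      · have := tangent_le 0.6 h (by linarith)
        norm_num at this ⊢; linarith
      · rcases le_total b (51 / 50) with hb02 | hb02
        · exact range_bound_near_one (by linarith) hb02
        · exact range_bound_near_one' hb02 hb04
    · rcases le_total b (229 / 200) with hb145 | hb145
      · refine ⟨1, (5 / 4), by norm_num, ?_,
          (mul_lt_mul_of_pos_right hg (by positivity)).trans_le (range_bound_left hb04 hb145)⟩
        have := tangent_le 0.5 h (by linarith)
        norm_num at this ⊢; linarith
      · rcases le_total h (7 / 50) with hh1 | hh1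
        · exact ⟨1, (2801 / 2500), by norm_num, chord hh1,
            (mul_lt_mul_of_pos_right hg (by positivity)).trans_le
              (range_bound_middle_chord hb145 hb15)⟩
        · refine ⟨(512943 / 500000), (13053 / 10000), by norm_num, ?_,
            (mul_lt_mul_of_pos_right hg (by positivity)).trans_le
              (range_bound_middle_tangent hb145 hb15)⟩
          have := tangent_le 0.43 h (by linarith)
          norm_num at this ⊢; linarith
  · have hg := hR hb15
    -- Beyond this value the range would force `γ < 4/5 - (9/10)² < 0`.
    have hb41 : b ≤ (141 / 100) := by
      by_contra hcon
      push Not at hcon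
      have h9 : (9 / 10 : ℝ) ≤ (b - 23 / 20) / (7 / 25) := by
        rw [le_div_iff₀ (by norm_num)]; linarith
      nlinarith
    rcases le_total h (7 / 50) with hh1 | hh1
    · refine ⟨1, (2801 / 2500), by norm_num, chord hh1,
        (mul_lt_mul_of_pos_right hg (by positivity)).trans_le ?_⟩
      rcases le_total b (5 / 4) with hb25 | hb25
      · exact range_bound_right_chord hb15 hb25
      · exact range_bound_right_chord' hb25 hb41
    · refine ⟨(512943 / 500000), (13053 / 10000), by norm_num, ?_,
        (mul_lt_mul_of_pos_right hg (by positivity)).trans_le ?_⟩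
      · have := tangent_le 0.43 h (by linarith)
        norm_num at this ⊢; linarith
      · rcases le_total b (5 / 4) with hb25 | hb25
        · exact range_bound_right_tangent hb15 hb25
        · exact range_bound_right_tangent' hb25 hb41

/-! ### Sign of the angular momentum on the level curves. -/

/-- The angular momentum of the unperturbed field about `(k, l)`. -/
def angular (γ k l c s : ℝ) : ℝ := γ * (s ^ 3 - s) * (s - l) + (c - k) * (c ^ 3 - c)

/-- Only `0 < s² < 1` is delicate, since elsewhere both terms of the expansion are nonnegative and
one is positive. There, multiplying by `c + 1` and eliminating `(c² - 1)²` by the energy reduces the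
claim to `not_tangent_of_range`. -/
lemma angular_pos_three {γ b c s : ℝ} (hγ : 0 < γ) (hγ8 : γ ≤ 0.8) (hb : 1 < b)
    (h1 : 1.15 - 0.16 * √(0.8 - γ) < b) (h2 : b < 1.15 + 0.28 * √(0.8 - γ)) (hc : 0 < c)
    (hE : (c ^ 2 - 1) ^ 2 + γ * (s ^ 2 - 1) ^ 2 = (b ^ 2 - 1) ^ 2 + γ) :
    0 < angular γ 1 0 c s := by
  have hm : 0 < (b ^ 2 - 1) ^ 2 := by
    have : 0 < b ^ 2 - 1 := by nlinarith
    positivity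
  have hexp : angular γ 1 0 c s = γ * s ^ 2 * (s ^ 2 - 1) + (c - 1) ^ 2 * (c * (c + 1)) := by
    unfold angular; ring
  rw [hexp]
  obtain ⟨t, ht⟩ : ∃ t, t = s ^ 2 := ⟨_, rfl⟩
  have ht0 : 0 ≤ t := by rw [ht]; positivity
  rw [← ht] at hE ⊢
  have hcc : 0 < c * (c + 1) := by positivity
  have hc1 : 0 < (c - 1) ^ 2 ∨ t > 1 := by
    by_cases hc1 : c = 1
    · right
      subst hc1
      by_contra hcon
      push Not at hcon
      have : γ * (t - 1) ^ 2 ≤ γ * 1 := by gcongr; nlinarith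
      nlinarith
    · left
      have := sub_ne_zero.2 hc1
      positivity
  rcases lt_or_ge 1 t with h | h
  · have : 0 < γ * t * (t - 1) := mul_pos (by positivity) (by linarith)
    have : 0 ≤ (c - 1) ^ 2 * (c * (c + 1)) := by positivity
    linarith
  · have hc2 : 0 < (c - 1) ^ 2 := hc1.resolve_right (not_lt.2 h)
    have hpos : 0 < (c - 1) ^ 2 * (c * (c + 1)) := by positivity
    rcases h.eq_or_lt with h | h
    · rw [h]; linarith
    rcases ht0.eq_or_lt with h0 | h0
    · rw [← h0]; linarith
    have key := not_tangent_of_range hγ hγ8 hb h1 h2 h0 h hc (by linarith)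
    have e : (c + 1) * ((c - 1) ^ 2 * (c * (c + 1))) = c * ((b ^ 2 - 1) ^ 2 + γ * t * (2 - t)) := by
      linear_combination c * hE
    have : 0 < (c + 1) * (γ * t * (t - 1) + (c - 1) ^ 2 * (c * (c + 1))) := by
      rw [mul_add, e]
      linarith
    exact pos_of_mul_pos_right this (by linarith)

lemma pos_of_continuous_of_ne_zero {f : ℝ → ℝ} (hf : Continuous f) (h0 : ∀ x, f x ≠ 0)
    (a : ℝ) (ha : 0 < f a) (x : ℝ) : 0 < f x := by
  by_contra hx
  push Not at hx
  obtain ⟨y, hy⟩ := mem_range_of_exists_le_of_exists_ge hf ⟨x, hx⟩ ⟨a, ha.le⟩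
  exact h0 y hy

/-- Outer cycles have nonvanishing angular momentum about the origin. -/
lemma angular_pos_outer {γ c s a : ℝ} (hγ : 0 < γ) (hγ1 : γ ≤ 1) (ha : 1 < a)
    (hE : (c ^ 2 - 1) ^ 2 + γ * (s ^ 2 - 1) ^ 2 = a) (hout : 1 < max (c ^ 2) (s ^ 2)) :
    0 < angular γ 0 0 c s := by
  obtain ⟨u, hu⟩ : ∃ u, u = c ^ 2 - 1 := ⟨_, rfl⟩
  obtain ⟨v, hv⟩ : ∃ v, v = s ^ 2 - 1 := ⟨_, rfl⟩
  have hexp : angular γ 0 0 c s = u ^ 2 + u + γ * (v ^ 2 + v) := by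
    rw [hu, hv]; unfold angular; ring
  rw [hexp]
  have hu1 : -1 ≤ u := by rw [hu]; nlinarith [sq_nonneg c]
  have hv1 : -1 ≤ v := by rw [hv]; nlinarith [sq_nonneg s]
  rw [← hu, ← hv] at hE
  have hor : 0 < u ∨ 0 < v := by
    rcases lt_max_iff.1 hout with h | h
    · left; linarith
    · right; linarith
  -- By the energy relation the expression equals `a + u + γ v`; one of `u`, `v` is positive, the
  -- other is at least `-1`, and `a > 1 ≥ γ`.
  rcases hor with h | h <;> nlinarith [mul_pos hγ h, mul_nonneg hγ.le (by linarith : 0 ≤ v + 1)]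

/-- Inner cycles have nonvanishing angular momentum about the origin. -/
lemma angular_neg_inner {γ c s a : ℝ} (hγ : 0 < γ) (ha2 : a < 1 + γ)
    (hE : (c ^ 2 - 1) ^ 2 + γ * (s ^ 2 - 1) ^ 2 = a) (hin : max (c ^ 2) (s ^ 2) < 1) :
    angular γ 0 0 c s < 0 := by
  obtain ⟨hc, hs⟩ := max_lt_iff.1 hin
  have hexp : angular γ 0 0 c s = -(c ^ 2 * (1 - c ^ 2) + γ * (s ^ 2 * (1 - s ^ 2))) := by
    unfold angular; ring
  rw [hexp]
  have h1 : 0 ≤ c ^ 2 * (1 - c ^ 2) := mul_nonneg (sq_nonneg c) (by linarith)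
  have h2 : 0 ≤ s ^ 2 * (1 - s ^ 2) := mul_nonneg (sq_nonneg s) (by linarith)
  -- Both nonnegative terms vanish only at the origin, whose energy `1 + γ` exceeds `a`.
  by_cases hc0 : c = 0
  · have hs0 : s ≠ 0 := by
      rintro rfl
      subst hc0
      norm_num at hE
      linarith
    have : 0 < s ^ 2 * (1 - s ^ 2) := mul_pos (by positivity) (by linarith)
    nlinarith
  · have : 0 < c ^ 2 * (1 - c ^ 2) := mul_pos (by positivity) (by linarith)
    nlinarith

/-- Since `k² = 1`, one has `(c - k)(c³ - c) = (c - k)² (c² + k c)`, and likewise in `s`; in the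
quadrant of `(k, l)` the second factors are positive. -/
lemma angular_pos_one {γ k l c s : ℝ} (hγ : 0 < γ) (hk : k ^ 2 = 1) (hl : l ^ 2 = 1)
    (hc : 0 < k * c) (hs : 0 < l * s) (hne : (c - k) ^ 2 + (s - l) ^ 2 ≠ 0) :
    0 < angular γ k l c s := by
  have hexp : angular γ k l c s
      = γ * ((s - l) ^ 2 * (s ^ 2 + l * s)) + (c - k) ^ 2 * (c ^ 2 + k * c) := by
    unfold angular
    linear_combination γ * ((s - l) * s) * hl + (c - k) * c * hk
  rw [hexp]
  have h1 : 0 < s ^ 2 + l * s := by positivity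
  have h2 : 0 < c ^ 2 + k * c := by positivity
  by_cases hc1 : (c - k) ^ 2 = 0
  · have : 0 < (s - l) ^ 2 := by
      rcases (sq_nonneg (s - l)).eq_or_lt with h | h
      · exact absurd (by rw [hc1, ← h]; ring) hne
      · exact h
    positivity
  · have : 0 < (c - k) ^ 2 := lt_of_le_of_ne (sq_nonneg _) (Ne.symm hc1)
    positivity

/-! ### The generating cycle: conservation of energy and star-shapedness. -/

namespace CycleParam

variable {γ : ℝ} {k l : ℤ} {b : ℝ} (G : CycleParam γ k l b)

lemma continuous_C : Continuous G.C :=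
  continuous_iff_continuousAt.2 fun φ => (G.hasDerivAt_C φ).continuousAt

lemma continuous_S : Continuous G.S :=
  continuous_iff_continuousAt.2 fun φ => (G.hasDerivAt_S φ).continuousAt

lemma ω_pos : 0 < G.ω := G.isLeast_ω.1.1

lemma periodic_C : Function.Periodic G.C G.ω := G.isLeast_ω.1.2.1

lemma periodic_S : Function.Periodic G.S G.ω := G.isLeast_ω.1.2.2

lemma deriv_C : deriv G.C = fun φ => γ * (G.S φ ^ 3 - G.S φ) :=
  funext fun φ => (G.hasDerivAt_C φ).deriv

lemma deriv_S : deriv G.S = fun φ => -(G.C φ ^ 3 - G.C φ) :=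
  funext fun φ => (G.hasDerivAt_S φ).deriv

lemma α_eq (φ : ℝ) : G.α φ = angular γ k l (G.C φ) (G.S φ) := by
  unfold α angular
  rw [deriv_C, deriv_S]
  ring

/-- The conserved quantity is `4 H`, where `H` is the Hamiltonian. -/
lemma energy (φ : ℝ) : (G.C φ ^ 2 - 1) ^ 2 + γ * (G.S φ ^ 2 - 1) ^ 2
    = (b ^ 2 - 1) ^ 2 + γ * ((l : ℝ) ^ 2 - 1) ^ 2 := by
  have hd : ∀ x, HasDerivAt (fun φ => (G.C φ ^ 2 - 1) ^ 2 + γ * (G.S φ ^ 2 - 1) ^ 2) 0 x := by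
    intro x
    have hC := G.hasDerivAt_C x
    have hS := G.hasDerivAt_S x
    have := (((hC.pow 2).sub_const 1).pow 2).add ((((hS.pow 2).sub_const 1).pow 2).const_mul γ)
    refine this.congr_deriv ?_
    simp
    ring
  have := is_const_of_deriv_eq_zero (fun x => (hd x).differentiableAt) (fun x => (hd x).deriv) φ 0
  rw [this, G.C_zero, G.S_zero]

variable {σ : ℝ}

lemma sq_gt_of_sqrt_lt (hγ : 0 < γ) (hγ1 : γ ≤ 1) (hσ : √(1 + 1 / √γ) < σ) :
    0 < σ ∧ 2 < σ ^ 2 ∧ 1 < γ * (σ ^ 2 - 1) ^ 2 := by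
  have hsγ : 0 < √γ := Real.sqrt_pos.2 hγ
  have hsγ2 : √γ ^ 2 = γ := Real.sq_sqrt hγ.le
  have hsγ1 : √γ ≤ 1 := by nlinarith
  have hσ0 : 0 < σ := (Real.sqrt_nonneg _).trans_lt hσ
  have hσ2 : 1 + 1 / √γ < σ ^ 2 := (Real.sqrt_lt' hσ0).1 hσ
  have hinv : 1 ≤ 1 / √γ := by rw [le_div_iff₀ hsγ]; linarith
  have h1 : 1 / √γ < σ ^ 2 - 1 := by linarith
  rw [div_lt_iff₀ hsγ] at h1
  refine ⟨hσ0, by linarith, ?_⟩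
  have : γ * (σ ^ 2 - 1) ^ 2 = ((σ ^ 2 - 1) * √γ) ^ 2 := by rw [mul_pow, hsγ2]; ring
  rw [this]
  nlinarith

lemma abs_lt_of_energy_lt (hγ : 0 < γ) (hγ1 : γ ≤ 1) (hσ : 0 < σ) (hσ2 : 2 < σ ^ 2) {c s : ℝ}
    (h : (c ^ 2 - 1) ^ 2 + γ * (s ^ 2 - 1) ^ 2 < γ * (σ ^ 2 - 1) ^ 2) : |c| < σ ∧ |s| < σ := by
  have h1 : 0 ≤ (c ^ 2 - 1) ^ 2 := sq_nonneg _
  have h2 : 0 ≤ γ * (s ^ 2 - 1) ^ 2 := by positivity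
  have h3 : 0 < σ ^ 2 - 1 := by linarith
  constructor
  · apply abs_lt_of_sq_lt_sq _ hσ.le
    have : (c ^ 2 - 1) ^ 2 < (σ ^ 2 - 1) ^ 2 := by nlinarith [sq_nonneg (σ ^ 2 - 1)]
    have := (abs_lt.1 (abs_lt_of_sq_lt_sq this h3.le)).2
    linarith
  · apply abs_lt_of_sq_lt_sq _ hσ.le
    have : (s ^ 2 - 1) ^ 2 < (σ ^ 2 - 1) ^ 2 := by
      have : γ * (s ^ 2 - 1) ^ 2 < γ * (σ ^ 2 - 1) ^ 2 := by linarith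
      exact lt_of_mul_lt_mul_left this hγ.le
    have := (abs_lt.1 (abs_lt_of_sq_lt_sq this h3.le)).2
    linarith

lemma sq_cast_eq_one {k : ℤ} (hk : k = 1 ∨ k = -1) : (k : ℝ) ^ 2 = 1 := by
  rcases hk with rfl | rfl <;> norm_num

/-- In both ranges the energy exceeds `1`, while on the boundary of the unit square it is at most
`1`. So the cycle never meets that boundary and stays on the side of its initial point `(b, 0)`. -/
lemma star_shaped_origin {γ b : ℝ} (G : CycleParam γ 0 0 b)
    (hγ : 0 < γ) (hγ1 : γ ≤ 1) (hσ : √(1 + 1 / √γ) < σ)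
    (hb : (0 < b ∧ b < √(1 - √(1 - γ))) ∨
      (√(1 + √(1 - γ)) < b ∧ b < √(1 + √(γ * σ ^ 2 * (σ ^ 2 - 2))))) (φ : ℝ) :
    G.α φ ≠ 0 ∧ |G.C φ| < σ ∧ |G.S φ| < σ := by
  obtain ⟨hσ0, hσ2, hσγ⟩ := sq_gt_of_sqrt_lt hγ hγ1 hσ
  have hE := G.energy
  rw [α_eq]
  simp only [Int.cast_zero] at hE ⊢
  have hcont : Continuous fun φ => max (G.C φ ^ 2) (G.S φ ^ 2) :=
    (G.continuous_C.pow 2).max (G.continuous_S.pow 2)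
  have hs1 : √(1 - γ) ^ 2 = 1 - γ := Real.sq_sqrt (by linarith)
  have hs10 := Real.sqrt_nonneg (1 - γ)
  have hs11 : √(1 - γ) < 1 := by nlinarith
  have hb0 : 0 < b := by
    rcases hb with hb | hb
    · exact hb.1
    · exact (Real.sqrt_nonneg _).trans_lt hb.1
  have ha1 : 1 < (b ^ 2 - 1) ^ 2 + γ := by
    rcases hb with ⟨h0, h1⟩ | ⟨h1, -⟩
    · have := (Real.lt_sqrt hb0.le).1 h1
      nlinarith
    · have := (Real.sqrt_lt' hb0).1 h1
      nlinarith
  have hne : ∀ φ, max (G.C φ ^ 2) (G.S φ ^ 2) ≠ 1 := by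
    intro φ h
    have hEφ := hE φ
    have hle1 : G.C φ ^ 2 ≤ 1 := h ▸ le_max_left _ _
    have hle2 : G.S φ ^ 2 ≤ 1 := h ▸ le_max_right _ _
    rcases max_choice (G.C φ ^ 2) (G.S φ ^ 2) with h' | h' <;> rw [h'] at h <;>
      nlinarith [sq_nonneg (G.C φ), sq_nonneg (G.S φ)]
  have hmax0 : max (G.C 0 ^ 2) (G.S 0 ^ 2) = b ^ 2 := by
    rw [G.C_zero, G.S_zero]; simp; positivity
  rcases hb with ⟨-, h1⟩ | ⟨h1, h2⟩
  · have hb2 := (Real.lt_sqrt hb0.le).1 h1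
    have hin : ∀ φ, max (G.C φ ^ 2) (G.S φ ^ 2) < 1 := by
      intro φ
      have := pos_of_continuous_of_ne_zero (f := fun φ => 1 - max (G.C φ ^ 2) (G.S φ ^ 2))
        (continuous_const.sub hcont) (fun x => sub_ne_zero.2 (hne x).symm) 0
        (by simp only [hmax0]; linarith) φ
      linarith
    refine ⟨(angular_neg_inner hγ ?_ (hE φ) (hin φ)).ne, ?_⟩
    · have : 0 < b ^ 2 := by positivity
      nlinarith
    · obtain ⟨hc, hs⟩ := max_lt_iff.1 (hin φ)
      exact ⟨abs_lt_of_sq_lt_sq (by linarith) hσ0.le, abs_lt_of_sq_lt_sq (by linarith) hσ0.le⟩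
  · have hb1 := (Real.sqrt_lt' hb0).1 h1
    have hin : ∀ φ, 1 < max (G.C φ ^ 2) (G.S φ ^ 2) := by
      intro φ
      have := pos_of_continuous_of_ne_zero (f := fun φ => max (G.C φ ^ 2) (G.S φ ^ 2) - 1)
        (hcont.sub continuous_const) (fun x => sub_ne_zero.2 (hne x)) 0
        (by simp only [hmax0]; nlinarith) φ
      linarith
    refine ⟨(angular_pos_outer hγ hγ1 ha1 (by rw [hE φ]; ring) (hin φ)).ne',
      abs_lt_of_energy_lt hγ hγ1 hσ0 hσ2 ?_⟩
    rw [hE φ]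
    have hpos : 0 ≤ γ * σ ^ 2 * (σ ^ 2 - 2) := by
      have : 0 ≤ σ ^ 2 - 2 := by linarith
      positivity
    have h3 := (Real.lt_sqrt hb0.le).1 h2
    have h4 := Real.sq_sqrt hpos
    have h5 := Real.sqrt_nonneg (γ * σ ^ 2 * (σ ^ 2 - 2))
    nlinarith

/-- The energy is less than `1`, which is the least energy on `C = 0`, so `C` keeps the sign of `k`;
the reflection `C ↦ k C` reduces to `k = 1`. -/
lemma star_shaped_three {γ b : ℝ} {k : ℤ} (G : CycleParam γ k 0 b)
    (hγ : 0 < γ) (hγ1 : γ ≤ 1) (hσ : √(1 + 1 / √γ) < σ)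
    (hk : k = 1 ∨ k = -1) (hb1 : 1 < k * b) (hb2 : k * b < √(1 + √(1 - γ))) (hγ8 : γ ≤ 0.8)
    (hb3 : 1.15 - 0.16 * √(0.8 - γ) < k * b) (hb4 : k * b < 1.15 + 0.28 * √(0.8 - γ)) (φ : ℝ) :
    G.α φ ≠ 0 ∧ |G.C φ| < σ ∧ |G.S φ| < σ := by
  obtain ⟨hσ0, hσ2, hσγ⟩ := sq_gt_of_sqrt_lt hγ hγ1 hσ
  have hE := G.energy
  rw [α_eq]
  simp only [Int.cast_zero] at hE ⊢
  have hk2 := sq_cast_eq_one hk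
  have hs1 : √(1 - γ) ^ 2 = 1 - γ := Real.sq_sqrt (by linarith)
  have hs10 := Real.sqrt_nonneg (1 - γ)
  have hkb0 : 0 < k * b := by linarith
  have hbb : (k * b) ^ 2 = b ^ 2 := by rw [mul_pow, hk2, one_mul]
  have h2 := (Real.lt_sqrt hkb0.le).1 hb2
  rw [hbb] at h2
  have hb1' : 1 < b ^ 2 := by rw [← hbb]; nlinarith
  have ha1 : (b ^ 2 - 1) ^ 2 + γ < 1 := by nlinarith
  have hcne : ∀ φ, k * G.C φ ≠ 0 := by
    intro φ h
    have hk0 : (k : ℝ) ≠ 0 := by rintro h; rw [h] at hk2; norm_num at hk2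
    have := (mul_eq_zero.1 h).resolve_left hk0
    have hEφ := hE φ
    rw [this] at hEφ
    nlinarith [mul_nonneg hγ.le (sq_nonneg (G.S φ ^ 2 - 1))]
  have hc := pos_of_continuous_of_ne_zero (f := fun φ => k * G.C φ)
      (continuous_const.mul G.continuous_C) hcne 0
    (by simp only [G.C_zero]; exact hkb0) φ
  have hang : angular γ k 0 (G.C φ) (G.S φ) = angular γ 1 0 (k * G.C φ) (G.S φ) := by
    unfold angular
    rcases hk with rfl | rfl <;> push_cast <;> ring
  refine ⟨?_, abs_lt_of_energy_lt hγ hγ1 hσ0 hσ2 ?_⟩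
  · rw [hang]
    refine (angular_pos_three hγ hγ8 hb1 hb3 hb4 hc ?_).ne'
    rw [mul_pow, mul_pow, hk2, one_mul, one_mul, hE φ]; ring
  · rw [hE φ]; linarith

/-- The energy is less than `γ ≤ 1`, which keeps the cycle off both axes; it is positive, which
keeps the cycle away from the equilibrium `(k, l)`. -/
lemma star_shaped_one
    (hγ : 0 < γ) (hγ1 : γ ≤ 1) (hσ : √(1 + 1 / √γ) < σ)
    (hk : k = 1 ∨ k = -1) (hl : l = 1 ∨ l = -1) (hb1 : 1 < k * b)
    (hb2 : k * b < √(1 + √γ)) (φ : ℝ) :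
    G.α φ ≠ 0 ∧ |G.C φ| < σ ∧ |G.S φ| < σ := by
  obtain ⟨hσ0, hσ2, hσγ⟩ := sq_gt_of_sqrt_lt hγ hγ1 hσ
  have hE := G.energy
  rw [α_eq]
  have hk2 := sq_cast_eq_one hk
  have hl2 := sq_cast_eq_one hl
  rw [hl2] at hE
  have hkb0 : 0 < k * b := by linarith
  have hbb : (k * b) ^ 2 = b ^ 2 := by rw [mul_pow, hk2, one_mul]
  have h2 := (Real.lt_sqrt hkb0.le).1 hb2
  rw [hbb] at h2
  have hs1 : √γ ^ 2 = γ := Real.sq_sqrt hγ.le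
  have hb1' : 1 < b ^ 2 := by rw [← hbb]; nlinarith
  have ha1 : (b ^ 2 - 1) ^ 2 < γ := by nlinarith
  have hk0 : (k : ℝ) ≠ 0 := by rintro h; rw [h] at hk2; norm_num at hk2
  have hl0 : (l : ℝ) ≠ 0 := by rintro h; rw [h] at hl2; norm_num at hl2
  have hcne : ∀ φ, k * G.C φ ≠ 0 := by
    intro φ h
    have := (mul_eq_zero.1 h).resolve_left hk0
    have hEφ := hE φ
    rw [this] at hEφ
    nlinarith [mul_nonneg hγ.le (sq_nonneg (G.S φ ^ 2 - 1))]
  have hsne : ∀ φ, l * G.S φ ≠ 0 := by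
    intro φ h
    have := (mul_eq_zero.1 h).resolve_left hl0
    have hEφ := hE φ
    rw [this] at hEφ
    nlinarith [sq_nonneg (G.C φ ^ 2 - 1)]
  have hc := pos_of_continuous_of_ne_zero (f := fun φ => k * G.C φ)
      (continuous_const.mul G.continuous_C) hcne 0
    (by simp only [G.C_zero]; exact hkb0) φ
  have hs := pos_of_continuous_of_ne_zero (f := fun φ => l * G.S φ)
      (continuous_const.mul G.continuous_S) hsne 0
    (by simp only [G.S_zero]; nlinarith) φ
  refine ⟨(angular_pos_one hγ hk2 hl2 hc hs ?_).ne', abs_lt_of_energy_lt hγ hγ1 hσ0 hσ2 ?_⟩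
  · intro h
    have e1 : G.C φ = k := by nlinarith [sq_nonneg (G.C φ - k), sq_nonneg (G.S φ - l)]
    have e2 : G.S φ = l := by nlinarith [sq_nonneg (G.C φ - k), sq_nonneg (G.S φ - l)]
    have hEφ := hE φ
    rw [e1, e2, hk2, hl2] at hEφ
    nlinarith
  · rw [hE φ]; nlinarith

/-- The generating cycle is star-shaped about `(k, l)` and lies in the square `|x|, |y| < σ`. -/
theorem star_shaped (hγ : 0 < γ) (hγ1 : γ ≤ 1) (hσ : √(1 + 1 / √γ) < σ)
    (hb : InitialRange γ σ k l b) (φ : ℝ) :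
    G.α φ ≠ 0 ∧ |G.C φ| < σ ∧ |G.S φ| < σ := by
  rcases hb with ⟨rfl, rfl, hb⟩ | ⟨hk, rfl, ⟨hb1, hb2⟩, hγ8, hb3, hb4⟩ | ⟨hk, hl, hb1, hb2⟩
  · exact G.star_shaped_origin hγ hγ1 hσ hb φ
  · exact G.star_shaped_three hγ hγ1 hσ hk hb1 hb2 hγ8 hb3 hb4 φ
  · exact G.star_shaped_one hγ hγ1 hσ hk hl hb1 hb2 φ

end CycleParam

/-! ### Global solutions of scalar equations. -/

/-- A bounded, globally Lipschitz time-dependent scalar field has global solutions. -/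
lemma exists_global_solution {F : ℝ → ℝ → ℝ} {L : NNReal} {M : ℝ}
    (hcont : ∀ x, Continuous fun t => F t x) (hlip : ∀ t, LipschitzWith L (F t))
    (hM : ∀ t x, |F t x| ≤ M) (t₀ x₀ : ℝ) :
    ∃ x : ℝ → ℝ, x t₀ = x₀ ∧ ∀ t, HasDerivAt x (F t (x t)) t := by
  have hM0 : 0 ≤ M := (abs_nonneg _).trans (hM 0 0)
  have hloc : ∀ T : ℝ, 0 < T → ∃ x : ℝ → ℝ, x t₀ = x₀ ∧
      ∀ t ∈ Ioo (t₀ - T) (t₀ + T), HasDerivAt x (F t (x t)) t := by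
    intro T hT
    have hmem : t₀ ∈ Icc (t₀ - T) (t₀ + T) := ⟨by linarith, by linarith⟩
    -- As `M` bounds `F` everywhere, the radius `M T` is enough on the interval of half-length `T`,
    -- for every `T`.
    have hPL : IsPicardLindelof F (⟨t₀, hmem⟩ : Icc (t₀ - T) (t₀ + T)) x₀
        (⟨M * T, by positivity⟩ : NNReal) 0 ⟨M, hM0⟩ L :=
      { lipschitzOnWith := fun t _ => (hlip t).lipschitzOnWith
        continuousOn := fun x _ => (hcont x).continuousOn
        norm_le := fun t _ x _ => hM t x
        mul_max_le := by
          simp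
          exact le_rfl }
    obtain ⟨x, hx0, hx⟩ := hPL.exists_eq_forall_mem_Icc_hasDerivWithinAt₀
    exact ⟨x, hx0, fun t ht => (hx t (Ioo_subset_Icc_self ht)).hasDerivAt (Icc_mem_nhds ht.1 ht.2)⟩
  choose! x hx0 hx using hloc
  have hagree : ∀ T₁ T₂ : ℝ, 0 < T₁ → T₁ ≤ T₂ → EqOn (x T₁) (x T₂) (Ioo (t₀ - T₁) (t₀ + T₁)) := by
    intro T₁ T₂ h1 h12
    have hsub : Ioo (t₀ - T₁) (t₀ + T₁) ⊆ Ioo (t₀ - T₂) (t₀ + T₂) :=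
      Ioo_subset_Ioo (by linarith) (by linarith)
    exact ODE_solution_unique_of_mem_Ioo (v := F) (s := fun _ => univ) (K := L) (t₀ := t₀)
      (fun t _ => (hlip t).lipschitzOnWith) ⟨by linarith, by linarith⟩
      (fun t ht => ⟨hx T₁ h1 t ht, trivial⟩)
      (fun t ht => ⟨hx T₂ (h1.trans_le h12) t (hsub ht), trivial⟩)
      (by rw [hx0 T₁ h1, hx0 T₂ (h1.trans_le h12)])
  -- The value at `t` is read off a solution whose interval contains `t`; by uniqueness the single
  -- solution with half-length `|t - t₀| + 2` gives the same values near `t`.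
  refine ⟨fun t => x (|t - t₀| + 1) t, hx0 _ (by positivity), fun t => ?_⟩
  have hT : 0 < |t - t₀| + 2 := by positivity
  have hmem : ∀ s, |s - t₀| < |t - t₀| + 1 → x (|s - t₀| + 1) s = x (|t - t₀| + 2) s := by
    intro s hs
    refine hagree _ _ (by positivity) (by linarith) ⟨?_, ?_⟩ <;>
      [linarith [neg_abs_le (s - t₀)]; linarith [le_abs_self (s - t₀)]]
  have hev : (fun s => x (|s - t₀| + 1) s) =ᶠ[𝓝 t] x (|t - t₀| + 2) := by
    have : ∀ᶠ s in 𝓝 t, |s - t₀| < |t - t₀| + 1 :=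
      ((continuous_id.sub continuous_const).abs.continuousAt).eventually_lt_const
        (by simp)
    exact this.mono fun s hs => hmem s hs
  have hd := hx (|t - t₀| + 2) hT t
    ⟨by linarith [neg_abs_le (t - t₀)], by linarith [le_abs_self (t - t₀)]⟩
  have hd' : HasDerivAt (x (|t - t₀| + 2)) (F t (x (|t - t₀| + 1) t)) t := by
    rwa [hmem t (by linarith)]
  exact hd'.congr_of_eventuallyEq hev

/-! ### Trapping fields: the periodic solution, its attraction and its dependence on the field. -/

/-- The retraction of the line onto `[-r, r]`. -/
def clamp (r x : ℝ) : ℝ := max (-r) (min r x)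

lemma abs_clamp_le {r : ℝ} (hr : 0 ≤ r) (x : ℝ) : |clamp r x| ≤ r := by
  unfold clamp
  rw [abs_le]
  exact ⟨le_max_left _ _, max_le (by linarith) (min_le_left _ _)⟩

lemma clamp_eq_self {r x : ℝ} (hx : |x| ≤ r) : clamp r x = x := by
  unfold clamp
  rw [abs_le] at hx
  rw [min_eq_right hx.2, max_eq_right hx.1]

lemma lipschitzWith_clamp (r : ℝ) : LipschitzWith 1 (clamp r) :=
  (LipschitzWith.id.const_min r).const_max (-r)

lemma eventually_sq_le_of_deriv_neg {w : ℝ → ℝ} {w' x : ℝ} (hw : HasDerivAt w w' x)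
    (hneg : w' * w x < 0) : ∀ᶠ y in 𝓝[>] x, w y ^ 2 ≤ w x ^ 2 := by
  have h2 : HasDerivAt (fun y => w y ^ 2) (2 * w x * w') x := by
    exact (hw.pow 2).congr_deriv (by simp)
  have hlt : 2 * w x * w' < 0 := by nlinarith
  have := (hasDerivAt_iff_tendsto_slope.1 h2).eventually_lt_const hlt
  have h3 : ∀ᶠ y in 𝓝[>] x, slope (fun y => w y ^ 2) x y < 0 :=
    this.filter_mono (nhdsWithin_mono x fun y (hy : x < y) => (ne_of_gt hy))
  filter_upwards [h3, self_mem_nhdsWithin] with y hy hxy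
  have hxy' : 0 < y - x := sub_pos.2 hxy
  rw [slope_def_field, div_lt_iff₀ hxy', zero_mul] at hy
  linarith

/-- A continuous periodic function attains its maximum. -/
lemma exists_max_of_periodic {f : ℝ → ℝ} {ω : ℝ} (hω : 0 < ω) (hf : Continuous f)
    (hper : Function.Periodic f ω) : ∃ x, ∀ y, f y ≤ f x := by
  obtain ⟨x, -, hx⟩ := isCompact_Icc.exists_isMaxOn (nonempty_Icc.2 hω.le)
    (hf.continuousOn (s := Icc 0 ω))
  refine ⟨x, fun y => ?_⟩
  obtain ⟨z, hz, hzy⟩ := hper.exists_mem_Ico₀ hω y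
  rw [hzy]
  exact hx (Ico_subset_Icc_self hz)

/-- A scalar periodic equation `ρ' = F φ ρ` on the strip `|ρ| ≤ r` together with a coordinate
`w = W φ ρ`, whose derivative along the solutions is `V φ ρ`, such that differences of `w` decay
at the rate `lam` and the region `|w| ≤ δ` is forward invariant. -/
structure TrappingField (F W V : ℝ → ℝ → ℝ) (ω r δ lam μ c C : ℝ) : Prop where
  ω_pos : 0 < ω
  r_pos : 0 < r
  lam_pos : 0 < lam
  c_pos : 0 < c
  periodic_F : ∀ φ ρ, F (φ + ω) ρ = F φ ρ
  periodic_W : ∀ φ ρ, W (φ + ω) ρ = W φ ρ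
  continuous_F : ∀ ρ, |ρ| ≤ r → Continuous fun φ => F φ ρ
  lipschitz_F : ∃ L : NNReal, ∀ φ ρ₁ ρ₂, |ρ₁| ≤ r → |ρ₂| ≤ r →
    |F φ ρ₁ - F φ ρ₂| ≤ L * |ρ₁ - ρ₂|
  bounded_F : ∃ M, ∀ φ ρ, |ρ| ≤ r → |F φ ρ| ≤ M
  hasDerivAt_W : ∀ (ρ : ℝ → ℝ) φ, |ρ φ| ≤ r → HasDerivAt ρ (F φ (ρ φ)) φ →
    HasDerivAt (fun t => W t (ρ t)) (V φ (ρ φ)) φ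
  lower_W : ∀ φ ρ₁ ρ₂, |ρ₁| ≤ r → |ρ₂| ≤ r → c * |ρ₁ - ρ₂| ≤ |W φ ρ₁ - W φ ρ₂|
  upper_W : ∀ φ ρ₁ ρ₂, |ρ₁| ≤ r → |ρ₂| ≤ r → |W φ ρ₁ - W φ ρ₂| ≤ C * |ρ₁ - ρ₂|
  contracting : ∀ φ ρ₁ ρ₂, |ρ₁| ≤ r → |ρ₂| ≤ r →
    (V φ ρ₁ - V φ ρ₂) * (W φ ρ₁ - W φ ρ₂) ≤ -lam * (W φ ρ₁ - W φ ρ₂) ^ 2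
  dissipative : ∀ φ ρ, |ρ| ≤ r → V φ ρ * W φ ρ ≤ -lam * W φ ρ ^ 2 + μ * |W φ ρ|
  δ_pos : 0 < δ
  μ_nonneg : 0 ≤ μ
  μ_lt : μ < lam * δ
  zero_mem : ∀ φ, |W φ 0| ≤ δ
  abs_lt : ∀ φ ρ, |ρ| ≤ r → |W φ ρ| ≤ δ → |ρ| < r

namespace TrappingField

variable {F W V : ℝ → ℝ → ℝ} {ω r δ lam μ c C : ℝ}

lemma lipschitz_clamp (h : TrappingField F W V ω r δ lam μ c C) :
    ∃ L : NNReal, ∀ φ, LipschitzWith L fun ρ => F φ (clamp r ρ) := by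
  obtain ⟨L, hL⟩ := h.lipschitz_F
  refine ⟨L, fun φ => LipschitzWith.of_dist_le_mul fun x y => ?_⟩
  rw [Real.dist_eq, Real.dist_eq]
  refine (hL φ _ _ (abs_clamp_le h.r_pos.le x) (abs_clamp_le h.r_pos.le y)).trans ?_
  have := (lipschitzWith_clamp r).dist_le_mul x y
  rw [Real.dist_eq, Real.dist_eq, NNReal.coe_one, one_mul] at this
  gcongr

/-- Clamping `ρ` extends the field from the strip to a bounded, globally Lipschitz one; solutions
that stay in the strip solve the original equation. -/
lemma exists_solution (h : TrappingField F W V ω r δ lam μ c C) (φ₀ ρ₀ : ℝ) :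
    ∃ ρ : ℝ → ℝ, ρ φ₀ = ρ₀ ∧ ∀ φ, HasDerivAt ρ (F φ (clamp r (ρ φ))) φ := by
  obtain ⟨L, hL⟩ := h.lipschitz_clamp
  obtain ⟨M, hM⟩ := h.bounded_F
  exact exists_global_solution (F := fun φ ρ => F φ (clamp r ρ)) (L := L) (M := M)
    (fun x => h.continuous_F _ (abs_clamp_le h.r_pos.le x)) hL
    (fun φ x => hM φ _ (abs_clamp_le h.r_pos.le x)) φ₀ ρ₀

lemma solution_unique (h : TrappingField F W V ω r δ lam μ c C) {ρ₁ ρ₂ : ℝ → ℝ}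
    (h₁ : ∀ φ, HasDerivAt ρ₁ (F φ (clamp r (ρ₁ φ))) φ)
    (h₂ : ∀ φ, HasDerivAt ρ₂ (F φ (clamp r (ρ₂ φ))) φ) {φ₀ : ℝ} (heq : ρ₁ φ₀ = ρ₂ φ₀) :
    ρ₁ = ρ₂ := by
  obtain ⟨L, hL⟩ := h.lipschitz_clamp
  exact ODE_solution_unique_univ (v := fun φ ρ => F φ (clamp r ρ)) (s := fun _ => univ)
    (fun φ => (hL φ).lipschitzOnWith) (fun φ => ⟨h₁ φ, trivial⟩) (fun φ => ⟨h₂ φ, trivial⟩) heq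

lemma hasDerivAt_W' (h : TrappingField F W V ω r δ lam μ c C) {ρ : ℝ → ℝ}
    (hρ : ∀ φ, HasDerivAt ρ (F φ (clamp r (ρ φ))) φ) {φ : ℝ} (hφ : |ρ φ| ≤ r) :
    HasDerivAt (fun t => W t (ρ t)) (V φ (ρ φ)) φ := by
  have := hρ φ
  rw [clamp_eq_self hφ] at this
  exact h.hasDerivAt_W ρ φ hφ this

/-- Where `|W| = δ`, `dissipative` and `μ < lam δ` make `W²` strictly decreasing along the solution,
while `abs_lt` keeps `ρ` away from the edge of the strip. So the closed set of times spent in the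
region can always be continued to the right. -/
lemma trapped (h : TrappingField F W V ω r δ lam μ c C) {ρ : ℝ → ℝ}
    (hρ : ∀ φ, HasDerivAt ρ (F φ (clamp r (ρ φ))) φ) {φ₀ : ℝ} (h0 : |ρ φ₀| ≤ r)
    (hW0 : |W φ₀ (ρ φ₀)| ≤ δ) {φ : ℝ} (hφ : φ₀ ≤ φ) :
    |ρ φ| ≤ r ∧ |W φ (ρ φ)| ≤ δ := by
  have hcont : Continuous ρ := continuous_iff_continuousAt.2 fun φ => (hρ φ).continuousAt
  have hclosed0 : IsClosed {t | |ρ t| ≤ r} := isClosed_le hcont.abs continuous_const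
  have hWcont : ContinuousOn (fun t => |W t (ρ t)|) {t | |ρ t| ≤ r} := fun t ht =>
    (h.hasDerivAt_W' hρ ht).continuousAt.abs.continuousWithinAt
  set A : Set ℝ := {t | |ρ t| ≤ r} ∩ (fun t => |W t (ρ t)|) ⁻¹' Iic δ with hA
  have hclosed : IsClosed A := hWcont.preimage_isClosed_of_isClosed hclosed0 isClosed_Iic
  have hsub : Icc φ₀ φ ⊆ A := by
    refine (hclosed.inter isClosed_Icc).Icc_subset_of_forall_mem_nhdsWithin ⟨h0, hW0⟩ ?_
    rintro t ⟨⟨ht1, ht2⟩, -⟩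
    have hlt := h.abs_lt t (ρ t) ht1 ht2
    have hev1 : ∀ᶠ s in 𝓝[>] t, |ρ s| ≤ r :=
      ((hcont.abs.continuousAt.eventually_lt_const hlt).filter_mono nhdsWithin_le_nhds).mono
        fun s hs => le_of_lt hs
    have hd := h.hasDerivAt_W' hρ ht1
    have hev2 : ∀ᶠ s in 𝓝[>] t, |W s (ρ s)| ≤ δ := by
      rcases lt_or_eq_of_le (show |W t (ρ t)| ≤ δ from ht2) with hlt' | heq
      · exact ((hd.continuousAt.abs.eventually_lt_const hlt').filter_mono
          nhdsWithin_le_nhds).mono fun s hs => le_of_lt hs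
      · have hdis := h.dissipative t (ρ t) ht1
        rw [heq, ← sq_abs, heq] at hdis
        have hμ := h.μ_lt
        have hδ := h.δ_pos
        have hneg : V t (ρ t) * W t (ρ t) < 0 := by nlinarith
        filter_upwards [eventually_sq_le_of_deriv_neg hd hneg] with s hs
        rw [← heq]
        exact sq_le_sq.1 hs
    filter_upwards [hev1, hev2] with s h1 h2 using ⟨h1, h2⟩
  exact hsub ⟨hφ, le_rfl⟩

/-- By `contracting`, the square of `exp (lam t)` times the difference of the two values of `W` does
not increase. -/
lemma contraction (h : TrappingField F W V ω r δ lam μ c C) {ρ₁ ρ₂ : ℝ → ℝ}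
    (h₁ : ∀ φ, HasDerivAt ρ₁ (F φ (clamp r (ρ₁ φ))) φ)
    (h₂ : ∀ φ, HasDerivAt ρ₂ (F φ (clamp r (ρ₂ φ))) φ) {φ₀ : ℝ}
    (hr₁ : ∀ φ, φ₀ ≤ φ → |ρ₁ φ| ≤ r) (hr₂ : ∀ φ, φ₀ ≤ φ → |ρ₂ φ| ≤ r) {φ : ℝ} (hφ : φ₀ ≤ φ) :
    |W φ (ρ₁ φ) - W φ (ρ₂ φ)| ≤
      Real.exp (-lam * (φ - φ₀)) * |W φ₀ (ρ₁ φ₀) - W φ₀ (ρ₂ φ₀)| := by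
  set D : ℝ → ℝ := fun t => W t (ρ₁ t) - W t (ρ₂ t) with hD
  have hDd : ∀ t, φ₀ ≤ t → HasDerivAt D (V t (ρ₁ t) - V t (ρ₂ t)) t := fun t ht =>
    (h.hasDerivAt_W' h₁ (hr₁ t ht)).sub (h.hasDerivAt_W' h₂ (hr₂ t ht))
  set g : ℝ → ℝ := fun t => (Real.exp (lam * (t - φ₀)) * D t) ^ 2 with hg
  have hgd : ∀ t, φ₀ ≤ t → HasDerivAt g (2 * Real.exp (lam * (t - φ₀)) ^ 2 *
      (lam * D t ^ 2 + (V t (ρ₁ t) - V t (ρ₂ t)) * D t)) t := by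
    intro t ht
    have he : HasDerivAt (fun t => Real.exp (lam * (t - φ₀)))
        (Real.exp (lam * (t - φ₀)) * lam) t := by
      simpa using (((hasDerivAt_id t).sub_const φ₀).const_mul lam).exp
    have := (he.mul (hDd t ht)).pow 2
    refine this.congr_deriv ?_
    simp only [Pi.mul_apply]
    push_cast
    ring
  have hanti : AntitoneOn g (Ici φ₀) := by
    refine antitoneOn_of_deriv_nonpos (convex_Ici φ₀)
      (fun t ht => (hgd t ht).continuousAt.continuousWithinAt)
      (fun t ht => (hgd t (interior_subset ht)).differentiableAt.differentiableWithinAt) ?_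
    intro t ht
    have ht' : φ₀ ≤ t := interior_subset ht
    rw [(hgd t ht').deriv]
    have := h.contracting t (ρ₁ t) (ρ₂ t) (hr₁ t ht') (hr₂ t ht')
    have h2 : lam * D t ^ 2 + (V t (ρ₁ t) - V t (ρ₂ t)) * D t ≤ 0 := by
      simp only [hD]; linarith
    have h3 : 0 ≤ 2 * Real.exp (lam * (t - φ₀)) ^ 2 := by positivity
    exact mul_nonpos_of_nonneg_of_nonpos h3 h2
  have hle := hanti (mem_Ici.2 le_rfl) (mem_Ici.2 hφ) hφ
  simp only [hg, sub_self, mul_zero, Real.exp_zero, one_mul] at hle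
  have habs := sq_le_sq.1 hle
  rw [abs_mul, abs_of_pos (Real.exp_pos _)] at habs
  have hexp : Real.exp (-lam * (φ - φ₀)) * Real.exp (lam * (φ - φ₀)) = 1 := by
    rw [← Real.exp_add]; simp
  calc |D φ| = Real.exp (-lam * (φ - φ₀)) * (Real.exp (lam * (φ - φ₀)) * |D φ|) := by
        rw [← mul_assoc, hexp, one_mul]
    _ ≤ _ := by gcongr

/-- A trapping periodic equation has a periodic solution in the trapping region. -/
lemma exists_periodic (h : TrappingField F W V ω r δ lam μ c C) :
    ∃ Υ : ℝ → ℝ, Function.Periodic Υ ω ∧ (∀ φ, |Υ φ| < r) ∧ (∀ φ, |W φ (Υ φ)| ≤ δ) ∧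
      (∀ φ, HasDerivAt Υ (F φ (Υ φ)) φ) ∧ ∀ φ, lam * |W φ (Υ φ)| ≤ μ := by
  have hω := h.ω_pos
  obtain ⟨ρ, hρ0, hρ⟩ := h.exists_solution 0 0
  have htr : ∀ φ, 0 ≤ φ → |ρ φ| ≤ r ∧ |W φ (ρ φ)| ≤ δ := fun φ hφ =>
    h.trapped hρ (by rw [hρ0, abs_zero]; exact h.r_pos.le) (by rw [hρ0]; exact h.zero_mem 0) hφ
  have shift : ∀ {σ : ℝ → ℝ}, (∀ φ, HasDerivAt σ (F φ (clamp r (σ φ))) φ) →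
      ∀ φ, HasDerivAt (fun φ => σ (φ + ω)) (F φ (clamp r (σ (φ + ω)))) φ := by
    intro σ hσ φ
    have := (hσ (φ + ω)).comp_add_const φ ω
    rwa [h.periodic_F] at this
  have hWn : ∀ (n : ℕ) φ ρ, W (φ + n * ω) ρ = W φ ρ := fun n φ ρ =>
    (show Function.Periodic (fun φ => W φ ρ) ω from fun φ => h.periodic_W φ ρ).nat_mul n φ
  have hW0 : ∀ (n : ℕ) ρ, W (n * ω) ρ = W 0 ρ := fun n ρ => by
    have := hWn n 0 ρ
    rwa [zero_add] at this
  have hexp1 : Real.exp (-lam * ω) < 1 := by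
    rw [Real.exp_lt_one_iff]; nlinarith [h.lam_pos]
  have hrn : ∀ n : ℕ, |ρ (n * ω)| ≤ r := fun n => (htr _ (by positivity)).1
  -- Successive iterates of the period map are values of two solutions, `ρ` and its shift by `ω`,
  -- whose distance in `W` shrinks by `exp (-lam ω)` in each period.
  have hstep : ∀ n : ℕ, |W 0 (ρ (n * ω)) - W 0 (ρ ((n + 1 : ℕ) * ω))|
      ≤ |W 0 (ρ 0) - W 0 (ρ ω)| * Real.exp (-lam * ω) ^ n := by
    intro n
    have := h.contraction hρ (shift hρ) (φ₀ := 0) (fun φ hφ => (htr φ hφ).1)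
      (fun φ hφ => (htr (φ + ω) (by linarith)).1) (φ := n * ω) (by positivity)
    rw [hW0, hW0, sub_zero, zero_add] at this
    have e : ((n + 1 : ℕ) : ℝ) * ω = n * ω + ω := by push_cast; ring
    have e2 : Real.exp (-lam * ω) ^ n = Real.exp (-lam * (n * ω)) := by
      rw [← Real.exp_nat_mul]; ring_nf
    rw [e, e2]
    exact this.trans_eq (mul_comm _ _)
  have hcauchy : CauchySeq fun n : ℕ => ρ (n * ω) := by
    refine cauchySeq_of_le_geometric (Real.exp (-lam * ω))
      (|W 0 (ρ 0) - W 0 (ρ ω)| / c) hexp1 fun n => ?_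
    rw [Real.dist_eq, div_mul_eq_mul_div, le_div_iff₀ h.c_pos, mul_comm]
    exact (h.lower_W 0 _ _ (hrn n) (hrn (n + 1))).trans (hstep n)
  obtain ⟨x, hx⟩ := cauchySeq_tendsto_of_complete hcauchy
  have hxr : |x| ≤ r := le_of_tendsto hx.abs (Eventually.of_forall hrn)
  have hWlim : Tendsto (fun n : ℕ => |W 0 x - W 0 (ρ (n * ω))|) atTop (𝓝 0) := by
    have : Tendsto (fun n : ℕ => C * |x - ρ (n * ω)|) atTop (𝓝 (C * |x - x|)) :=
      (tendsto_const_nhds.sub hx).abs.const_mul C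
    rw [sub_self, abs_zero, mul_zero] at this
    exact squeeze_zero (fun _ => abs_nonneg _) (fun n => h.upper_W 0 _ _ hxr (hrn n)) this
  have hxδ : |W 0 x| ≤ δ := by
    have hlim : Tendsto (fun n : ℕ => δ + |W 0 x - W 0 (ρ (n * ω))|) atTop (𝓝 (δ + 0)) :=
      hWlim.const_add δ
    rw [add_zero] at hlim
    refine ge_of_tendsto hlim (Eventually.of_forall fun n => ?_)
    have h1 := (htr (n * ω) (by positivity)).2
    rw [hW0] at h1
    have h2 := abs_add_le (W 0 (ρ (n * ω))) (W 0 x - W 0 (ρ (n * ω)))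
    rw [add_sub_cancel] at h2
    linarith
  obtain ⟨Υ, hΥ0, hΥ⟩ := h.exists_solution 0 x
  have hΥtr : ∀ φ, 0 ≤ φ → |Υ φ| ≤ r ∧ |W φ (Υ φ)| ≤ δ := fun φ hφ =>
    h.trapped hΥ (by rw [hΥ0]; exact hxr) (by rw [hΥ0]; exact hxδ) hφ
  have shiftn : ∀ n : ℕ, ∀ φ, HasDerivAt (fun φ => ρ (φ + n * ω))
      (F φ (clamp r (ρ (φ + n * ω)))) φ := by
    intro n φ
    have := (hρ (φ + n * ω)).comp_add_const φ (n * ω)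
    rwa [show F (φ + n * ω) = F φ from funext fun ρ =>
      (show Function.Periodic (fun φ => F φ ρ) ω from fun φ => h.periodic_F φ ρ).nat_mul n φ]
      at this
  -- `Υ` starts at the limit of `ρ (n ω)`. Comparing it over one period with the shift of `ρ` by `n
  -- ω` shows that `Υ ω` is the limit of `ρ ((n + 1) ω)`, which is the same limit.
  have hΥω : Υ ω = Υ 0 := by
    have hlim : Tendsto (fun n : ℕ => ρ ((n + 1 : ℕ) * ω)) atTop (𝓝 (Υ ω)) := by
      rw [tendsto_iff_dist_tendsto_zero]
      have hz : Tendsto (fun n : ℕ => |W 0 x - W 0 (ρ (n * ω))| / c) atTop (𝓝 0) := by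
        simpa using hWlim.div_const c
      refine squeeze_zero (fun _ => dist_nonneg) (fun n => ?_) hz
      have hc := h.contraction hΥ (shiftn n) (φ₀ := 0) (fun φ hφ => (hΥtr φ hφ).1)
        (fun φ hφ => (htr (φ + n * ω) (by positivity)).1) (φ := ω) hω.le
      have hWω : ∀ ρ, W ω ρ = W 0 ρ := fun ρ => by
        have := h.periodic_W 0 ρ; rwa [zero_add] at this
      rw [hWω, hWω, zero_add, hΥ0, sub_zero] at hc
      rw [dist_comm, Real.dist_eq, le_div_iff₀ h.c_pos, mul_comm]
      have e : ((n + 1 : ℕ) : ℝ) * ω = ω + n * ω := by push_cast; ring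
      refine (h.lower_W 0 _ _ (hΥtr ω hω.le).1 (hrn (n + 1))).trans ?_
      rw [e]
      refine hc.trans ?_
      exact mul_le_of_le_one_left (abs_nonneg _) hexp1.le
    rw [hΥ0]
    exact tendsto_nhds_unique hlim (hx.comp (tendsto_add_atTop_nat 1))
  have hper : Function.Periodic Υ ω := by
    have := h.solution_unique (shift hΥ) hΥ (φ₀ := 0) (by simp only [zero_add]; exact hΥω)
    exact fun φ => congrFun this φ
  have hall : ∀ φ, |Υ φ| ≤ r ∧ |W φ (Υ φ)| ≤ δ := by
    intro φ
    have hpr : Function.Periodic (fun φ => (Υ φ, W φ (Υ φ))) ω := fun φ => by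
      simp only [hper φ, h.periodic_W]
    obtain ⟨y, hy, hyφ⟩ := hpr.exists_mem_Ico₀ hω φ
    simp only [Prod.mk.injEq] at hyφ
    rw [hyφ.1]
    have := hΥtr y hy.1
    rw [← hyφ.2, hyφ.1] at this
    exact this
  have hder : ∀ φ, HasDerivAt Υ (F φ (Υ φ)) φ := fun φ => by
    have := hΥ φ
    rwa [clamp_eq_self (hall φ).1] at this
  have hWd := fun φ => h.hasDerivAt_W Υ φ (hall φ).1 (hder φ)
  refine ⟨Υ, hper, fun φ => h.abs_lt φ _ (hall φ).1 (hall φ).2, fun φ => (hall φ).2, hder, ?_⟩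
  have hWc : Continuous fun φ => W φ (Υ φ) :=
    continuous_iff_continuousAt.2 fun φ => (hWd φ).continuousAt
  -- At a maximum of `W²` along `Υ` the product `V W` vanishes, so `dissipative` yields `lam |W| ≤
  -- μ`. This is sharper than `|W| ≤ δ` and will give the size `O(ε)` of the solution.
  obtain ⟨m, hm⟩ := exists_max_of_periodic hω (hWc.pow 2)
    (fun φ => by simp only [Pi.pow_apply, hper φ, h.periodic_W])
  have hmax : IsLocalMax ((fun φ => W φ (Υ φ)) ^ 2) m := Eventually.of_forall hm
  have hz := hmax.hasDerivAt_eq_zero ((hWd m).pow 2)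
  have hVW : V m (Υ m) * W m (Υ m) = 0 := by
    simp at hz
    rcases hz with hz | hz <;> simp [hz]
  have hdis := h.dissipative m (Υ m) (hall m).1
  rw [hVW, ← sq_abs] at hdis
  have hlm : lam * |W m (Υ m)| ^ 2 ≤ μ * |W m (Υ m)| := by linarith
  intro φ
  have hmφ : |W φ (Υ φ)| ≤ |W m (Υ m)| := sq_le_sq.1 (hm φ)
  rcases (abs_nonneg (W m (Υ m))).eq_or_lt with h0 | h0
  · rw [← h0] at hmφ
    rw [le_antisymm hmφ (abs_nonneg _), mul_zero]
    exact h.μ_nonneg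
  · have : lam * |W m (Υ m)| ≤ μ := by nlinarith
    exact (mul_le_mul_of_nonneg_left hmφ h.lam_pos.le).trans this

end TrappingField

namespace TrappingField

variable {F W V : ℝ → ℝ → ℝ} {ω r δ lam μ c C : ℝ}

/-- Solutions that start in the trapping region approach the periodic solution exponentially. -/
lemma exists_attracted (h : TrappingField F W V ω r δ lam μ c C) {Υ : ℝ → ℝ}
    (hΥr : ∀ φ, |Υ φ| ≤ r) (hΥ : ∀ φ, HasDerivAt Υ (F φ (Υ φ)) φ) {φ₀ ρ₀ : ℝ} (hρ₀ : |ρ₀| ≤ r)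
    (hW₀ : |W φ₀ ρ₀| ≤ δ) :
    ∃ ρ : ℝ → ℝ, Continuous ρ ∧ ρ φ₀ = ρ₀ ∧ ∀ φ, φ₀ ≤ φ → |ρ φ| ≤ r ∧
      HasDerivAt ρ (F φ (ρ φ)) φ ∧
      |ρ φ - Υ φ| ≤ C / c * Real.exp (-lam * (φ - φ₀)) * |ρ₀ - Υ φ₀| := by
  obtain ⟨ρ, hρ0, hρ⟩ := h.exists_solution φ₀ ρ₀
  have htr : ∀ φ, φ₀ ≤ φ → |ρ φ| ≤ r := fun φ hφ =>
    (h.trapped hρ (by rwa [hρ0]) (by rwa [hρ0]) hφ).1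
  have hΥ' : ∀ φ, HasDerivAt Υ (F φ (clamp r (Υ φ))) φ := fun φ => by
    rw [clamp_eq_self (hΥr φ)]; exact hΥ φ
  refine ⟨ρ, continuous_iff_continuousAt.2 fun φ => (hρ φ).continuousAt, hρ0, fun φ hφ =>
    ⟨htr φ hφ, ?_, ?_⟩⟩
  · have := hρ φ
    rwa [clamp_eq_self (htr φ hφ)] at this
  · have h1 := h.contraction hρ hΥ' htr (fun φ _ => hΥr φ) hφ
    have h2 := h.lower_W φ _ _ (htr φ hφ) (hΥr φ)
    have h3 := h.upper_W φ₀ _ _ hρ₀ (hΥr φ₀)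
    rw [hρ0] at h1
    have hc := h.c_pos
    calc |ρ φ - Υ φ| = (c * |ρ φ - Υ φ|) / c := by field_simp
      _ ≤ (Real.exp (-lam * (φ - φ₀)) * (C * |ρ₀ - Υ φ₀|)) / c := by
          refine div_le_div_of_nonneg_right ?_ hc.le
          exact h2.trans (h1.trans (by gcongr))
      _ = _ := by ring

/-- Two periodic solutions of nearby equations are close to each other. -/
lemma abs_sub_periodic_le (h : TrappingField F W V ω r δ lam μ c C) {Υ Υ' : ℝ → ℝ}
    {W' V' : ℝ → ℝ → ℝ} (hΥr : ∀ φ, |Υ φ| ≤ r) (hΥ : ∀ φ, HasDerivAt Υ (F φ (Υ φ)) φ)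
    (hΥp : Function.Periodic Υ ω) (hΥr' : ∀ φ, |Υ' φ| ≤ r) (hΥp' : Function.Periodic Υ' ω)
    (hW' : ∀ φ ρ, W' (φ + ω) ρ = W' φ ρ)
    (hd' : ∀ φ, HasDerivAt (fun t => W' t (Υ' t)) (V' φ (Υ' φ)) φ) {u v : ℝ}
    (hu : ∀ φ, |W φ (Υ' φ) - W' φ (Υ' φ)| ≤ u) (hv : ∀ φ, |V φ (Υ' φ) - V' φ (Υ' φ)| ≤ v)
    (φ : ℝ) : c * |Υ φ - Υ' φ| ≤ v / lam + 2 * u := by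
  have hlam := h.lam_pos
  set D : ℝ → ℝ := fun t => W t (Υ t) - W' t (Υ' t) with hD
  have hDd : ∀ t, HasDerivAt D (V t (Υ t) - V' t (Υ' t)) t := fun t =>
    (h.hasDerivAt_W Υ t (hΥr t) (hΥ t)).sub (hd' t)
  have hDc : Continuous D := continuous_iff_continuousAt.2 fun t => (hDd t).continuousAt
  have hDp : Function.Periodic D ω := fun t => by
    simp only [hD, hΥp t, hΥp' t, h.periodic_W, hW']
  -- At a maximum of `D²` either `D = 0` or the two derivatives `V` and `V'` coincide; in the second
  -- case `contracting` bounds `W m (Υ m) - W m (Υ' m)` by `v / lam`. Only the unprimed field needs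
  -- to be trapping.
  obtain ⟨m, hm⟩ := exists_max_of_periodic h.ω_pos (hDc.pow 2)
    (fun t => by simp only [Pi.pow_apply, hDp t])
  have hmax : IsLocalMax (D ^ 2) m := Eventually.of_forall hm
  have hz := hmax.hasDerivAt_eq_zero ((hDd m).pow 2)
  have hu0 : 0 ≤ u := (abs_nonneg _).trans (hu 0)
  have hv0 : 0 ≤ v := (abs_nonneg _).trans (hv 0)
  have hDm : |D m| ≤ v / lam + u := by
    by_cases h0 : D m = 0
    · rw [h0, abs_zero]; positivity
    · have hVV : V m (Υ m) = V' m (Υ' m) := by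
        simp at hz
        rcases hz with hz | hz
        · exact absurd hz h0
        · linarith
      have hcon := h.contracting m (Υ m) (Υ' m) (hΥr m) (hΥr' m)
      set d := W m (Υ m) - W m (Υ' m) with hd
      have h1 : lam * |d| ^ 2 ≤ v * |d| := by
        rw [sq_abs]
        have h2 := hv m
        rw [hVV] at hcon
        have h3 : -((V' m (Υ' m) - V m (Υ' m)) * d) ≤ |V m (Υ' m) - V' m (Υ' m)| * |d| := by
          rw [← abs_mul]
          refine le_trans (le_of_eq ?_) (le_abs_self _)
          ring
        have h4 : |V m (Υ' m) - V' m (Υ' m)| * |d| ≤ v * |d| := by gcongr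
        linarith
      have h2 : |d| ≤ v / lam := by
        rw [le_div_iff₀ hlam]
        rcases (abs_nonneg d).eq_or_lt with h0 | h0
        · rw [← h0, zero_mul]; exact hv0
        · nlinarith
      have h3 : D m = d + (W m (Υ' m) - W' m (Υ' m)) := by simp only [hD, hd]; ring
      rw [h3]
      exact (abs_add_le _ _).trans (add_le_add h2 (hu m))
  have h1 : |D φ| ≤ v / lam + u := (sq_le_sq.1 (hm φ)).trans hDm
  have h2 := h.lower_W φ _ _ (hΥr φ) (hΥr' φ)
  have h3 : W φ (Υ φ) - W φ (Υ' φ) = D φ - (W φ (Υ' φ) - W' φ (Υ' φ)) := by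
    simp only [hD]; ring
  rw [h3] at h2
  have h4 := abs_sub (D φ) (W φ (Υ' φ) - W' φ (Υ' φ))
  have h5 := hu φ
  linarith

end TrappingField

/-! ### Restoring the time along an orbit. -/

/-- Solutions of a scalar autonomous equation with a continuous positive right-hand side. -/
lemma exists_time_change {o : ℝ → ℝ} (ho : Continuous o) {m M : ℝ} (hm : 0 < m)
    (hmo : ∀ φ, m ≤ o φ) (hoM : ∀ φ, o φ ≤ M) (φ₀ : ℝ) :
    ∃ θ : ℝ → ℝ, θ 0 = φ₀ ∧ (∀ t, HasDerivAt θ (o (θ t)) t) ∧ StrictMono θ ∧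
      Function.Surjective θ ∧ Tendsto θ atTop atTop ∧ Tendsto θ atBot atBot ∧
      ∀ ω, 0 < ω → Function.Periodic o ω → ∃ T, 0 < T ∧ ∀ t, θ (t + T) = θ t + ω := by
  have hpos : ∀ φ, 0 < o φ := fun φ => hm.trans_le (hmo φ)
  have hM : 0 < M := (hpos 0).trans_le (hoM 0)
  have hinv : Continuous fun φ => (o φ)⁻¹ := ho.inv₀ fun φ => (hpos φ).ne'
  -- `τ` is the time as a function of the angle, and `θ` will be its inverse. The bound `o ≤ M`
  -- makes `τ` grow at least like `φ / M`, hence surjective.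
  set τ : ℝ → ℝ := fun φ => ∫ s in φ₀..φ, (o s)⁻¹ with hτ
  have hτd : ∀ φ, HasDerivAt τ (o φ)⁻¹ φ := fun φ =>
    intervalIntegral.integral_hasDerivAt_right (hinv.intervalIntegrable _ _)
      (hinv.stronglyMeasurableAtFilter _ _) hinv.continuousAt
  have hτ0 : τ φ₀ = 0 := by simp [hτ]
  have hτc : Continuous τ := continuous_iff_continuousAt.2 fun φ => (hτd φ).continuousAt
  have hmono : StrictMono τ := strictMono_of_deriv_pos fun φ => by
    rw [(hτd φ).deriv]; exact inv_pos.2 (hpos φ)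
  have hg : Monotone fun φ => τ φ - φ / M := by
    have hgd : ∀ φ, HasDerivAt (fun φ => τ φ - φ / M) ((o φ)⁻¹ - 1 / M) φ := fun φ =>
      (hτd φ).sub ((hasDerivAt_id φ).div_const M)
    refine monotone_of_deriv_nonneg (fun φ => (hgd φ).differentiableAt) fun φ => ?_
    rw [(hgd φ).deriv, one_div, sub_nonneg]
    exact inv_anti₀ (hpos φ) (hoM φ)
  have htop : Tendsto τ atTop atTop := by
    have h1 : Tendsto (fun φ => φ / M - φ₀ / M) atTop atTop :=
      tendsto_atTop_add_const_right _ _ (tendsto_id.atTop_div_const hM)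
    refine tendsto_atTop_mono' _ ?_ h1
    filter_upwards [eventually_ge_atTop φ₀] with φ hφ
    have := hg hφ
    simp only [hτ0] at this
    linarith
  have hbot : Tendsto τ atBot atBot := by
    have h1 : Tendsto (fun φ => φ / M - φ₀ / M) atBot atBot :=
      tendsto_atBot_add_const_right _ _ (tendsto_id.atBot_div_const hM)
    refine tendsto_atBot_mono' _ ?_ h1
    filter_upwards [eventually_le_atBot φ₀] with φ hφ
    have := hg hφ
    simp only [hτ0] at this
    linarith
  have hsurj : Function.Surjective τ := hτc.surjective htop hbot
  set e := hmono.orderIsoOfSurjective τ hsurj with he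
  have heτ : ∀ φ, e φ = τ φ := fun φ => rfl
  have hθτ : ∀ t, τ (e.symm t) = t := fun t => e.apply_symm_apply t
  refine ⟨e.symm, ?_, ?_, e.symm.strictMono, e.symm.surjective, e.symm.tendsto_atTop,
    e.symm.tendsto_atBot, ?_⟩
  · rw [e.symm_apply_eq, heτ, hτ0]
  · intro t
    have h2 : HasDerivAt e.symm ((o (e.symm t))⁻¹)⁻¹ t :=
      HasDerivAt.of_local_left_inverse e.symm.continuous.continuousAt (hτd (e.symm t))
        (inv_ne_zero (hpos _).ne') (Eventually.of_forall hθτ)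
    rwa [inv_inv] at h2
  · intro ω hω hper
    refine ⟨τ (φ₀ + ω), ?_, ?_⟩
    · rw [← hτ0]; exact hmono (by linarith)
    · intro t
      have hconst : ∀ φ, τ (φ + ω) - τ φ = τ (φ₀ + ω) := by
        intro φ
        have hd : ∀ φ, HasDerivAt (fun φ => τ (φ + ω) - τ φ) 0 φ := fun φ => by
          have := ((hτd (φ + ω)).comp_add_const φ ω).sub (hτd φ)
          rwa [hper φ, sub_self] at this
        have := is_const_of_deriv_eq_zero (fun x => (hd x).differentiableAt)
          (fun x => (hd x).deriv) φ φ₀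
        simpa [hτ0] using this
      rw [e.symm_apply_eq, heτ]
      have := hconst (e.symm t)
      rw [hθτ] at this
      linarith

/-! ### Estimates near `ρ = ε = 0`, uniform in the angle. -/

/-- A function that is `C¹` within a convex set is strictly differentiable within this set. -/
lemma _root_.ContDiffWithinAt.exists_strict_approx {E : Type*} [NormedAddCommGroup E]
    [NormedSpace ℝ E] {g : E → ℝ} {s : Set E} {p : E} (hg : ContDiffWithinAt ℝ 1 g s p)
    (hs : Convex ℝ s) (hp : p ∈ s) :
    ∃ g' : E →L[ℝ] ℝ, HasFDerivWithinAt g g' s p ∧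
      ∀ η > 0, ∃ ε > 0, ∀ x y, x ∈ s → y ∈ s → dist x p < ε → dist y p < ε →
        |g x - g y - g' (x - y)| ≤ η * ‖x - y‖ := by
  have hg' : ContDiffWithinAt ℝ (0 + 1) g s p := by rwa [zero_add]
  obtain ⟨u, hu, hus, -, g', hg', hc⟩ :=
    (contDiffWithinAt_succ_iff_hasFDerivWithinAt' (by simp)).1 hg'
  rw [insert_eq_of_mem hp] at hu hus
  refine ⟨g' p, hg' p (mem_of_mem_nhdsWithin hp hu), fun η hη => ?_⟩
  have hc' := hc.continuousWithinAt
  have hev : ∀ᶠ x in 𝓝[s] p, x ∈ u ∧ ‖g' x - g' p‖ ≤ η := by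
    have hu' : ∀ᶠ x in 𝓝[s] p, x ∈ u := hu
    have hc'' : ∀ᶠ x in 𝓝[s] p, dist (g' x) (g' p) < η :=
      Metric.tendsto_nhds.1 hc' η hη
    filter_upwards [hu', hc''] with x hx hx'
    rw [dist_eq_norm] at hx'
    exact ⟨hx, hx'.le⟩
  obtain ⟨ε, hε, hball⟩ := Metric.mem_nhdsWithin_iff.1 hev
  refine ⟨ε, hε, fun x y hx hy hxε hyε => ?_⟩
  -- The mean value inequality for `g - g' p` on the convex set `ball ∩ s`. Working within `s` is
  -- essential: the perturbation is given only for `ε ≥ 0`, and `ε = 0` is a boundary point.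
  have := Convex.norm_image_sub_le_of_norm_hasFDerivWithin_le' (f := g) (f' := g') (φ := g' p)
    (s := Metric.ball p ε ∩ s) (C := η) (x := y) (y := x)
    (fun z hz => (hg' z (hball hz).1).mono inter_subset_right)
    (fun z hz => (hball hz).2) ((convex_ball p ε).inter hs) ⟨hyε, hy⟩ ⟨hxε, hx⟩
  rwa [Real.norm_eq_abs] at this

/-- The domain of the variables `(ρ, ε, φ)`. -/
def slab (ε₀ : ℝ) : Set (ℝ × ℝ × ℝ) := univ ×ˢ Icc 0 ε₀ ×ˢ univ

lemma convex_slab (ε₀ : ℝ) : Convex ℝ (slab ε₀) :=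
  convex_univ.prod ((convex_Icc _ _).prod convex_univ)

lemma mem_slab {ε₀ ρ ε φ : ℝ} (h : ε ∈ Icc 0 ε₀) : (ρ, ε, φ) ∈ slab ε₀ :=
  ⟨trivial, h, trivial⟩

/-- A property that holds locally uniformly near `(ρ, ε) = 0` holds uniformly in `φ`, if it is
periodic in `φ`. -/
lemma exists_uniform {ω : ℝ} (hω : 0 < ω) {Q : ℝ → ℝ → ℝ × ℝ × ℝ → ℝ → Prop}
    (hmono : ∀ L L' x φ, L ≤ L' → Q L ω x φ → Q L' ω x φ)
    (hper : ∀ L x φ, Q L ω x (φ + ω) ↔ Q L ω x φ)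
    (hloc : ∀ φ, ∃ L, ∀ᶠ z : (ℝ × ℝ × ℝ) × ℝ in 𝓝 ((0, 0, 0), φ), Q L ω z.1 z.2) :
    ∃ L, ∃ r > 0, ∀ ρ₁ ρ₂ ε, |ρ₁| ≤ r → |ρ₂| ≤ r → |ε| ≤ r → ∀ φ, Q L ω (ρ₁, ρ₂, ε) φ := by
  have key : ∃ L, ∀ᶠ x in 𝓝 ((0, 0, 0) : ℝ × ℝ × ℝ), ∀ φ ∈ Icc 0 ω, Q L ω x φ := by
    -- One period is compact, so finitely many local neighbourhoods suffice; `hmono` allows the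
    -- largest of their constants to be taken.
    refine isCompact_Icc.induction_on (p := fun s => ∃ L, ∀ᶠ x in 𝓝 ((0, 0, 0) : ℝ × ℝ × ℝ),
      ∀ φ ∈ s, Q L ω x φ) ⟨0, Eventually.of_forall fun x φ hφ => hφ.elim⟩ ?_ ?_ ?_
    · rintro s t hst ⟨L, hL⟩
      exact ⟨L, hL.mono fun x hx φ hφ => hx φ (hst hφ)⟩
    · rintro s t ⟨L, hL⟩ ⟨L', hL'⟩
      refine ⟨max L L', ?_⟩
      filter_upwards [hL, hL'] with x hx hx' φ hφ
      rcases hφ with hφ | hφ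
      · exact hmono _ _ _ _ (le_max_left _ _) (hx φ hφ)
      · exact hmono _ _ _ _ (le_max_right _ _) (hx' φ hφ)
    · intro φ _
      obtain ⟨L, hL⟩ := hloc φ
      rw [nhds_prod_eq, eventually_prod_iff] at hL
      obtain ⟨pa, ha, pb, hb, hab⟩ := hL
      exact ⟨{φ | pb φ}, mem_nhdsWithin_of_mem_nhds hb, L, ha.mono fun x hx φ hφ => hab hx hφ⟩
  obtain ⟨L, hL⟩ := key
  obtain ⟨r, hr, hball⟩ := Metric.eventually_nhds_iff.1 hL
  refine ⟨L, r / 2, by positivity, fun ρ₁ ρ₂ ε h1 h2 h3 φ => ?_⟩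
  have hmem : dist ((ρ₁, ρ₂, ε) : ℝ × ℝ × ℝ) (0, 0, 0) < r := by
    simp only [Prod.dist_eq, Real.dist_eq, sub_zero]
    exact (max_le h1 (max_le h2 h3)).trans_lt (by linarith)
  have hp : Function.Periodic (fun φ => Q L ω (ρ₁, ρ₂, ε) φ) ω := fun φ =>
    propext (hper L _ φ)
  obtain ⟨ψ, hψ, hψφ⟩ := hp.exists_mem_Ico₀ hω φ
  rw [hψφ]
  exact hball hmem ψ (Ico_subset_Icc_self hψ)

variable {g : ℝ × ℝ × ℝ → ℝ} {ε₀ ω : ℝ}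

lemma norm_slice (ρ₁ ρ₂ ε φ : ℝ) :
    ‖((ρ₁, ε, φ) : ℝ × ℝ × ℝ) - (ρ₂, ε, φ)‖ = |ρ₁ - ρ₂| := by
  simp [Prod.norm_def]

lemma tendsto_slice₁ (φ : ℝ) : Tendsto (fun z : (ℝ × ℝ × ℝ) × ℝ => (z.1.1, z.1.2.2, z.2))
    (𝓝 ((0, 0, 0), φ)) (𝓝 ((0, 0, φ) : ℝ × ℝ × ℝ)) :=
  Continuous.tendsto' (by fun_prop) _ _ rfl

lemma tendsto_slice₂ (φ : ℝ) : Tendsto (fun z : (ℝ × ℝ × ℝ) × ℝ => (z.1.2.1, z.1.2.2, z.2))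
    (𝓝 ((0, 0, 0), φ)) (𝓝 ((0, 0, φ) : ℝ × ℝ × ℝ)) :=
  Continuous.tendsto' (by fun_prop) _ _ rfl

/-- Uniform strict differentiability in `ρ` near `ρ = ε = 0`. -/
lemma exists_uniform_approx (hω : 0 < ω) (hε₀ : 0 ≤ ε₀)
    (hg : ∀ φ, ContDiffWithinAt ℝ 1 g (slab ε₀) (0, 0, φ))
    (hper : ∀ ρ ε φ, g (ρ, ε, φ + ω) = g (ρ, ε, φ)) {d : ℝ → ℝ} (hd : Continuous d)
    (hdper : Function.Periodic d ω)
    (hderiv : ∀ φ, HasDerivAt (fun ρ => g (ρ, 0, φ)) (d φ) 0) {η : ℝ} (hη : 0 < η) :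
    ∃ r > 0, ∀ ρ₁ ρ₂ ε φ, |ρ₁| ≤ r → |ρ₂| ≤ r → |ε| ≤ r → ε ∈ Icc 0 ε₀ →
      |g (ρ₁, ε, φ) - g (ρ₂, ε, φ) - d φ * (ρ₁ - ρ₂)| ≤ η * |ρ₁ - ρ₂| := by
  -- The constant is prescribed in advance here, so the parameter `L` of `Q` is a dummy. The triple
  -- `x` stands for `(ρ₁, ρ₂, ε)`.
  have key := exists_uniform hω
    (Q := fun _ _ x φ => x.2.2 ∈ Icc 0 ε₀ →
      |g (x.1, x.2.2, φ) - g (x.2.1, x.2.2, φ) - d φ * (x.1 - x.2.1)| ≤ η * |x.1 - x.2.1|)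
    (fun _ _ _ _ _ h => h) (fun _ x φ => by rw [hper, hper, hdper])
  obtain ⟨-, r, hr, h⟩ := key (by
    intro φ
    refine ⟨0, ?_⟩
    have hmem : ((0, 0, φ) : ℝ × ℝ × ℝ) ∈ slab ε₀ := mem_slab ⟨le_rfl, hε₀⟩
    obtain ⟨g', hg', happ⟩ := (hg φ).exists_strict_approx (convex_slab ε₀) hmem
    have hg'd : g' (1, 0, 0) = d φ := by
      have hc : HasDerivWithinAt (fun ρ : ℝ => ((ρ, 0, φ) : ℝ × ℝ × ℝ)) (1, 0, 0) univ 0 :=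
        ((hasDerivAt_id (0 : ℝ)).prodMk
          ((hasDerivAt_const 0 (0 : ℝ)).prodMk (hasDerivAt_const 0 φ))).hasDerivWithinAt
      have := HasFDerivWithinAt.comp_hasDerivWithinAt_of_eq (t := slab ε₀) (0 : ℝ) hg' hc
        (fun ρ _ => mem_slab ⟨le_rfl, hε₀⟩) rfl
      exact (hasDerivWithinAt_univ.1 this).unique (hderiv φ)
    obtain ⟨ε, hε, happ⟩ := happ (η / 2) (by positivity)
    have h1 := (tendsto_slice₁ φ).eventually (Metric.ball_mem_nhds _ hε)
    have h2 := (tendsto_slice₂ φ).eventually (Metric.ball_mem_nhds _ hε)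
    have h3 : ∀ᶠ z : (ℝ × ℝ × ℝ) × ℝ in 𝓝 ((0, 0, 0), φ), |d z.2 - d φ| < η / 2 := by
      have hcont : Continuous fun z : (ℝ × ℝ × ℝ) × ℝ => |d z.2 - d φ| := by fun_prop
      exact hcont.continuousAt.eventually_lt_const (by simpa using hη)
    filter_upwards [h1, h2, h3] with z hz1 hz2 hz3 hz
    have h4 := happ _ _ (mem_slab hz) (mem_slab hz) hz1 hz2
    rw [norm_slice] at h4
    have h5 : g' ((z.1.1, z.1.2.2, z.2) - (z.1.2.1, z.1.2.2, z.2)) = d φ * (z.1.1 - z.1.2.1) := by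
      have : ((z.1.1, z.1.2.2, z.2) - (z.1.2.1, z.1.2.2, z.2) : ℝ × ℝ × ℝ)
          = (z.1.1 - z.1.2.1) • ((1, 0, 0) : ℝ × ℝ × ℝ) := by ext <;> simp
      rw [this, map_smul, hg'd, smul_eq_mul, mul_comm]
    rw [h5] at h4
    have h6 : |(d φ - d z.2) * (z.1.1 - z.1.2.1)| ≤ η / 2 * |z.1.1 - z.1.2.1| := by
      rw [abs_mul, abs_sub_comm]; gcongr
    calc _ = |(g (z.1.1, z.1.2.2, z.2) - g (z.1.2.1, z.1.2.2, z.2)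
            - d φ * (z.1.1 - z.1.2.1)) + (d φ - d z.2) * (z.1.1 - z.1.2.1)| := by
          congr 1; ring
      _ ≤ _ := abs_add_le _ _
      _ ≤ _ := by linarith)
  exact ⟨r, hr, fun ρ₁ ρ₂ ε φ h1 h2 h3 h4 => h ρ₁ ρ₂ ε h1 h2 h3 φ h4⟩

/-- Uniform boundedness, Lipschitz continuity in `ρ` and continuity near `ρ = ε = 0`. -/
lemma exists_uniform_lipschitz (hω : 0 < ω) (hε₀ : 0 ≤ ε₀)
    (hg : ∀ φ, ContDiffWithinAt ℝ 1 g (slab ε₀) (0, 0, φ))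
    (hper : ∀ ρ ε φ, g (ρ, ε, φ + ω) = g (ρ, ε, φ)) :
    ∃ L, ∃ r > 0, ∀ ρ₁ ρ₂ ε φ, |ρ₁| ≤ r → |ρ₂| ≤ r → |ε| ≤ r → ε ∈ Icc 0 ε₀ →
      |g (ρ₁, ε, φ) - g (ρ₂, ε, φ)| ≤ L * |ρ₁ - ρ₂| ∧ |g (ρ₁, ε, φ)| ≤ L := by
  have key := exists_uniform hω
    (Q := fun L _ x φ => x.2.2 ∈ Icc 0 ε₀ →
      |g (x.1, x.2.2, φ) - g (x.2.1, x.2.2, φ)| ≤ L * |x.1 - x.2.1| ∧ |g (x.1, x.2.2, φ)| ≤ L)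
    (fun L L' _ _ hL h hx => ⟨(h hx).1.trans (by gcongr), (h hx).2.trans hL⟩)
    (fun _ x φ => by rw [hper, hper])
  obtain ⟨L, r, hr, h⟩ := key (by
    intro φ
    have hmem : ((0, 0, φ) : ℝ × ℝ × ℝ) ∈ slab ε₀ := mem_slab ⟨le_rfl, hε₀⟩
    obtain ⟨g', hg', happ⟩ := (hg φ).exists_strict_approx (convex_slab ε₀) hmem
    obtain ⟨ε, hε, happ⟩ := happ 1 one_pos
    have hcw : ∀ᶠ y in 𝓝 ((0, 0, φ) : ℝ × ℝ × ℝ), y ∈ slab ε₀ → |g y| < |g (0, 0, φ)| + 1 :=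
      eventually_nhdsWithin_iff.1
        ((hg φ).continuousWithinAt.abs.eventually_lt_const (lt_add_one _))
    refine ⟨max (‖g'‖ + 1) (|g (0, 0, φ)| + 1), ?_⟩
    filter_upwards [(tendsto_slice₁ φ).eventually (Metric.ball_mem_nhds _ hε),
      (tendsto_slice₂ φ).eventually (Metric.ball_mem_nhds _ hε),
      (tendsto_slice₁ φ).eventually hcw] with z hz1 hz2 hz3 hz
    refine ⟨?_, (hz3 (mem_slab hz)).le.trans (le_max_right _ _)⟩
    have h4 := happ _ _ (mem_slab hz) (mem_slab hz) hz1 hz2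
    have h5 := g'.le_opNorm ((z.1.1, z.1.2.2, z.2) - (z.1.2.1, z.1.2.2, z.2))
    rw [norm_slice] at h4 h5
    rw [Real.norm_eq_abs] at h5
    have h6 := abs_add_le (g (z.1.1, z.1.2.2, z.2) - g (z.1.2.1, z.1.2.2, z.2)
      - g' ((z.1.1, z.1.2.2, z.2) - (z.1.2.1, z.1.2.2, z.2)))
      (g' ((z.1.1, z.1.2.2, z.2) - (z.1.2.1, z.1.2.2, z.2)))
    rw [sub_add_cancel] at h6
    calc _ ≤ (‖g'‖ + 1) * |z.1.1 - z.1.2.1| := by linarith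
      _ ≤ _ := by gcongr; exact le_max_left _ _)
  exact ⟨L, r, hr, fun ρ₁ ρ₂ ε φ h1 h2 h3 h4 => h ρ₁ ρ₂ ε h1 h2 h3 φ h4⟩

/-- Uniform Lipschitz estimate of the deviation from the value at `ρ = ε = 0`. -/
lemma exists_uniform_near (hω : 0 < ω) (hε₀ : 0 ≤ ε₀)
    (hg : ∀ φ, ContDiffWithinAt ℝ 1 g (slab ε₀) (0, 0, φ))
    (hper : ∀ ρ ε φ, g (ρ, ε, φ + ω) = g (ρ, ε, φ)) :
    ∃ L, ∃ r > 0, ∀ ρ ε φ, |ρ| ≤ r → |ε| ≤ r → ε ∈ Icc 0 ε₀ →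
      |g (ρ, ε, φ) - g (0, 0, φ)| ≤ L * max |ρ| |ε| := by
  have key := exists_uniform hω
    (Q := fun L _ x φ => x.2.2 ∈ Icc 0 ε₀ →
      |g (x.1, x.2.2, φ) - g (0, 0, φ)| ≤ L * max |x.1| |x.2.2|)
    (fun L L' _ _ hL h hx => (h hx).trans
      (mul_le_mul_of_nonneg_right hL ((abs_nonneg _).trans (le_max_left _ _))))
    (fun _ x φ => by rw [hper, hper])
  obtain ⟨L, r, hr, h⟩ := key (by
    intro φ
    have hmem : ∀ ψ, ((0, 0, ψ) : ℝ × ℝ × ℝ) ∈ slab ε₀ := fun ψ => mem_slab ⟨le_rfl, hε₀⟩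
    obtain ⟨g', hg', happ⟩ := (hg φ).exists_strict_approx (convex_slab ε₀) (hmem φ)
    obtain ⟨ε, hε, happ⟩ := happ 1 one_pos
    have h0 : Tendsto (fun z : (ℝ × ℝ × ℝ) × ℝ => ((0, 0, z.2) : ℝ × ℝ × ℝ))
        (𝓝 ((0, 0, 0), φ)) (𝓝 (0, 0, φ)) := Continuous.tendsto' (by fun_prop) _ _ rfl
    refine ⟨‖g'‖ + 1, ?_⟩
    filter_upwards [(tendsto_slice₁ φ).eventually (Metric.ball_mem_nhds _ hε),
      h0.eventually (Metric.ball_mem_nhds _ hε)] with z hz1 hz2 hz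
    have h4 := happ _ _ (mem_slab hz) (hmem _) hz1 hz2
    have h5 := g'.le_opNorm ((z.1.1, z.1.2.2, z.2) - (0, 0, z.2))
    have hn : ‖((z.1.1, z.1.2.2, z.2) : ℝ × ℝ × ℝ) - (0, 0, z.2)‖ = max |z.1.1| |z.1.2.2| := by
      simp [Prod.norm_def]
    rw [hn] at h4 h5
    rw [Real.norm_eq_abs] at h5
    have h6 := abs_add_le (g (z.1.1, z.1.2.2, z.2) - g (0, 0, z.2)
      - g' ((z.1.1, z.1.2.2, z.2) - (0, 0, z.2)))
      (g' ((z.1.1, z.1.2.2, z.2) - (0, 0, z.2)))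
    rw [sub_add_cancel] at h6
    linarith)
  exact ⟨L, r, hr, fun ρ ε φ h1 h2 h3 => h ρ ρ ε h1 h1 h2 φ h3⟩

/-! ### Regularity of the cycle and the identity linking `q`, `ξ` and `β`. -/

namespace CycleParam

variable {γ : ℝ} {k l : ℤ} {b : ℝ} (G : CycleParam γ k l b)

lemma contDiff_C : ContDiff ℝ 1 G.C := by
  refine contDiff_one_iff_deriv.2 ⟨fun φ => (G.hasDerivAt_C φ).differentiableAt, ?_⟩
  rw [deriv_C]
  have := G.continuous_S
  fun_prop

lemma contDiff_S : ContDiff ℝ 1 G.S := by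
  refine contDiff_one_iff_deriv.2 ⟨fun φ => (G.hasDerivAt_S φ).differentiableAt, ?_⟩
  rw [deriv_S]
  have := G.continuous_C
  fun_prop

lemma α_eq' : G.α = fun φ => γ * (G.S φ ^ 3 - G.S φ) * (G.S φ - l)
    + (G.C φ - k) * (G.C φ ^ 3 - G.C φ) :=
  funext G.α_eq

lemma contDiff_α : ContDiff ℝ 1 G.α := by
  rw [α_eq']
  have := G.contDiff_C
  have := G.contDiff_S
  fun_prop

lemma hasDerivAt_α (φ : ℝ) : HasDerivAt G.α
    (γ * (3 * G.S φ ^ 2 - 1) * deriv G.S φ * (G.S φ - l)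
      + (3 * G.C φ ^ 2 - 1) * deriv G.C φ * (G.C φ - k)) φ := by
  have hC := G.hasDerivAt_C φ
  have hS := G.hasDerivAt_S φ
  rw [α_eq', deriv_C, deriv_S]
  have := ((((hS.pow 3).sub hS).const_mul γ).mul (hS.sub_const (l : ℝ))).add
    ((hC.sub_const (k : ℝ)).mul ((hC.pow 3).sub hC))
  refine this.congr_deriv ?_
  simp
  ring

lemma deriv_α : deriv G.α = fun φ => γ * (3 * G.S φ ^ 2 - 1) * deriv G.S φ * (G.S φ - l)
      + (3 * G.C φ ^ 2 - 1) * deriv G.C φ * (G.C φ - k) :=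
  funext fun φ => (G.hasDerivAt_α φ).deriv

lemma periodic_deriv_C : Function.Periodic (deriv G.C) G.ω := fun φ => by
  simp only [deriv_C, G.periodic_S φ]

lemma periodic_deriv_S : Function.Periodic (deriv G.S) G.ω := fun φ => by
  simp only [deriv_S, G.periodic_C φ]

lemma periodic_α : Function.Periodic G.α G.ω := fun φ => by
  simp only [α_eq', G.periodic_C φ, G.periodic_S φ]

lemma periodic_deriv_α : Function.Periodic (deriv G.α) G.ω := fun φ => by
  simp only [deriv_α, G.periodic_C φ, G.periodic_S φ, G.periodic_deriv_C φ, G.periodic_deriv_S φ]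

lemma continuous_deriv_C : Continuous (deriv G.C) := G.contDiff_C.continuous_deriv_one

lemma continuous_deriv_S : Continuous (deriv G.S) := G.contDiff_S.continuous_deriv_one

lemma continuous_deriv_α : Continuous (deriv G.α) := G.contDiff_α.continuous_deriv_one

lemma continuous_α : Continuous G.α := G.contDiff_α.continuous

lemma continuous_q (hα : ∀ φ, G.α φ ≠ 0) : Continuous G.q := by
  have := G.continuous_C
  have := G.continuous_S
  have := G.continuous_α
  unfold q
  exact Continuous.div (by fun_prop) (by fun_prop) fun φ => pow_ne_zero 2 (hα φ)

lemma continuous_ξ (hα : ∀ φ, G.α φ ≠ 0) : Continuous G.ξ := by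
  have := G.continuous_C
  have := G.continuous_S
  have := G.continuous_α
  have := G.continuous_deriv_α
  have := G.continuous_q hα
  have hp : Continuous G.p := by
    unfold p
    have h1 : Continuous fun φ => 3 * γ / G.α φ := continuous_const.div (by fun_prop) hα
    fun_prop
  unfold ξ
  exact Continuous.div (by fun_prop) (by fun_prop) hα

/-- The right-hand side is the second derivative of `H` in the radial direction `(C - k, S - l)`.
Thus `q + 1/α` is that second derivative divided by `α²`, the form that can be differentiated
directly. -/
lemma α_sq_mul_q (hk : (k : ℝ) ^ 3 = k) (hl : (l : ℝ) ^ 3 = l) (hα : ∀ φ, G.α φ ≠ 0) (φ : ℝ) :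
    G.α φ ^ 2 * G.q φ + G.α φ = (3 * G.C φ ^ 2 - 1) * (G.C φ - k) ^ 2
      + γ * (3 * G.S φ ^ 2 - 1) * (G.S φ - l) ^ 2 := by
  have := hα φ
  have e : G.α φ ^ 2 * G.q φ
      = (G.C φ - k) ^ 3 * (2 * G.C φ + k) + γ * (G.S φ - l) ^ 3 * (2 * G.S φ + l) := by
    unfold q; field_simp
  rw [e, α_eq']
  linear_combination (G.C φ - k) * hk + γ * (G.S φ - l) * hl

/-- The function `q + 1/α` is an antiderivative of `-2ξ`. -/
lemma hasDerivAt_q_add (hk : (k : ℝ) ^ 3 = k) (hl : (l : ℝ) ^ 3 = l) (hα : ∀ φ, G.α φ ≠ 0)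
    (φ : ℝ) : HasDerivAt (fun φ => G.q φ + 1 / G.α φ) (-2 * G.ξ φ) φ := by
  have hC := G.hasDerivAt_C φ
  have hS := G.hasDerivAt_S φ
  have hA := G.hasDerivAt_α φ
  have hα0 := hα φ
  have hM := ((((hC.pow 2).const_mul 3).sub_const 1).mul ((hC.sub_const (k : ℝ)).pow 2)).add
    (((((hS.pow 2).const_mul 3).sub_const 1).const_mul γ).mul ((hS.sub_const (l : ℝ)).pow 2))
  have hfun : (fun φ => G.q φ + 1 / G.α φ) = fun φ => ((3 * G.C φ ^ 2 - 1) * (G.C φ - k) ^ 2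
      + γ * (3 * G.S φ ^ 2 - 1) * (G.S φ - l) ^ 2) / G.α φ ^ 2 := by
    ext φ
    rw [← G.α_sq_mul_q hk hl hα]
    have := hα φ
    field_simp
  rw [hfun]
  refine (hM.div (hA.pow 2) (pow_ne_zero 2 hα0)).congr_deriv ?_
  have hq : G.q φ = ((3 * G.C φ ^ 2 - 1) * (G.C φ - k) ^ 2
      + γ * (3 * G.S φ ^ 2 - 1) * (G.S φ - l) ^ 2 - G.α φ) / G.α φ ^ 2 := by
    rw [← G.α_sq_mul_q hk hl hα]; field_simp; ring
  simp only [ξ, p, hq, deriv_α, deriv_C, deriv_S, Pi.mul_apply, Pi.add_apply, Pi.pow_apply,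
    Nat.cast_ofNat, Nat.add_one_sub_one]
  generalize G.α φ = A at *
  field_simp
  ring

/-- The mean value of `ξ` vanishes. -/
lemma avg_ξ (hk : (k : ℝ) ^ 3 = k) (hl : (l : ℝ) ^ 3 = l) (hα : ∀ φ, G.α φ ≠ 0) :
    G.avg G.ξ = 0 := by
  have h := intervalIntegral.integral_eq_sub_of_hasDerivAt (a := 0) (b := G.ω)
    (fun φ _ => G.hasDerivAt_q_add hk hl hα φ)
    ((continuous_const.mul (G.continuous_ξ hα)).intervalIntegrable _ _)
  have hper : G.q G.ω + 1 / G.α G.ω = G.q 0 + 1 / G.α 0 := by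
    have hα0 : G.α G.ω = G.α 0 := by simpa using G.periodic_α 0
    have hC : G.C G.ω = G.C 0 := by simpa using G.periodic_C 0
    have hS : G.S G.ω = G.S 0 := by simpa using G.periodic_S 0
    simp only [q, hα0, hC, hS]
  rw [hper, sub_self, intervalIntegral.integral_const_mul] at h
  unfold avg
  have : ∫ φ in (0 : ℝ)..G.ω, G.ξ φ = 0 := by linarith
  rw [this, mul_zero]

/-- The derivative formula integrated, the mean of `ξ` being zero. It eliminates `q` and `β`
together from `K`, in exchange for `1/α`. -/
lemma q_add_β (hk : (k : ℝ) ^ 3 = k) (hl : (l : ℝ) ^ 3 = l) (hα : ∀ φ, G.α φ ≠ 0) (φ : ℝ) :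
    G.q φ + 1 / G.α φ + 2 * G.β φ = G.q 0 + 1 / G.α 0 := by
  have h := intervalIntegral.integral_eq_sub_of_hasDerivAt (a := 0) (b := φ)
    (fun φ _ => G.hasDerivAt_q_add hk hl hα φ)
    ((continuous_const.mul (G.continuous_ξ hα)).intervalIntegrable _ _)
  rw [intervalIntegral.integral_const_mul] at h
  unfold β
  simp only [G.avg_ξ hk hl hα, sub_zero]
  linarith

lemma continuous_β (hα : ∀ φ, G.α φ ≠ 0) : Continuous G.β := by
  unfold β
  exact intervalIntegral.continuous_primitive
    (fun a b => ((G.continuous_ξ hα).sub continuous_const).intervalIntegrable a b) 0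

end CycleParam

lemma InitialRange.cast_pow_three {γ σ : ℝ} {k l : ℤ} {b : ℝ} (h : InitialRange γ σ k l b) :
    (k : ℝ) ^ 3 = k ∧ (l : ℝ) ^ 3 = l := by
  rcases h with ⟨rfl, rfl, -⟩ | ⟨rfl | rfl, rfl, -⟩ | ⟨rfl | rfl, rfl | rfl, -⟩ <;> norm_num

/-! ### The averaged coefficient `κ` and its mean value. -/

namespace PerturbedSystem

variable (P : PerturbedSystem) {k l : ℤ} {b : ℝ} (G : CycleParam P.γ k l b)

lemma isOpen_domain : IsOpen P.domain := isOpen_Ioo.prod isOpen_Ioo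

lemma star_shaped (hb : InitialRange P.γ P.σ k l b) (φ : ℝ) :
    G.α φ ≠ 0 ∧ (G.C φ, G.S φ) ∈ P.domain := by
  obtain ⟨h1, h2, h3⟩ := G.star_shaped P.γ_pos P.γ_le_one P.lt_σ hb φ
  exact ⟨h1, abs_lt.1 h2, abs_lt.1 h3⟩

/-- The function `(x, y) ↦ Z x y` on the plane. -/
def uncurried (Z : ℝ → ℝ → ℝ) (z : ℝ × ℝ) : ℝ := Z z.1 z.2

variable {P} in
lemma contDiffAt_of_analytic {Z : ℝ → ℝ → ℝ}
    (hZ : AnalyticOnNhd ℝ (fun p : ℝ × ℝ => Z p.1 p.2) (Ioo (-P.σ) P.σ ×ˢ Ioo (-P.σ) P.σ))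
    {z : ℝ × ℝ} (hz : z ∈ P.domain) : ContDiffAt ℝ 2 (uncurried Z) z :=
  (hZ z hz).contDiffAt

lemma contDiffAt_X₀ {z : ℝ × ℝ} (hz : z ∈ P.domain) : ContDiffAt ℝ 2 (uncurried P.X₀) z :=
  contDiffAt_of_analytic P.analytic_X₀ hz

lemma contDiffAt_Y₀ {z : ℝ × ℝ} (hz : z ∈ P.domain) : ContDiffAt ℝ 2 (uncurried P.Y₀) z :=
  contDiffAt_of_analytic P.analytic_Y₀ hz

lemma radialDeriv_eq {Z : ℝ → ℝ → ℝ} {φ : ℝ}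
    (hZ : ContDiffAt ℝ 2 (uncurried Z) (G.C φ, G.S φ)) :
    P.radialDeriv G Z φ
      = fderiv ℝ (uncurried Z) (G.C φ, G.S φ) (G.C φ - k, G.S φ - l) := by
  have hd := (hZ.differentiableAt two_ne_zero).hasFDerivAt
  have h1 : HasDerivAt (fun x => Z x (G.S φ))
      (fderiv ℝ (uncurried Z) (G.C φ, G.S φ) (1, 0)) (G.C φ) :=
    HasFDerivAt.comp_hasDerivAt_of_eq (l := uncurried Z) (f := fun x => (x, G.S φ)) (G.C φ) hd
      ((hasDerivAt_id (G.C φ)).prodMk (hasDerivAt_const _ (G.S φ))) rfl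
  have h2 : HasDerivAt (fun y => Z (G.C φ) y)
      (fderiv ℝ (uncurried Z) (G.C φ, G.S φ) (0, 1)) (G.S φ) :=
    HasFDerivAt.comp_hasDerivAt_of_eq (l := uncurried Z) (f := fun y => (G.C φ, y)) (G.S φ) hd
      ((hasDerivAt_const _ (G.C φ)).prodMk (hasDerivAt_id (G.S φ))) rfl
  unfold radialDeriv
  rw [h1.deriv, h2.deriv, ← smul_eq_mul, ← smul_eq_mul, ← map_smul, ← map_smul, ← map_add]
  simp

/-- The radial derivative is the derivative along the ray. -/
lemma hasDerivAt_ray {Z : ℝ → ℝ → ℝ} {φ : ℝ}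
    (hZ : ContDiffAt ℝ 2 (uncurried Z) (G.C φ, G.S φ)) :
    HasDerivAt (fun ρ => Z (G.C φ + (G.C φ - k) * ρ) (G.S φ + (G.S φ - l) * ρ))
      (P.radialDeriv G Z φ) 0 := by
  rw [radialDeriv_eq P G hZ]
  have hd := (hZ.differentiableAt two_ne_zero).hasFDerivAt
  have h1 : HasDerivAt (fun ρ : ℝ => (G.C φ + (G.C φ - k) * ρ, G.S φ + (G.S φ - l) * ρ))
      (G.C φ - k, G.S φ - l) 0 := by
    have e1 := ((hasDerivAt_id (0 : ℝ)).const_mul (G.C φ - k)).const_add (G.C φ)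
    have e2 := ((hasDerivAt_id (0 : ℝ)).const_mul (G.S φ - l)).const_add (G.S φ)
    simpa using e1.prodMk e2
  exact hd.comp_hasDerivAt_of_eq 0 h1 (by simp)

lemma continuous_radialDeriv (hb : InitialRange P.γ P.σ k l b) {Z : ℝ → ℝ → ℝ}
    (hZ : ∀ z ∈ P.domain, ContDiffAt ℝ 2 (uncurried Z) z) : Continuous (P.radialDeriv G Z) := by
  have h : P.radialDeriv G Z = fun φ =>
      fderiv ℝ (uncurried Z) (G.C φ, G.S φ) (G.C φ - k, G.S φ - l) :=
    funext fun φ => radialDeriv_eq P G (hZ _ (P.star_shaped G hb φ).2)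
  rw [h]
  have hC := G.continuous_C
  have hS := G.continuous_S
  refine Continuous.clm_apply ?_ (by fun_prop)
  refine continuous_iff_continuousAt.2 fun φ => ?_
  have hc : ContinuousAt (fderiv ℝ (uncurried Z)) (G.C φ, G.S φ) :=
    ((hZ _ (P.star_shaped G hb φ).2).fderiv_right (m := 1) (by norm_num)).continuousAt
  exact ContinuousAt.comp (f := fun φ => (G.C φ, G.S φ)) hc (by fun_prop)

lemma continuous_on_cycle (hb : InitialRange P.γ P.σ k l b) {Z : ℝ → ℝ → ℝ}
    (hZ : ∀ z ∈ P.domain, ContDiffAt ℝ 2 (uncurried Z) z) :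
    Continuous fun φ => Z (G.C φ) (G.S φ) := by
  have hC := G.continuous_C
  have hS := G.continuous_S
  refine continuous_iff_continuousAt.2 fun φ => ?_
  exact ContinuousAt.comp (g := uncurried Z) (f := fun φ => (G.C φ, G.S φ))
    (hZ _ (P.star_shaped G hb φ).2).continuousAt (by fun_prop)

/-- The derivative of the averaged rate of energy with respect to the energy. -/
noncomputable def κ (φ : ℝ) : ℝ :=
  P.Pr G φ + deriv G.α φ / G.α φ * P.Φ G φ + P.R G φ / G.α φ

lemma continuous_R (hb : InitialRange P.γ P.σ k l b) : Continuous (P.R G) := by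
  have h1 := P.continuous_on_cycle G hb fun z hz => P.contDiffAt_X₀ hz
  have h2 := P.continuous_on_cycle G hb fun z hz => P.contDiffAt_Y₀ hz
  have := G.continuous_deriv_C
  have := G.continuous_deriv_S
  unfold R
  fun_prop

lemma continuous_Pr (hb : InitialRange P.γ P.σ k l b) : Continuous (P.Pr G) := by
  have h1 := P.continuous_radialDeriv G hb fun z hz => P.contDiffAt_X₀ hz
  have h2 := P.continuous_radialDeriv G hb fun z hz => P.contDiffAt_Y₀ hz
  have := G.continuous_deriv_C
  have := G.continuous_deriv_S
  unfold Pr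
  exact Continuous.div (by fun_prop) G.continuous_α fun φ => (P.star_shaped G hb φ).1

lemma continuous_Φ (hb : InitialRange P.γ P.σ k l b) : Continuous (P.Φ G) := by
  have h1 := P.continuous_on_cycle G hb fun z hz => P.contDiffAt_X₀ hz
  have h2 := P.continuous_on_cycle G hb fun z hz => P.contDiffAt_Y₀ hz
  have := G.continuous_C
  have := G.continuous_S
  unfold Φ
  exact Continuous.div (by fun_prop) G.continuous_α fun φ => (P.star_shaped G hb φ).1

lemma continuous_deriv_α_mul_Φ (hb : InitialRange P.γ P.σ k l b) :
    Continuous fun φ => deriv G.α φ / G.α φ * P.Φ G φ :=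
  (G.continuous_deriv_α.div G.continuous_α fun φ => (P.star_shaped G hb φ).1).mul
    (P.continuous_Φ G hb)

lemma continuous_κ (hb : InitialRange P.γ P.σ k l b) : Continuous (P.κ G) :=
  ((P.continuous_Pr G hb).add (P.continuous_deriv_α_mul_Φ G hb)).add
    ((P.continuous_R G hb).div G.continuous_α fun φ => (P.star_shaped G hb φ).1)

lemma periodic_R : Function.Periodic (P.R G) G.ω := fun φ => by
  simp only [R, G.periodic_C φ, G.periodic_S φ, G.periodic_deriv_C φ, G.periodic_deriv_S φ]

lemma periodic_κ : Function.Periodic (P.κ G) G.ω := fun φ => by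
  simp only [κ, Pr, Φ, radialDeriv, P.periodic_R G φ, G.periodic_C φ, G.periodic_S φ,
    G.periodic_deriv_C φ, G.periodic_deriv_S φ, G.periodic_α φ, G.periodic_deriv_α φ]

/-- If the mean value of `R` vanishes, then `K` is the mean value of `κ`. -/
lemma integral_κ (hb : P.IsAdmissible G) :
    ∫ φ in (0 : ℝ)..G.ω, P.κ G φ = G.ω * P.K G := by
  obtain ⟨hb, hR, -⟩ := hb
  obtain ⟨hk, hl⟩ := hb.cast_pow_three
  have hα := fun φ => (P.star_shaped G hb φ).1
  have hω := G.ω_pos.ne'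
  have cR := P.continuous_R G hb
  have cRr : Continuous (P.Rr G) :=
    ((P.continuous_Pr G hb).add (P.continuous_deriv_α_mul_Φ G hb)).sub
      ((continuous_const.mul (G.continuous_β hα)).mul cR)
  have cRq : Continuous fun φ => P.R G φ * G.q φ := cR.mul (G.continuous_q hα)
  have hR0 : ∫ φ in (0 : ℝ)..G.ω, P.R G φ = 0 := by
    unfold CycleParam.avg at hR
    rcases mul_eq_zero.1 hR with h | h
    · exact absurd h (by positivity)
    · exact h
  -- Since `q + 2β` is a constant minus `1/α`, the terms `-2βR - Rq` equal `R/α` minus a constant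
  -- multiple of `R`; that multiple has mean zero because `b` solves the generating equation.
  have hκ : ∀ φ, P.κ G φ = (P.Rr G φ - P.R G φ * G.q φ) + (G.q 0 + 1 / G.α 0) * P.R G φ := by
    intro φ
    rw [← G.q_add_β hk hl hα φ]
    unfold κ Rr
    ring
  simp only [hκ]
  have cd : Continuous fun φ => P.Rr G φ - P.R G φ * G.q φ := cRr.sub cRq
  have cm : Continuous fun φ => (G.q 0 + 1 / G.α 0) * P.R G φ := continuous_const.mul cR
  rw [intervalIntegral.integral_add (cd.intervalIntegrable _ _) (cm.intervalIntegrable _ _),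
    intervalIntegral.integral_sub (cRr.intervalIntegrable _ _) (cRq.intervalIntegrable _ _),
    intervalIntegral.integral_const_mul, hR0, mul_zero, add_zero]
  unfold K CycleParam.avg
  field_simp

end PerturbedSystem

/-! ### The system in polar coordinates about `(k, l)`. -/

namespace PerturbedSystem

variable (P : PerturbedSystem) {k l : ℤ} {b : ℝ} (G : CycleParam P.γ k l b)

/-- The point with the polar coordinates `(ρ, φ)`; the argument is `(ρ, ε, φ)`. -/
def point (p : ℝ × ℝ × ℝ) : ℝ × ℝ :=
  (G.C p.2.2 + (G.C p.2.2 - k) * p.1, G.S p.2.2 + (G.S p.2.2 - l) * p.1)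

/-- The right-hand side in polar coordinates. -/
def rhs (p : ℝ × ℝ × ℝ) : ℝ × ℝ := P.field p.2.1 (P.point G p)

/-- The angular velocity `φ'`. -/
noncomputable def angularVelocity (p : ℝ × ℝ × ℝ) : ℝ :=
  ((G.S p.2.2 - l) * (P.rhs G p).1 - (G.C p.2.2 - k) * (P.rhs G p).2) /
    (G.α p.2.2 * (1 + p.1))

/-- The right-hand side of the equation for `dρ/dφ`. -/
noncomputable def slope (p : ℝ × ℝ × ℝ) : ℝ :=
  ((deriv G.C p.2.2 * (P.rhs G p).2 - deriv G.S p.2.2 * (P.rhs G p).1) / G.α p.2.2) /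
    P.angularVelocity G p

/-- The energy, normalized by its value on the generating cycle. -/
noncomputable def energyDiff (p : ℝ × ℝ × ℝ) : ℝ :=
  ((((P.point G p).1 ^ 2 - 1) ^ 2 + P.γ * ((P.point G p).2 ^ 2 - 1) ^ 2)
    - ((G.C p.2.2 ^ 2 - 1) ^ 2 + P.γ * (G.S p.2.2 ^ 2 - 1) ^ 2)) / 4

/-- The power of the perturbation. -/
def power (p : ℝ × ℝ × ℝ) : ℝ :=
  ((P.point G p).1 ^ 3 - (P.point G p).1) *
      (P.X₀ (P.point G p).1 (P.point G p).2
        + P.X₁ (P.point G p).1 (P.point G p).2 p.2.1 * p.2.1) +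
    P.γ * ((P.point G p).2 ^ 3 - (P.point G p).2) *
      (P.Y₀ (P.point G p).1 (P.point G p).2
        + P.Y₁ (P.point G p).1 (P.point G p).2 p.2.1 * p.2.1)

/-- The derivative of the energy with respect to `φ`, divided by `ε`. -/
noncomputable def energyRate (p : ℝ × ℝ × ℝ) : ℝ := P.power G p / P.angularVelocity G p

lemma contDiff_point : ContDiff ℝ 1 (P.point G) := by
  have hC := G.contDiff_C
  have hS := G.contDiff_S
  unfold point
  fun_prop

lemma point_zero (ε φ : ℝ) : P.point G (0, ε, φ) = (G.C φ, G.S φ) := by simp [point]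

lemma contDiffWithinAt_X₀_point {Z : ℝ → ℝ → ℝ}
    (hZ : ∀ z ∈ P.domain, ContDiffAt ℝ 2 (uncurried Z) z) {p : ℝ × ℝ × ℝ}
    (hp : P.point G p ∈ P.domain) :
    ContDiffWithinAt ℝ 1 (fun p => Z (P.point G p).1 (P.point G p).2) (slab P.ε₀) p := by
  have h1 : ContDiffAt ℝ 1 (uncurried Z) (P.point G p) := (hZ _ hp).of_le (by norm_num)
  exact (h1.comp p (P.contDiff_point G).contDiffAt).contDiffWithinAt

lemma contDiffWithinAt_X₁_point {Z : ℝ → ℝ → ℝ → ℝ}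
    (hZ : ContDiffOn ℝ 1 (fun p : ℝ × ℝ × ℝ => Z p.1 p.2.1 p.2.2)
      (Icc (-P.σ) P.σ ×ˢ Icc (-P.σ) P.σ ×ˢ Icc 0 P.ε₀)) {p : ℝ × ℝ × ℝ}
    (hp : P.point G p ∈ P.domain) (hps : p ∈ slab P.ε₀) :
    ContDiffWithinAt ℝ 1 (fun p => Z (P.point G p).1 (P.point G p).2 p.2.1) (slab P.ε₀) p := by
  have hpt := P.contDiff_point G
  have hC := G.contDiff_C
  have hS := G.contDiff_S
  have hin : ContDiffWithinAt ℝ 1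
      (fun p : ℝ × ℝ × ℝ => ((P.point G p).1, (P.point G p).2, p.2.1)) (slab P.ε₀) p := by
    have : ContDiff ℝ 1
      (fun p : ℝ × ℝ × ℝ => ((P.point G p).1, (P.point G p).2, p.2.1)) := by fun_prop
    exact this.contDiffAt.contDiffWithinAt
  refine ContDiffWithinAt.comp_of_preimage_mem_nhdsWithin
    (g := fun p : ℝ × ℝ × ℝ => Z p.1 p.2.1 p.2.2) p
    (hZ ((P.point G p).1, (P.point G p).2, p.2.1) ?_) hin ?_
  · exact ⟨Ioo_subset_Icc_self hp.1, Ioo_subset_Icc_self hp.2, hps.2.1⟩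
  · have hnear : ∀ᶠ q in 𝓝 p, P.point G q ∈ P.domain :=
      hpt.continuous.continuousAt.eventually (P.isOpen_domain.mem_nhds hp)
    filter_upwards [nhdsWithin_le_nhds hnear, self_mem_nhdsWithin] with q hq hqs
    exact ⟨Ioo_subset_Icc_self hq.1, Ioo_subset_Icc_self hq.2, hqs.2.1⟩

section Regularity

variable {p : ℝ × ℝ × ℝ}

lemma contDiffWithinAt_of_contDiff {f : ℝ × ℝ × ℝ → ℝ} (hf : ContDiff ℝ 1 f) {s : Set (ℝ × ℝ × ℝ)} :
    ContDiffWithinAt ℝ 1 f s p := hf.contDiffAt.contDiffWithinAt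

lemma contDiffWithinAt_perturbation_X (hp : P.point G p ∈ P.domain) (hps : p ∈ slab P.ε₀) :
    ContDiffWithinAt ℝ 1 (fun p => P.X₀ (P.point G p).1 (P.point G p).2
        + P.X₁ (P.point G p).1 (P.point G p).2 p.2.1 * p.2.1) (slab P.ε₀) p :=
  (P.contDiffWithinAt_X₀_point G (fun _ hz => P.contDiffAt_X₀ hz) hp).add
    ((P.contDiffWithinAt_X₁_point G P.contDiff_X₁ hp hps).mul
      (contDiffWithinAt_of_contDiff (by fun_prop)))

lemma contDiffWithinAt_perturbation_Y (hp : P.point G p ∈ P.domain) (hps : p ∈ slab P.ε₀) :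
    ContDiffWithinAt ℝ 1 (fun p => P.Y₀ (P.point G p).1 (P.point G p).2
        + P.Y₁ (P.point G p).1 (P.point G p).2 p.2.1 * p.2.1) (slab P.ε₀) p :=
  (P.contDiffWithinAt_X₀_point G (fun _ hz => P.contDiffAt_Y₀ hz) hp).add
    ((P.contDiffWithinAt_X₁_point G P.contDiff_Y₁ hp hps).mul
      (contDiffWithinAt_of_contDiff (by fun_prop)))

lemma contDiffWithinAt_rhs (hp : P.point G p ∈ P.domain) (hps : p ∈ slab P.ε₀) :
    ContDiffWithinAt ℝ 1 (fun p => (P.rhs G p).1) (slab P.ε₀) p ∧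
      ContDiffWithinAt ℝ 1 (fun p => (P.rhs G p).2) (slab P.ε₀) p := by
  have hC := G.contDiff_C
  have hS := G.contDiff_S
  constructor
  · exact (contDiffWithinAt_of_contDiff
      (f := fun p => P.γ * ((P.point G p).2 ^ 3 - (P.point G p).2)) (by fun_prop)).add
      ((contDiffWithinAt_of_contDiff (f := fun p => p.2.1) (by fun_prop)).mul
        (P.contDiffWithinAt_perturbation_X G hp hps))
  · exact (contDiffWithinAt_of_contDiff
      (f := fun p => -((P.point G p).1 ^ 3 - (P.point G p).1)) (by fun_prop)).add
      ((contDiffWithinAt_of_contDiff (f := fun p => p.2.1) (by fun_prop)).mul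
        (P.contDiffWithinAt_perturbation_Y G hp hps))

lemma contDiffWithinAt_angularVelocity (hp : P.point G p ∈ P.domain) (hps : p ∈ slab P.ε₀)
    (hα : G.α p.2.2 ≠ 0) (hρ : 1 + p.1 ≠ 0) :
    ContDiffWithinAt ℝ 1 (P.angularVelocity G) (slab P.ε₀) p := by
  obtain ⟨h1, h2⟩ := P.contDiffWithinAt_rhs G hp hps
  have hC := G.contDiff_C
  have hS := G.contDiff_S
  have hA := G.contDiff_α
  have e1 : ContDiffWithinAt ℝ 1 (fun p : ℝ × ℝ × ℝ => G.S p.2.2 - l) (slab P.ε₀) p :=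
    contDiffWithinAt_of_contDiff (by fun_prop)
  have e2 : ContDiffWithinAt ℝ 1 (fun p : ℝ × ℝ × ℝ => G.C p.2.2 - k) (slab P.ε₀) p :=
    contDiffWithinAt_of_contDiff (by fun_prop)
  have e3 : ContDiffWithinAt ℝ 1 (fun p : ℝ × ℝ × ℝ => G.α p.2.2 * (1 + p.1)) (slab P.ε₀) p :=
    contDiffWithinAt_of_contDiff (by fun_prop)
  exact ((e1.mul h1).sub (e2.mul h2)).div e3 (mul_ne_zero hα hρ)

lemma contDiffWithinAt_slope (hp : P.point G p ∈ P.domain) (hps : p ∈ slab P.ε₀)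
    (hα : G.α p.2.2 ≠ 0) (hρ : 1 + p.1 ≠ 0) (hΩ : P.angularVelocity G p ≠ 0) :
    ContDiffWithinAt ℝ 1 (P.slope G) (slab P.ε₀) p := by
  obtain ⟨h1, h2⟩ := P.contDiffWithinAt_rhs G hp hps
  have hC := G.contDiff_C
  have hS := G.contDiff_S
  have hA := G.contDiff_α
  have e1 : ContDiffWithinAt ℝ 1 (fun p : ℝ × ℝ × ℝ => deriv G.C p.2.2) (slab P.ε₀) p := by
    rw [CycleParam.deriv_C]; exact contDiffWithinAt_of_contDiff (by fun_prop)
  have e2 : ContDiffWithinAt ℝ 1 (fun p : ℝ × ℝ × ℝ => deriv G.S p.2.2) (slab P.ε₀) p := by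
    rw [CycleParam.deriv_S]; exact contDiffWithinAt_of_contDiff (by fun_prop)
  have e3 : ContDiffWithinAt ℝ 1 (fun p : ℝ × ℝ × ℝ => G.α p.2.2) (slab P.ε₀) p :=
    contDiffWithinAt_of_contDiff (by fun_prop)
  exact (((e1.mul h2).sub (e2.mul h1)).div e3 hα).div
    (P.contDiffWithinAt_angularVelocity G hp hps hα hρ) hΩ

lemma contDiffWithinAt_energyRate (hp : P.point G p ∈ P.domain) (hps : p ∈ slab P.ε₀)
    (hα : G.α p.2.2 ≠ 0) (hρ : 1 + p.1 ≠ 0) (hΩ : P.angularVelocity G p ≠ 0) :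
    ContDiffWithinAt ℝ 1 (P.energyRate G) (slab P.ε₀) p := by
  have hC := G.contDiff_C
  have hS := G.contDiff_S
  exact (((contDiffWithinAt_of_contDiff
      (f := fun p => (P.point G p).1 ^ 3 - (P.point G p).1) (by fun_prop)).mul
      (P.contDiffWithinAt_perturbation_X G hp hps)).add
    ((contDiffWithinAt_of_contDiff
      (f := fun p => P.γ * ((P.point G p).2 ^ 3 - (P.point G p).2)) (by fun_prop)).mul
      (P.contDiffWithinAt_perturbation_Y G hp hps))).div
    (P.contDiffWithinAt_angularVelocity G hp hps hα hρ) hΩ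

lemma contDiff_energyDiff : ContDiff ℝ 1 (P.energyDiff G) := by
  have hC := G.contDiff_C
  have hS := G.contDiff_S
  have hpt := P.contDiff_point G
  unfold energyDiff
  fun_prop

end Regularity

section AtZero

lemma rhs_zero (φ : ℝ) : P.rhs G (0, 0, φ) = (deriv G.C φ, deriv G.S φ) := by
  simp [rhs, field, point_zero, CycleParam.deriv_C, CycleParam.deriv_S]

lemma angularVelocity_zero {φ : ℝ} (hα : G.α φ ≠ 0) : P.angularVelocity G (0, 0, φ) = 1 := by
  unfold angularVelocity
  rw [rhs_zero, add_zero, mul_one, div_eq_one_iff_eq hα]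
  simp only [CycleParam.α]
  ring

lemma energyRate_zero {φ : ℝ} (hα : G.α φ ≠ 0) : P.energyRate G (0, 0, φ) = P.R G φ := by
  unfold energyRate
  rw [P.angularVelocity_zero G hα, div_one]
  simp only [power, point_zero, R, CycleParam.deriv_C, CycleParam.deriv_S]
  ring

lemma energyDiff_zero (ε φ : ℝ) : P.energyDiff G (0, ε, φ) = 0 := by
  simp [energyDiff, point_zero]

lemma hasDerivAt_point_ray (ε φ ρ : ℝ) :
    HasDerivAt (fun ρ => (P.point G (ρ, ε, φ)).1) (G.C φ - k) ρ ∧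
      HasDerivAt (fun ρ => (P.point G (ρ, ε, φ)).2) (G.S φ - l) ρ := by
  constructor
  · exact (((hasDerivAt_id ρ).const_mul (G.C φ - k)).const_add (G.C φ)).congr_deriv (by simp)
  · exact (((hasDerivAt_id ρ).const_mul (G.S φ - l)).const_add (G.S φ)).congr_deriv (by simp)

/-- The angular momentum `α` is also the radial derivative of the energy, so star-shapedness lets
the energy serve as a coordinate in place of `ρ`. -/
lemma hasDerivAt_energyDiff (φ : ℝ) :
    HasDerivAt (fun ρ => P.energyDiff G (ρ, 0, φ)) (G.α φ) 0 := by
  obtain ⟨hx, hy⟩ := P.hasDerivAt_point_ray G 0 φ 0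
  have := (((((hx.pow 2).sub_const 1).pow 2).add
    ((((hy.pow 2).sub_const 1).pow 2).const_mul P.γ)).sub_const
      ((G.C φ ^ 2 - 1) ^ 2 + P.γ * (G.S φ ^ 2 - 1) ^ 2)).div_const 4
  refine this.congr_deriv ?_
  simp [point_zero, CycleParam.α_eq']
  ring

/-- Divided by `α`, the derivative in `ρ` becomes one in the energy; this is how `κ` arises. -/
lemma hasDerivAt_energyRate (hb : InitialRange P.γ P.σ k l b) (φ : ℝ) :
    HasDerivAt (fun ρ => P.energyRate G (ρ, 0, φ)) (P.κ G φ * G.α φ) 0 := by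
  obtain ⟨hα, hdom⟩ := P.star_shaped G hb φ
  obtain ⟨hk, hl⟩ := hb.cast_pow_three
  obtain ⟨hx, hy⟩ := P.hasDerivAt_point_ray G 0 φ 0
  have hX := P.hasDerivAt_ray G (P.contDiffAt_X₀ hdom)
  have hY := P.hasDerivAt_ray G (P.contDiffAt_Y₀ hdom)
  have hpow : HasDerivAt (fun ρ => P.power G (ρ, 0, φ)) _ 0 :=
    ((((hx.pow 3).sub hx).mul hX).add ((((hy.pow 3).sub hy).const_mul P.γ).mul
      hY)).congr_of_eventuallyEq
      (Eventually.of_forall fun ρ => by simp [power, point])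
  have hden : HasDerivAt (fun ρ : ℝ => G.α φ * (1 + ρ)) (G.α φ) 0 := by
    simpa using ((hasDerivAt_id (0 : ℝ)).const_add 1).const_mul (G.α φ)
  have hΩ : HasDerivAt (fun ρ => P.angularVelocity G (ρ, 0, φ)) _ 0 :=
    (((((hy.pow 3).sub hy).const_mul P.γ).const_mul (G.S φ - l)).sub
      ((((hx.pow 3).sub hx).neg).const_mul (G.C φ - k))).div hden (by simpa using hα)
      |>.congr_of_eventuallyEq
      (Eventually.of_forall fun ρ => by simp [angularVelocity, rhs, field])
  have hΩ0 := P.angularVelocity_zero G hα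
  refine (hpow.div hΩ (by rw [hΩ0]; exact one_ne_zero)).congr_deriv ?_
  rw [hΩ0]
  have hα' := congrFun G.α_eq' φ
  simp only [Pi.sub_apply, Pi.pow_apply]
  simp only [power, point_zero, κ, Pr, Φ, R, CycleParam.deriv_C, CycleParam.deriv_S,
    CycleParam.deriv_α, add_zero, mul_one]
  generalize G.α φ = a at *
  generalize P.radialDeriv G P.X₀ φ = DX
  generalize P.radialDeriv G P.Y₀ φ = DY
  norm_num [point_zero]
  field_simp
  rw [hα']
  ring

end AtZero

end PerturbedSystem

lemma exists_abs_le_of_periodic {f : ℝ → ℝ} {ω : ℝ} (hω : 0 < ω) (hf : Continuous f)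
    (hper : Function.Periodic f ω) : ∃ M, 0 < M ∧ ∀ φ, |f φ| ≤ M := by
  obtain ⟨x, hx⟩ := exists_max_of_periodic hω hf.abs
    (fun φ => by simp only [hper φ])
  exact ⟨|f x| + 1, by positivity, fun φ => (hx φ).trans (by linarith)⟩

lemma exists_le_abs_of_periodic {f : ℝ → ℝ} {ω : ℝ} (hω : 0 < ω) (hf : Continuous f)
    (hper : Function.Periodic f ω) (h0 : ∀ φ, f φ ≠ 0) : ∃ m, 0 < m ∧ ∀ φ, m ≤ |f φ| := by
  obtain ⟨x, hx⟩ := exists_max_of_periodic hω hf.abs.neg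
    (fun φ => by simp only [Pi.neg_apply, hper φ])
  exact ⟨|f x|, abs_pos.2 (h0 x), fun φ => by simpa using hx φ⟩

namespace PerturbedSystem

variable (P : PerturbedSystem) {k l : ℤ} {b : ℝ} (G : CycleParam P.γ k l b)

section AlongSolutions

variable {ρ : ℝ → ℝ} {ε φ : ℝ}

/-- A solution of the equation `dρ/dφ = slope` gives an orbit of the system. -/
lemma hasDerivAt_point_along (hα : G.α φ ≠ 0) (h1 : 1 + ρ φ ≠ 0)
    (hΩ : P.angularVelocity G (ρ φ, ε, φ) ≠ 0)
    (hρ : HasDerivAt ρ (P.slope G (ρ φ, ε, φ)) φ) :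
    HasDerivAt (fun t => P.point G (ρ t, ε, t))
      ((P.angularVelocity G (ρ φ, ε, φ))⁻¹ • P.rhs G (ρ φ, ε, φ)) φ := by
  have hC : HasDerivAt G.C (deriv G.C φ) φ := by
    rw [CycleParam.deriv_C]; exact G.hasDerivAt_C φ
  have hS : HasDerivAt G.S (deriv G.S φ) φ := by
    rw [CycleParam.deriv_S]; exact G.hasDerivAt_S φ
  have hs : P.slope G (ρ φ, ε, φ) * P.angularVelocity G (ρ φ, ε, φ) * G.α φ =
      deriv G.C φ * (P.rhs G (ρ φ, ε, φ)).2 - deriv G.S φ * (P.rhs G (ρ φ, ε, φ)).1 := by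
    unfold slope
    field_simp
  have hv : P.angularVelocity G (ρ φ, ε, φ) * (1 + ρ φ) * G.α φ =
      (G.S φ - l) * (P.rhs G (ρ φ, ε, φ)).1 - (G.C φ - k) * (P.rhs G (ρ φ, ε, φ)).2 := by
    unfold angularVelocity
    field_simp
  have hα' : G.α φ = deriv G.C φ * (G.S φ - l) - (G.C φ - k) * deriv G.S φ := rfl
  refine ((hC.add ((hC.sub_const (k : ℝ)).mul hρ)).prodMk
    (hS.add ((hS.sub_const (l : ℝ)).mul hρ))).congr_deriv ?_
  ext
  · simp only [Prod.smul_fst, smul_eq_mul]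
    rw [eq_inv_mul_iff_mul_eq₀ hΩ]
    refine mul_right_cancel₀ hα ?_
    linear_combination (G.C φ - k) * hs + deriv G.C φ * hv
      - (P.rhs G (ρ φ, ε, φ)).1 * hα'
  · simp only [Prod.smul_snd, smul_eq_mul]
    rw [eq_inv_mul_iff_mul_eq₀ hΩ]
    refine mul_right_cancel₀ hα ?_
    linear_combination (G.S φ - l) * hs + deriv G.S φ * hv
      - (P.rhs G (ρ φ, ε, φ)).2 * hα'

lemma hasDerivAt_energyDiff_along (hα : G.α φ ≠ 0) (h1 : 1 + ρ φ ≠ 0)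
    (hΩ : P.angularVelocity G (ρ φ, ε, φ) ≠ 0)
    (hρ : HasDerivAt ρ (P.slope G (ρ φ, ε, φ)) φ) :
    HasDerivAt (fun t => P.energyDiff G (ρ t, ε, t)) (ε * P.energyRate G (ρ φ, ε, φ)) φ := by
  have hz := P.hasDerivAt_point_along G hα h1 hΩ hρ
  have hx : HasDerivAt (fun t => (P.point G (ρ t, ε, t)).1) _ φ := hz.fst
  have hy : HasDerivAt (fun t => (P.point G (ρ t, ε, t)).2) _ φ := hz.snd
  -- The energy of the generating cycle does not depend on the angle, so subtracting it contributes
  -- nothing; the unperturbed part of the field preserves `H`, and only the power of the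
  -- perturbation remains.
  have he : (fun t => P.energyDiff G (ρ t, ε, t)) = fun t =>
      ((((P.point G (ρ t, ε, t)).1 ^ 2 - 1) ^ 2 + P.γ * ((P.point G (ρ t, ε, t)).2 ^ 2 - 1) ^ 2)
        - ((b ^ 2 - 1) ^ 2 + P.γ * ((l : ℝ) ^ 2 - 1) ^ 2)) / 4 := by
    funext t
    simp only [energyDiff, G.energy]
  rw [he]
  refine (((((hx.pow 2).sub_const 1).pow 2).add
    ((((hy.pow 2).sub_const 1).pow 2).const_mul P.γ)).sub_const _ |>.div_const 4).congr_deriv ?_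
  simp only [energyRate, power, Prod.smul_fst, Prod.smul_snd, smul_eq_mul, rhs, field]
  generalize P.angularVelocity G (ρ φ, ε, φ) = Ω at *
  field_simp
  norm_num
  ring

end AlongSolutions

/-! ### The normalized energy. -/

/-- The periodic part of the energy along the generating cycle. -/
noncomputable def energyShift (φ : ℝ) : ℝ := ∫ s in (0 : ℝ)..φ, P.R G s

/-- The periodic part of the logarithm of the multiplier of the energy. -/
noncomputable def logShift (φ : ℝ) : ℝ := ∫ s in (0 : ℝ)..φ, (P.κ G s - P.K G)

lemma hasDerivAt_energyShift (hb : InitialRange P.γ P.σ k l b) (φ : ℝ) :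
    HasDerivAt (P.energyShift G) (P.R G φ) φ :=
  intervalIntegral.integral_hasDerivAt_right ((P.continuous_R G hb).intervalIntegrable _ _)
    ((P.continuous_R G hb).stronglyMeasurableAtFilter _ _) (P.continuous_R G hb).continuousAt

lemma hasDerivAt_logShift (hb : InitialRange P.γ P.σ k l b) (φ : ℝ) :
    HasDerivAt (P.logShift G) (P.κ G φ - P.K G) φ := by
  have hc : Continuous fun s => P.κ G s - P.K G := (P.continuous_κ G hb).sub continuous_const
  exact intervalIntegral.integral_hasDerivAt_right (hc.intervalIntegrable _ _)
    (hc.stronglyMeasurableAtFilter _ _) hc.continuousAt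

lemma continuous_energyShift (hb : InitialRange P.γ P.σ k l b) : Continuous (P.energyShift G) :=
  continuous_iff_continuousAt.2 fun φ => (P.hasDerivAt_energyShift G hb φ).continuousAt

lemma continuous_logShift (hb : InitialRange P.γ P.σ k l b) : Continuous (P.logShift G) :=
  continuous_iff_continuousAt.2 fun φ => (P.hasDerivAt_logShift G hb φ).continuousAt

lemma _root_.Function.Periodic.intervalIntegral_periodic {f : ℝ → ℝ} {ω : ℝ}
    (hf : Function.Periodic f ω) (hc : Continuous f) (h0 : ∫ s in (0 : ℝ)..ω, f s = 0) :
    Function.Periodic (fun φ => ∫ s in (0 : ℝ)..φ, f s) ω := fun φ => by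
  have h1 := hf.intervalIntegral_add_eq φ 0
  rw [zero_add, h0] at h1
  have h2 := intervalIntegral.integral_add_adjacent_intervals (μ := MeasureTheory.volume)
    (hc.intervalIntegrable 0 φ) (hc.intervalIntegrable φ (φ + ω))
  simp only
  rw [← h2, h1, add_zero]

/-- This is where the generating equation enters: a primitive of `R` is periodic because the mean of
`R` is zero. -/
lemma periodic_energyShift (hb : P.IsAdmissible G) :
    Function.Periodic (P.energyShift G) G.ω := by
  refine (P.periodic_R G).intervalIntegral_periodic (P.continuous_R G hb.1) ?_
  have := hb.2.1
  rw [CycleParam.avg, mul_eq_zero] at this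
  exact this.resolve_left (one_div_ne_zero G.ω_pos.ne')

lemma periodic_logShift (hb : P.IsAdmissible G) : Function.Periodic (P.logShift G) G.ω := by
  refine Function.Periodic.intervalIntegral_periodic (fun φ => by rw [P.periodic_κ G φ])
    ((P.continuous_κ G hb.1).sub continuous_const) ?_
  rw [intervalIntegral.integral_sub ((P.continuous_κ G hb.1).intervalIntegrable _ _)
    intervalIntegrable_const, P.integral_κ G hb]
  simp

/-- The normalized energy, whose derivative along the solutions is `ε K` times itself up to
terms of higher order. -/
noncomputable def normalizedEnergy (ε φ ρ : ℝ) : ℝ :=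
  Real.exp (-ε * P.logShift G φ) * (P.energyDiff G (ρ, ε, φ) - ε * P.energyShift G φ)

/-- The error terms in the derivative of the normalized energy. -/
noncomputable def remainder (ε φ ρ : ℝ) : ℝ :=
  Real.exp (-ε * P.logShift G φ) * (P.energyRate G (ρ, ε, φ) - P.R G φ
    - P.κ G φ * (P.energyDiff G (ρ, ε, φ) - ε * P.energyShift G φ))

/-- The derivative of the normalized energy along the solutions. -/
noncomputable def normalizedRate (ε φ ρ : ℝ) : ℝ :=
  ε * (P.K G * P.normalizedEnergy G ε φ ρ + P.remainder G ε φ ρ)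

/-- The derivative of the exponential factor trades `κ` for `K`, and that of `energyShift` cancels
`ε R`. -/
lemma hasDerivAt_normalizedEnergy_along (hb : InitialRange P.γ P.σ k l b) {ρ : ℝ → ℝ} {ε φ : ℝ}
    (h1 : 1 + ρ φ ≠ 0) (hΩ : P.angularVelocity G (ρ φ, ε, φ) ≠ 0)
    (hρ : HasDerivAt ρ (P.slope G (ρ φ, ε, φ)) φ) :
    HasDerivAt (fun t => P.normalizedEnergy G ε t (ρ t)) (P.normalizedRate G ε φ (ρ φ)) φ := by
  refine ((((P.hasDerivAt_logShift G hb φ).const_mul (-ε)).exp).mul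
    ((P.hasDerivAt_energyDiff_along G (P.star_shaped G hb φ).1 h1 hΩ hρ).sub
      ((P.hasDerivAt_energyShift G hb φ).const_mul ε))).congr_deriv ?_
  simp only [normalizedRate, remainder, normalizedEnergy, Pi.sub_apply]
  ring

section Periodicity

variable (ρ ε φ : ℝ)

lemma point_add : P.point G (ρ, ε, φ + G.ω) = P.point G (ρ, ε, φ) := by
  simp only [point, G.periodic_C φ, G.periodic_S φ]

lemma rhs_add : P.rhs G (ρ, ε, φ + G.ω) = P.rhs G (ρ, ε, φ) := by
  simp only [rhs, point_add]

lemma angularVelocity_add :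
    P.angularVelocity G (ρ, ε, φ + G.ω) = P.angularVelocity G (ρ, ε, φ) := by
  simp only [angularVelocity, rhs_add, G.periodic_C φ, G.periodic_S φ, G.periodic_α φ]

lemma slope_add : P.slope G (ρ, ε, φ + G.ω) = P.slope G (ρ, ε, φ) := by
  simp only [slope, rhs_add, angularVelocity_add, G.periodic_deriv_C φ, G.periodic_deriv_S φ,
    G.periodic_α φ]

lemma energyDiff_add : P.energyDiff G (ρ, ε, φ + G.ω) = P.energyDiff G (ρ, ε, φ) := by
  simp only [energyDiff, point_add, G.periodic_C φ, G.periodic_S φ]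

lemma energyRate_add : P.energyRate G (ρ, ε, φ + G.ω) = P.energyRate G (ρ, ε, φ) := by
  simp only [energyRate, power, point_add, angularVelocity_add]

lemma normalizedEnergy_add (hb : P.IsAdmissible G) :
    P.normalizedEnergy G ε (φ + G.ω) ρ = P.normalizedEnergy G ε φ ρ := by
  simp only [normalizedEnergy, energyDiff_add, P.periodic_logShift G hb φ,
    P.periodic_energyShift G hb φ]

end Periodicity

/-! ### Uniform estimates of the radial equation. -/

/-- Estimates of the equation in polar coordinates for `|ρ| ≤ r` and `0 ≤ ε ≤ min r ε₀`. -/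
structure RadialEstimates (η L r : ℝ) : Prop where
  r_pos : 0 < r
  r_le : r ≤ 1 / 2
  L_nonneg : 0 ≤ L
  point_mem : ∀ {ρ ε φ}, |ρ| ≤ r → P.point G (ρ, ε, φ) ∈ P.domain
  angularVelocity_mem : ∀ {ρ ε φ}, |ρ| ≤ r → ε ∈ Icc 0 P.ε₀ → ε ≤ r →
    P.angularVelocity G (ρ, ε, φ) ∈ Icc (1 / 2) (3 / 2)
  slope_lipschitz : ∀ {ρ₁ ρ₂ ε φ}, |ρ₁| ≤ r → |ρ₂| ≤ r → ε ∈ Icc 0 P.ε₀ → ε ≤ r →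
    |P.slope G (ρ₁, ε, φ) - P.slope G (ρ₂, ε, φ)| ≤ L * |ρ₁ - ρ₂|
  slope_le : ∀ {ρ ε φ}, |ρ| ≤ r → ε ∈ Icc 0 P.ε₀ → ε ≤ r → |P.slope G (ρ, ε, φ)| ≤ L
  energyDiff_approx : ∀ {ρ₁ ρ₂ ε φ}, |ρ₁| ≤ r → |ρ₂| ≤ r → ε ∈ Icc 0 P.ε₀ → ε ≤ r →
    |P.energyDiff G (ρ₁, ε, φ) - P.energyDiff G (ρ₂, ε, φ) - G.α φ * (ρ₁ - ρ₂)|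
      ≤ η * |ρ₁ - ρ₂|
  energyRate_approx : ∀ {ρ₁ ρ₂ ε φ}, |ρ₁| ≤ r → |ρ₂| ≤ r → ε ∈ Icc 0 P.ε₀ → ε ≤ r →
    |P.energyRate G (ρ₁, ε, φ) - P.energyRate G (ρ₂, ε, φ) - P.κ G φ * G.α φ * (ρ₁ - ρ₂)|
      ≤ η * |ρ₁ - ρ₂|
  energyRate_near : ∀ {ε φ}, ε ∈ Icc 0 P.ε₀ → ε ≤ r →
    |P.energyRate G (0, ε, φ) - P.R G φ| ≤ L * ε

lemma exists_point_mem (hb : InitialRange P.γ P.σ k l b) :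
    ∃ r > 0, ∀ ρ ε φ, |ρ| ≤ r → P.point G (ρ, ε, φ) ∈ P.domain := by
  have key := exists_uniform G.ω_pos
    (Q := fun _ _ x φ => P.point G (x.1, 0, φ) ∈ P.domain)
    (fun _ _ _ _ _ h => h) (fun _ x φ => by rw [point_add])
  obtain ⟨-, r, hr, h⟩ := key (by
    intro φ
    refine ⟨0, ?_⟩
    have hcont : Continuous fun z : (ℝ × ℝ × ℝ) × ℝ => P.point G (z.1.1, 0, z.2) :=
      (P.contDiff_point G).continuous.comp (by fun_prop)
    exact hcont.continuousAt.eventually (P.isOpen_domain.mem_nhds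
      (by simpa [point_zero] using (P.star_shaped G hb φ).2)))
  exact ⟨r, hr, fun ρ ε φ h1 => h ρ ρ 0 h1 h1 (by simpa using hr.le) φ⟩

lemma exists_radialEstimates (hb : InitialRange P.γ P.σ k l b) {η : ℝ} (hη : 0 < η) :
    ∃ L r, P.RadialEstimates G η L r := by
  have hω := G.ω_pos
  have hε := P.ε₀_pos.le
  have hα := fun φ => (P.star_shaped G hb φ).1
  have hdom : ∀ φ, P.point G (0, 0, φ) ∈ P.domain := fun φ => by
    rw [point_zero]; exact (P.star_shaped G hb φ).2
  have hmem : ∀ φ, ((0, 0, φ) : ℝ × ℝ × ℝ) ∈ slab P.ε₀ := fun φ => mem_slab ⟨le_rfl, hε⟩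
  have h1 : (1 : ℝ) + 0 ≠ 0 := by norm_num
  have hΩ0 : ∀ φ, P.angularVelocity G (0, 0, φ) ≠ 0 := fun φ => by
    rw [P.angularVelocity_zero G (hα φ)]; exact one_ne_zero
  have rΩ := fun φ => P.contDiffWithinAt_angularVelocity G (hdom φ) (hmem φ) (hα φ) h1
  have rF := fun φ => P.contDiffWithinAt_slope G (hdom φ) (hmem φ) (hα φ) h1 (hΩ0 φ)
  have rN := fun φ => P.contDiffWithinAt_energyRate G (hdom φ) (hmem φ) (hα φ) h1 (hΩ0 φ)
  have rH := fun φ => (P.contDiff_energyDiff G).contDiffAt.contDiffWithinAt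
    (s := slab P.ε₀) (x := (0, 0, φ))
  obtain ⟨r₁, hr₁, e₁⟩ := P.exists_point_mem G hb
  obtain ⟨L₂, r₂, hr₂, e₂⟩ := exists_uniform_near hω hε rΩ (P.angularVelocity_add G)
  obtain ⟨L₃, r₃, hr₃, e₃⟩ := exists_uniform_lipschitz hω hε rF (P.slope_add G)
  obtain ⟨r₄, hr₄, e₄⟩ := exists_uniform_approx hω hε rH (P.energyDiff_add G)
    G.continuous_α G.periodic_α (P.hasDerivAt_energyDiff G) hη
  obtain ⟨r₅, hr₅, e₅⟩ := exists_uniform_approx hω hε rN (P.energyRate_add G)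
    ((P.continuous_κ G hb).mul G.continuous_α) ((P.periodic_κ G).mul G.periodic_α)
    (P.hasDerivAt_energyRate G hb) hη
  obtain ⟨L₆, r₆, hr₆, e₆⟩ := exists_uniform_near hω hε rN (P.energyRate_add G)
  -- This radius keeps the angular velocity within `1/2` of its value `1` on the generating cycle.
  set r₇ := 1 / (2 * (|L₂| + 1)) with hr₇
  have hr₇0 : 0 < r₇ := by positivity
  have hL₂ : |L₂| * r₇ ≤ 1 / 2 := by
    rw [hr₇, ← mul_div_assoc, div_le_div_iff₀ (by positivity) (by norm_num)]
    linarith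
  obtain ⟨r, hr0, hr⟩ : ∃ r > 0, r ≤ r₁ ∧ r ≤ r₂ ∧ r ≤ r₃ ∧ r ≤ r₄ ∧ r ≤ r₅ ∧ r ≤ r₆ ∧ r ≤ r₇ ∧
      r ≤ 1 / 2 := by
    refine ⟨min r₁ (min r₂ (min r₃ (min r₄ (min r₅ (min r₆ (min r₇ (1 / 2))))))),
      by simp only [gt_iff_lt, lt_min_iff]; norm_num; tauto, ?_⟩
    simp
  obtain ⟨hr1, hr2, hr3, hr4, hr5, hr6, hr7, hr8⟩ := hr
  refine ⟨max |L₃| |L₆|, r, hr0, hr8, (abs_nonneg _).trans (le_max_left _ _),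
    fun h => e₁ _ _ _ (h.trans hr1), fun {ρ ε φ} h h' h'' => ?_,
    fun h h' hε hε' => ?_, fun h hε hε' => ?_, fun h h' hε hε' => ?_, fun h h' hε hε' => ?_,
    fun {ε φ} hε hε' => ?_⟩
  · have ha : |ε| ≤ r := by rwa [abs_of_nonneg h'.1]
    have := e₂ ρ ε φ (h.trans hr2) (ha.trans hr2) h'
    rw [P.angularVelocity_zero G (hα φ)] at this
    have h3 : L₂ * max |ρ| |ε| ≤ |L₂| * r₇ := by
      gcongr
      · exact le_abs_self _
      · exact max_le (h.trans hr7) (ha.trans hr7)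
    have := abs_le.1 (this.trans (h3.trans hL₂))
    constructor <;> linarith [this.1, this.2]
  · rw [← abs_of_nonneg hε.1] at hε'
    exact (e₃ _ _ _ _ (h.trans hr3) (h'.trans hr3) (hε'.trans hr3) hε).1.trans
      (by gcongr; exact (le_abs_self _).trans (le_max_left _ _))
  · rw [← abs_of_nonneg hε.1] at hε'
    exact (e₃ _ _ _ _ (h.trans hr3) (h.trans hr3) (hε'.trans hr3) hε).2.trans
      ((le_abs_self _).trans (le_max_left _ _))
  · rw [← abs_of_nonneg hε.1] at hε'
    exact e₄ _ _ _ _ (h.trans hr4) (h'.trans hr4) (hε'.trans hr4) hε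
  · rw [← abs_of_nonneg hε.1] at hε'
    exact e₅ _ _ _ _ (h.trans hr5) (h'.trans hr5) (hε'.trans hr5) hε
  · have ha : |ε| ≤ r := by rwa [abs_of_nonneg hε.1]
    have := e₆ 0 ε φ (by simpa using hr₆.le) (ha.trans hr6) hε
    rw [P.energyRate_zero G (hα φ), abs_zero, max_eq_right (abs_nonneg _),
      abs_of_nonneg hε.1] at this
    have hε0 := hε.1
    exact this.trans (by gcongr; exact (le_abs_self _).trans (le_max_right _ _))

end PerturbedSystem

/-! ### The radial equation is a trapping field. -/

namespace PerturbedSystem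

variable (P : PerturbedSystem) {k l : ℤ} {b : ℝ} (G : CycleParam P.γ k l b)

/-- Bounds of the coefficients on the generating cycle. -/
structure CoefficientBounds (a A κ₀ m g₀ : ℝ) : Prop where
  a_pos : 0 < a
  κ₀_pos : 0 < κ₀
  m_pos : 0 < m
  g₀_pos : 0 < g₀
  le_α : ∀ φ, a ≤ |G.α φ|
  α_le : ∀ φ, |G.α φ| ≤ A
  κ_le : ∀ φ, |P.κ G φ| ≤ κ₀
  logShift_le : ∀ φ, |P.logShift G φ| ≤ m
  energyShift_le : ∀ φ, |P.energyShift G φ| ≤ g₀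

lemma exists_coefficientBounds (hb : P.IsAdmissible G) :
    ∃ a A κ₀ m g₀, P.CoefficientBounds G a A κ₀ m g₀ := by
  have hω := G.ω_pos
  obtain ⟨a, ha, ha'⟩ := exists_le_abs_of_periodic hω G.continuous_α G.periodic_α
    fun φ => (P.star_shaped G hb.1 φ).1
  obtain ⟨A, -, hA⟩ := exists_abs_le_of_periodic hω G.continuous_α G.periodic_α
  obtain ⟨κ₀, hκ, hκ'⟩ := exists_abs_le_of_periodic hω (P.continuous_κ G hb.1) (P.periodic_κ G)
  obtain ⟨m, hm, hm'⟩ := exists_abs_le_of_periodic hω (P.continuous_logShift G hb.1)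
    (P.periodic_logShift G hb)
  obtain ⟨g₀, hg, hg'⟩ := exists_abs_le_of_periodic hω (P.continuous_energyShift G hb.1)
    (P.periodic_energyShift G hb)
  exact ⟨a, A, κ₀, m, g₀, ha, hκ, hm, hg, ha', hA, hκ', hm', hg'⟩

variable {P G} {a A κ₀ m g₀ η L r ε : ℝ}

lemma CoefficientBounds.exp_mem (h : P.CoefficientBounds G a A κ₀ m g₀) (hε : 0 ≤ ε)
    (hεm : ε * m ≤ 1 / 2) (φ : ℝ) :
    Real.exp (-ε * P.logShift G φ) ∈ Icc (1 / 2) 2 := by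
  have h1 : |(-ε * P.logShift G φ)| ≤ 1 / 2 := by
    rw [abs_mul, abs_neg, abs_of_nonneg hε]
    exact (mul_le_mul_of_nonneg_left (h.logShift_le φ) hε).trans hεm
  obtain ⟨h2, h3⟩ := abs_le.1 h1
  constructor
  · linarith [Real.add_one_le_exp (-ε * P.logShift G φ)]
  · have := Real.exp_bound_div_one_sub_of_interval' (x := 1 / 2) (by norm_num) (by norm_num)
    exact (Real.exp_le_exp.2 h3).trans (this.le.trans (by norm_num))

namespace RadialEstimates

section EnergyDifference

variable (h : P.RadialEstimates G η L r) (hB : P.CoefficientBounds G a A κ₀ m g₀)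
  (hηa : η ≤ a / 2) (hε : ε ∈ Icc 0 P.ε₀) (hεr : ε ≤ r)
include h hB hηa hε hεr

lemma le_energyDiff_sub {ρ₁ ρ₂ φ : ℝ} (h1 : |ρ₁| ≤ r) (h2 : |ρ₂| ≤ r) :
    a / 2 * |ρ₁ - ρ₂| ≤ |P.energyDiff G (ρ₁, ε, φ) - P.energyDiff G (ρ₂, ε, φ)| := by
  have h3 := h.energyDiff_approx (φ := φ) h1 h2 hε hεr
  have h4 := abs_sub_abs_le_abs_sub (G.α φ * (ρ₁ - ρ₂))
    (P.energyDiff G (ρ₁, ε, φ) - P.energyDiff G (ρ₂, ε, φ))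
  rw [abs_sub_comm (G.α φ * (ρ₁ - ρ₂)), abs_mul] at h4
  have h5 := mul_le_mul_of_nonneg_right (hB.le_α φ) (abs_nonneg (ρ₁ - ρ₂))
  have h6 := mul_le_mul_of_nonneg_right hηa (abs_nonneg (ρ₁ - ρ₂))
  linarith

lemma energyDiff_sub_le {ρ₁ ρ₂ φ : ℝ} (h1 : |ρ₁| ≤ r) (h2 : |ρ₂| ≤ r) :
    |P.energyDiff G (ρ₁, ε, φ) - P.energyDiff G (ρ₂, ε, φ)| ≤ (A + a / 2) * |ρ₁ - ρ₂| := by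
  have h3 := h.energyDiff_approx (φ := φ) h1 h2 hε hεr
  have h4 := abs_sub_abs_le_abs_sub (P.energyDiff G (ρ₁, ε, φ) - P.energyDiff G (ρ₂, ε, φ))
    (G.α φ * (ρ₁ - ρ₂))
  rw [abs_mul] at h4
  have h5 := mul_le_mul_of_nonneg_right (hB.α_le φ) (abs_nonneg (ρ₁ - ρ₂))
  have h6 := mul_le_mul_of_nonneg_right hηa (abs_nonneg (ρ₁ - ρ₂))
  linarith

variable (hεm : ε * m ≤ 1 / 2)
include hεm

lemma le_normalizedEnergy_sub {ρ₁ ρ₂ φ : ℝ} (h1 : |ρ₁| ≤ r) (h2 : |ρ₂| ≤ r) :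
    a / 4 * |ρ₁ - ρ₂| ≤ |P.normalizedEnergy G ε φ ρ₁ - P.normalizedEnergy G ε φ ρ₂| := by
  have h3 := h.le_energyDiff_sub hB hηa hε hεr (φ := φ) h1 h2
  obtain ⟨h4, -⟩ := hB.exp_mem hε.1 hεm φ
  have ha := hB.a_pos
  rw [normalizedEnergy, normalizedEnergy, ← mul_sub, sub_sub_sub_cancel_right, abs_mul,
    Real.abs_exp]
  calc a / 4 * |ρ₁ - ρ₂| = 1 / 2 * (a / 2 * |ρ₁ - ρ₂|) := by ring
    _ ≤ _ := by gcongr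

lemma normalizedEnergy_sub_le {ρ₁ ρ₂ φ : ℝ} (h1 : |ρ₁| ≤ r) (h2 : |ρ₂| ≤ r) :
    |P.normalizedEnergy G ε φ ρ₁ - P.normalizedEnergy G ε φ ρ₂| ≤ 2 * (A + a / 2) * |ρ₁ - ρ₂| := by
  have h3 := h.energyDiff_sub_le hB hηa hε hεr (φ := φ) h1 h2
  obtain ⟨-, h4⟩ := hB.exp_mem hε.1 hεm φ
  rw [normalizedEnergy, normalizedEnergy, ← mul_sub, sub_sub_sub_cancel_right, abs_mul,
    Real.abs_exp, mul_assoc]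
  gcongr

-- The linear parts `κ α (ρ₁ - ρ₂)` of the rate and of `κ` times the energy cancel. What is left is
-- at most `η (1 + κ₀) |ρ₁ - ρ₂|`, and differences of `ρ` are controlled by differences of the
-- energy because `|α| ≥ a`. Both differences carry the same exponential factor, so no loss occurs
-- in passing to the normalized energy.
omit hεm in
lemma remainder_sub_le (hηK : η * (1 + κ₀) ≤ |P.K G| / 2 * (a / 2)) {ρ₁ ρ₂ φ : ℝ}
    (h1 : |ρ₁| ≤ r) (h2 : |ρ₂| ≤ r) :
    |P.remainder G ε φ ρ₁ - P.remainder G ε φ ρ₂| ≤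
      |P.K G| / 2 * |P.normalizedEnergy G ε φ ρ₁ - P.normalizedEnergy G ε φ ρ₂| := by
  have h3 := h.le_energyDiff_sub hB hηa hε hεr (φ := φ) h1 h2
  have h4 := h.energyDiff_approx (φ := φ) h1 h2 hε hεr
  have h5 := h.energyRate_approx (φ := φ) h1 h2 hε hεr
  have h6 : |P.energyRate G (ρ₁, ε, φ) - P.energyRate G (ρ₂, ε, φ)
      - P.κ G φ * (P.energyDiff G (ρ₁, ε, φ) - P.energyDiff G (ρ₂, ε, φ))| ≤
      |P.K G| / 2 * |P.energyDiff G (ρ₁, ε, φ) - P.energyDiff G (ρ₂, ε, φ)| := by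
    calc _ = |(P.energyRate G (ρ₁, ε, φ) - P.energyRate G (ρ₂, ε, φ)
          - P.κ G φ * G.α φ * (ρ₁ - ρ₂)) - P.κ G φ * (P.energyDiff G (ρ₁, ε, φ)
          - P.energyDiff G (ρ₂, ε, φ) - G.α φ * (ρ₁ - ρ₂))| := by congr 1; ring
      _ ≤ η * |ρ₁ - ρ₂| + κ₀ * (η * |ρ₁ - ρ₂|) := by
        refine (abs_sub _ _).trans (add_le_add h5 ?_)
        rw [abs_mul]
        exact mul_le_mul (hB.κ_le φ) h4 (abs_nonneg _) hB.κ₀_pos.le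
      _ = η * (1 + κ₀) * |ρ₁ - ρ₂| := by ring
      _ ≤ |P.K G| / 2 * (a / 2) * |ρ₁ - ρ₂| := by gcongr
      _ = |P.K G| / 2 * (a / 2 * |ρ₁ - ρ₂|) := by ring
      _ ≤ _ := by gcongr
  calc |P.remainder G ε φ ρ₁ - P.remainder G ε φ ρ₂|
      = Real.exp (-ε * P.logShift G φ) * |P.energyRate G (ρ₁, ε, φ) - P.energyRate G (ρ₂, ε, φ)
      - P.κ G φ * (P.energyDiff G (ρ₁, ε, φ) - P.energyDiff G (ρ₂, ε, φ))| := by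
        rw [← Real.abs_exp (-ε * P.logShift G φ), ← abs_mul, remainder, remainder]
        congr 1; ring
    _ ≤ Real.exp (-ε * P.logShift G φ) * (|P.K G| / 2 *
        |P.energyDiff G (ρ₁, ε, φ) - P.energyDiff G (ρ₂, ε, φ)|) := by gcongr
    _ = |P.K G| / 2 * (Real.exp (-ε * P.logShift G φ) *
        |P.energyDiff G (ρ₁, ε, φ) - P.energyDiff G (ρ₂, ε, φ)|) := by ring
    _ = _ := by
        rw [normalizedEnergy, normalizedEnergy, ← mul_sub, sub_sub_sub_cancel_right, abs_mul,
          Real.abs_exp]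

omit hηa h hεr in
lemma normalizedEnergy_zero_le (φ : ℝ) : |P.normalizedEnergy G ε φ 0| ≤ 2 * g₀ * ε := by
  have hε0 := hε.1
  obtain ⟨-, h4⟩ := hB.exp_mem hε.1 hεm φ
  rw [normalizedEnergy, energyDiff_zero, zero_sub, abs_mul, abs_neg, abs_mul, Real.abs_exp,
    abs_of_nonneg hε0]
  calc _ ≤ 2 * (ε * g₀) := by gcongr; exact hB.energyShift_le φ
    _ = _ := by ring

omit hηa in
lemma remainder_zero_le (φ : ℝ) : |P.remainder G ε φ 0| ≤ 2 * (L + κ₀ * g₀) * ε := by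
  have hε0 := hε.1
  have hκ := hB.κ₀_pos
  obtain ⟨-, h4⟩ := hB.exp_mem hε.1 hεm φ
  have h5 := h.energyRate_near (φ := φ) hε hεr
  rw [remainder, energyDiff_zero, zero_sub, abs_mul, Real.abs_exp]
  calc _ ≤ 2 * (L * ε + κ₀ * (ε * g₀)) := by
        gcongr
        refine (abs_sub _ _).trans (add_le_add h5 ?_)
        rw [abs_mul, abs_neg, abs_mul, abs_of_nonneg hε0]
        gcongr
        · exact hB.κ_le φ
        · exact hB.energyShift_le φ
    _ = _ := by ring

end EnergyDifference

end RadialEstimates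

variable (P G) in
/-- For small `ε`, the equation in polar coordinates, with the direction of the angle chosen by the
sign of `K`, is a trapping field. -/
structure IsTrapping (s η L r δ c C B ε₁ : ℝ) : Prop where
  sign : s = 1 ∧ P.K G < 0 ∨ s = -1 ∧ 0 < P.K G
  estimates : P.RadialEstimates G η L r
  B_pos : 0 < B
  c_pos : 0 < c
  ε₁_pos : 0 < ε₁
  ε₁_le : ε₁ ≤ P.ε₀
  ε₁_le_r : ε₁ ≤ r
  zero_le : ∀ {ε φ}, 0 ≤ ε → ε ≤ ε₁ → |P.normalizedEnergy G ε φ 0| ≤ B * ε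
  trapping : ∀ {ε}, 0 < ε → ε ≤ ε₁ → TrappingField (fun φ ρ => s * P.slope G (ρ, ε, s * φ))
    (fun φ ρ => P.normalizedEnergy G ε (s * φ) ρ) (fun φ ρ => s * P.normalizedRate G ε (s * φ) ρ)
    G.ω r δ (ε * (|P.K G| / 2)) (ε * (B * ε)) c C

lemma add_period_of_sign {s ω : ℝ} (hs : s = 1 ∨ s = -1) {β : Type*} {f : ℝ → β}
    (hf : Function.Periodic f ω) (φ : ℝ) : f (s * (φ + ω)) = f (s * φ) := by
  rcases hs with rfl | rfl
  · simpa using hf φ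
  · rw [show (-1 : ℝ) * (φ + ω) = -1 * φ - ω by ring]
    exact hf.sub_eq _

lemma RadialEstimates.contDiffWithinAt_slope (h : P.RadialEstimates G η L r)
    (hb : InitialRange P.γ P.σ k l b) {ε : ℝ} (hε : ε ∈ Icc 0 P.ε₀) (hεr : ε ≤ r) {ρ φ : ℝ}
    (hρ : |ρ| ≤ r) : ContDiffWithinAt ℝ 1 (P.slope G) (slab P.ε₀) (ρ, ε, φ) := by
  refine P.contDiffWithinAt_slope G (h.point_mem hρ) (mem_slab hε) (P.star_shaped G hb φ).1 ?_ ?_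
  · have := (abs_le.1 hρ).1
    have := h.r_le
    simp only
    linarith
  · have := (h.angularVelocity_mem (φ := φ) hρ hε hεr).1
    linarith

theorem exists_isTrapping (hb : P.IsAdmissible G) :
    ∃ s η L r δ c C B ε₁, P.IsTrapping G s η L r δ c C B ε₁ := by
  obtain ⟨a, A, κ₀, m, g₀, hB⟩ := P.exists_coefficientBounds G hb
  have ha := hB.a_pos
  have hκ := hB.κ₀_pos
  have hm := hB.m_pos
  have hg := hB.g₀_pos
  have hK : 0 < |P.K G| := abs_pos.2 hb.2.2
  -- The first bound keeps the energy a coordinate on the strip; the second lets the remainder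
  -- consume at most half of the rate `|K|`.
  obtain ⟨η, hη, hη1, hη2⟩ : ∃ η > 0, η ≤ a / 2 ∧ η * (1 + κ₀) ≤ |P.K G| / 2 * (a / 2) := by
    refine ⟨min (a / 2) (|P.K G| / 2 * (a / 2) / (1 + κ₀)),
      lt_min (by positivity) (by positivity), min_le_left _ _, ?_⟩
    rw [← le_div_iff₀ (by positivity)]
    exact min_le_right _ _
  obtain ⟨L, r, h⟩ := P.exists_radialEstimates G hb.1 hη
  have hr := h.r_pos
  have hL := h.L_nonneg
  -- The angle is reversed when `K > 0`, so that in either case the equation contracts: `s K =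
  -- -|K|`.
  obtain ⟨s, hs⟩ : ∃ s : ℝ, s = 1 ∧ P.K G < 0 ∨ s = -1 ∧ 0 < P.K G := by
    rcases lt_or_gt_of_ne hb.2.2 with h | h
    · exact ⟨1, Or.inl ⟨rfl, h⟩⟩
    · exact ⟨-1, Or.inr ⟨rfl, h⟩⟩
  have hs1 : s = 1 ∨ s = -1 := hs.imp And.left And.left
  have hsK : s * P.K G = -|P.K G| := by
    rcases hs with ⟨rfl, hK⟩ | ⟨rfl, hK⟩
    · rw [abs_of_neg hK]; ring
    · rw [abs_of_pos hK]; ring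
  have hs2 : s * s = 1 := by rcases hs1 with rfl | rfl <;> norm_num
  have hsa : |s| = 1 := by rcases hs1 with rfl | rfl <;> norm_num
  -- The summands bound the remainder at `ρ = 0`, the cost of passing from `w - w(0)` to `w` in its
  -- Lipschitz estimate, and `w(0)` itself, each divided by `ε`.
  set B := 2 * (L + κ₀ * g₀) + |P.K G| * g₀ + 2 * g₀ with hBdef
  have hBpos : 0 < B := by positivity
  -- If `|w| ≤ δ` and `|w(0)| ≤ δ`, then `(a / 4) |ρ| ≤ 2 δ`, whence `|ρ| ≤ r / 2 < r`.
  set δ := a * r / 16 with hδdef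
  have hδ : 0 < δ := by positivity
  obtain ⟨ε₁, hε₁, h1, h2, h3, h4, h5⟩ : ∃ ε₁ > 0, ε₁ ≤ P.ε₀ ∧ ε₁ ≤ r ∧ ε₁ * m ≤ 1 / 2 ∧
      B * ε₁ ≤ δ ∧ B * ε₁ < |P.K G| / 2 * δ := by
    refine ⟨min P.ε₀ (min r (min (1 / 2 / m) (min (δ / B) (|P.K G| / 4 * δ / B)))), ?_,
      ?_, ?_, ?_, ?_, ?_⟩
    · have := P.ε₀_pos
      simp only [gt_iff_lt, lt_min_iff]
      refine ⟨this, hr, ?_, ?_, ?_⟩ <;> positivity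
    · exact min_le_left _ _
    · exact (min_le_right _ _).trans (min_le_left _ _)
    · rw [← le_div_iff₀ hm]
      exact (min_le_right _ _).trans ((min_le_right _ _).trans (min_le_left _ _))
    · rw [mul_comm, ← le_div_iff₀ hBpos]
      exact (min_le_right _ _).trans ((min_le_right _ _).trans ((min_le_right _ _).trans
        (min_le_left _ _)))
    · rw [mul_comm, ← lt_div_iff₀ hBpos]
      refine ((min_le_right _ _).trans ((min_le_right _ _).trans ((min_le_right _ _).trans
        (min_le_right _ _)))).trans_lt ?_
      gcongr
      norm_num
  have hεIcc : ∀ {ε}, 0 ≤ ε → ε ≤ ε₁ → ε ∈ Icc 0 P.ε₀ := fun h h' => ⟨h, h'.trans h1⟩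
  have hεm : ∀ {ε}, ε ≤ ε₁ → ε * m ≤ 1 / 2 := fun h' =>
    (mul_le_mul_of_nonneg_right h' hm.le).trans h3
  have hzero : ∀ {ε φ}, 0 ≤ ε → ε ≤ ε₁ → |P.normalizedEnergy G ε φ 0| ≤ B * ε := fun h' h'' => by
    refine (RadialEstimates.normalizedEnergy_zero_le hB (hεIcc h' h'') (hεm h'') _).trans ?_
    gcongr
    rw [hBdef]
    have : 0 ≤ 2 * (L + κ₀ * g₀) + |P.K G| * g₀ := by positivity
    linarith
  have h0r : |(0 : ℝ)| ≤ r := by simpa using hr.le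
  refine ⟨s, η, L, r, δ, a / 4, 2 * (A + a / 2), B, ε₁, hs, h, hBpos, by positivity, hε₁, h1, h2,
    hzero, fun {ε} hε0 hε1 => ?_⟩
  have hεI := hεIcc hε0.le hε1
  have hεr := hε1.trans h2
  have hεm := hεm hε1
  have hzδ : ∀ φ, |P.normalizedEnergy G ε φ 0| ≤ δ := fun φ =>
    (hzero hε0.le hε1).trans ((mul_le_mul_of_nonneg_left hε1 hBpos.le).trans h4)
  have hlow : ∀ {ρ₁ ρ₂ φ}, |ρ₁| ≤ r → |ρ₂| ≤ r → a / 4 * |ρ₁ - ρ₂| ≤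
      |P.normalizedEnergy G ε φ ρ₁ - P.normalizedEnergy G ε φ ρ₂| := fun h1 h2 =>
    h.le_normalizedEnergy_sub hB hη1 hεI hεr hεm h1 h2
  have hrem : ∀ {ρ₁ ρ₂ φ}, |ρ₁| ≤ r → |ρ₂| ≤ r → |P.remainder G ε φ ρ₁ - P.remainder G ε φ ρ₂| ≤
      |P.K G| / 2 * |P.normalizedEnergy G ε φ ρ₁ - P.normalizedEnergy G ε φ ρ₂| := fun h1 h2 =>
    h.remainder_sub_le hB hη1 hεI hεr hη2 h1 h2
  refine
    { ω_pos := G.ω_pos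
      r_pos := hr
      lam_pos := by positivity
      c_pos := by positivity
      periodic_F := fun φ ρ => ?_
      periodic_W := fun φ ρ => ?_
      continuous_F := fun ρ hρ => ?_
      lipschitz_F := ⟨⟨L, hL⟩, fun φ ρ₁ ρ₂ h1 h2 => ?_⟩
      bounded_F := ⟨L, fun φ ρ hρ => ?_⟩
      hasDerivAt_W := fun ρ φ hρ hd => ?_
      lower_W := fun φ ρ₁ ρ₂ h1 h2 => hlow h1 h2
      upper_W := fun φ ρ₁ ρ₂ h1 h2 => h.normalizedEnergy_sub_le hB hη1 hεI hεr hεm h1 h2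
      contracting := fun φ ρ₁ ρ₂ h1 h2 => ?_
      dissipative := fun φ ρ hρ => ?_
      δ_pos := hδ
      μ_nonneg := by positivity
      μ_lt := ?_
      zero_mem := fun φ => hzδ _
      abs_lt := fun φ ρ hρ hW => ?_ }
  · exact congrArg (s * ·) (add_period_of_sign hs1 (f := fun φ => P.slope G (ρ, ε, φ))
      (P.slope_add G ρ ε) φ)
  · exact add_period_of_sign hs1 (f := fun φ => P.normalizedEnergy G ε φ ρ)
      (fun φ => P.normalizedEnergy_add G ρ ε φ hb) φ
  · refine continuous_const.mul (continuous_iff_continuousAt.2 fun φ => ?_)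
    have h1 : Tendsto (fun φ : ℝ => ((ρ, ε, s * φ) : ℝ × ℝ × ℝ)) (𝓝 φ)
        (𝓝[slab P.ε₀] (ρ, ε, s * φ)) :=
      tendsto_nhdsWithin_iff.2 ⟨Continuous.tendsto' (by fun_prop) _ _ rfl,
        Eventually.of_forall fun φ => mem_slab hεI⟩
    exact (h.contDiffWithinAt_slope hb.1 hεI hεr hρ).continuousWithinAt.tendsto.comp h1
  · rw [← mul_sub, abs_mul, hsa, one_mul]
    exact h.slope_lipschitz h1 h2 hεI hεr
  · rw [abs_mul, hsa, one_mul]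
    exact h.slope_le hρ hεI hεr
  · have hd' : HasDerivAt (fun t => ρ (s * t)) (P.slope G (ρ (s * (s * φ)), ε, s * φ)) (s * φ) := by
      have hd1 : HasDerivAt ρ (s * P.slope G (ρ φ, ε, s * φ)) (s * (s * φ)) := by
        rw [← mul_assoc, hs2, one_mul]; exact hd
      have := hd1.comp (s * φ) ((hasDerivAt_id (s * φ)).const_mul s)
      refine this.congr_deriv ?_
      rw [← mul_assoc s s φ, hs2, one_mul, mul_one, mul_right_comm, hs2, one_mul]
    have hρ' : |ρ (s * (s * φ))| ≤ r := by rwa [← mul_assoc, hs2, one_mul]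
    have h6 := P.hasDerivAt_normalizedEnergy_along G hb.1 (ρ := fun t => ρ (s * t))
      (by have := (_root_.abs_le.1 hρ').1; have := h.r_le; linarith)
      (by have := (h.angularVelocity_mem (φ := s * φ) hρ' hεI hεr).1; linarith) hd'
    have h7 : HasDerivAt (fun t => P.normalizedEnergy G ε (s * t) (ρ (s * (s * t)))) _ φ :=
      h6.comp φ ((hasDerivAt_id φ).const_mul s)
    have e : (fun t => P.normalizedEnergy G ε (s * t) (ρ (s * (s * t)))) =
        fun t => P.normalizedEnergy G ε (s * t) (ρ t) := by
      funext t
      simp only [← mul_assoc s s t, hs2, one_mul]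
    rw [e] at h7
    refine h7.congr_deriv ?_
    simp only [← mul_assoc, hs2, one_mul, mul_one]
    ring
  · have h6 := hrem (φ := s * φ) h1 h2
    simp only [normalizedRate]
    set w := P.normalizedEnergy G ε (s * φ) ρ₁ - P.normalizedEnergy G ε (s * φ) ρ₂ with hw
    set e := P.remainder G ε (s * φ) ρ₁ - P.remainder G ε (s * φ) ρ₂ with he
    have h7 : s * e * w ≤ |P.K G| / 2 * w ^ 2 := by
      calc s * e * w ≤ |s * e * w| := le_abs_self _
        _ = |e| * |w| := by rw [abs_mul, abs_mul, hsa, one_mul]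
        _ ≤ |P.K G| / 2 * |w| * |w| := by gcongr
        _ = _ := by rw [mul_assoc, abs_mul_abs_self, sq]
    calc _ = ε * ((s * P.K G) * w ^ 2 + s * e * w) := by rw [hw, he]; ring
      _ ≤ ε * (-|P.K G| * w ^ 2 + |P.K G| / 2 * w ^ 2) := by rw [hsK]; gcongr
      _ = _ := by ring
  · have h6 := hrem (φ := s * φ) hρ h0r
    have h7 := h.remainder_zero_le hB hεI hεr hεm (s * φ)
    have h8 := RadialEstimates.normalizedEnergy_zero_le hB hεI hεm (s * φ)
    simp only [normalizedRate]
    set w := P.normalizedEnergy G ε (s * φ) ρ with hw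
    set e := P.remainder G ε (s * φ) ρ with he
    -- The remainder is compared with its value at `ρ = 0`.
    have h9 : |e| ≤ |P.K G| / 2 * |w| + B * ε := by
      have e1 := abs_sub_abs_le_abs_sub e (P.remainder G ε (s * φ) 0)
      have e2 := abs_sub w (P.normalizedEnergy G ε (s * φ) 0)
      have e3 : |P.K G| / 2 * |w - P.normalizedEnergy G ε (s * φ) 0| ≤
          |P.K G| / 2 * (|w| + 2 * g₀ * ε) := by gcongr; linarith
      have e4 : B * ε = 2 * (L + κ₀ * g₀) * ε + |P.K G| / 2 * (2 * g₀ * ε) + 2 * g₀ * ε := by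
        rw [hBdef]; ring
      have e5 : 0 ≤ 2 * g₀ * ε := by positivity
      linarith
    have h10 : s * e * w ≤ |P.K G| / 2 * w ^ 2 + B * ε * |w| := by
      calc s * e * w ≤ |s * e * w| := le_abs_self _
        _ = |e| * |w| := by rw [abs_mul, abs_mul, hsa, one_mul]
        _ ≤ (|P.K G| / 2 * |w| + B * ε) * |w| := by gcongr
        _ = |P.K G| / 2 * (|w| * |w|) + B * ε * |w| := by ring
        _ = _ := by rw [abs_mul_abs_self, sq]
    calc _ = ε * ((s * P.K G) * w ^ 2 + s * e * w) := by ring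
      _ ≤ ε * (-|P.K G| * w ^ 2 + (|P.K G| / 2 * w ^ 2 + B * ε * |w|)) := by rw [hsK]; gcongr
      _ = _ := by ring
  · rw [mul_assoc]
    refine mul_lt_mul_of_pos_left ((mul_le_mul_of_nonneg_left hε1 hBpos.le).trans_lt h5) hε0
  · have h6 := hlow (φ := s * φ) hρ h0r
    have h7 := abs_sub (P.normalizedEnergy G ε (s * φ) ρ) (P.normalizedEnergy G ε (s * φ) 0)
    have h8 := hzδ (s * φ)
    rw [sub_zero] at h6
    have h9 : a / 4 * |ρ| ≤ a / 4 * (r / 2) := by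
      have : a / 4 * (r / 2) = 2 * δ := by rw [hδdef]; ring
      linarith
    have := le_of_mul_le_mul_left h9 (by positivity)
    linarith

end PerturbedSystem

/-! ### The family of radial cycles and its dependence on `ε`. -/

/-- Uniform continuity in the parameter on a compact set of the other variables. -/
lemma eventually_forall_abs_sub_le {g : ℝ × ℝ × ℝ → ℝ} {r ε₁ ω ε : ℝ} (hω : 0 < ω)
    (hg : ContinuousOn g (Icc (-r) r ×ˢ Icc 0 ε₁ ×ˢ univ))
    (hper : ∀ ρ ε φ, g (ρ, ε, φ + ω) = g (ρ, ε, φ)) (hε : ε ∈ Icc 0 ε₁) {ν : ℝ} (hν : 0 < ν) :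
    ∃ d > 0, ∀ ε' ∈ Icc 0 ε₁, |ε - ε'| < d → ∀ ρ φ, |ρ| ≤ r →
      |g (ρ, ε, φ) - g (ρ, ε', φ)| ≤ ν := by
  have hK : IsCompact (Icc (-r) r ×ˢ Icc 0 ε₁ ×ˢ Icc 0 ω) :=
    isCompact_Icc.prod (isCompact_Icc.prod isCompact_Icc)
  have huc := hK.uniformContinuousOn_of_continuous
    (hg.mono (prod_mono_right (prod_mono_right (subset_univ _))))
  obtain ⟨d, hd, h⟩ := Metric.uniformContinuousOn_iff.1 huc ν hν
  refine ⟨d, hd, fun ε' hε' hεε' ρ φ hρ => ?_⟩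
  have hp : Function.Periodic (fun φ => g (ρ, ε, φ) - g (ρ, ε', φ)) ω := fun φ => by
    simp only [hper]
  obtain ⟨ψ, hψ, hψφ⟩ := hp.exists_mem_Ico₀ hω φ
  rw [show g (ρ, ε, φ) - g (ρ, ε', φ) = _ from hψφ]
  have hψ' := Ico_subset_Icc_self hψ
  refine (h (ρ, ε, ψ) ⟨abs_le.1 hρ, hε, hψ'⟩ (ρ, ε', ψ) ⟨abs_le.1 hρ, hε', hψ'⟩ ?_).le
  simp only [Prod.dist_eq, dist_self, Real.dist_eq ε]
  exact max_lt hd (max_lt hεε' hd)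

namespace PerturbedSystem

variable {P : PerturbedSystem} {k l : ℤ} {b : ℝ} {G : CycleParam P.γ k l b}

variable (P G) in
lemma exists_dist_point_le : ∃ Q > 0, ∀ ρ₁ ρ₂ ε₁ ε₂ φ,
    dist (P.point G (ρ₁, ε₁, φ)) (P.point G (ρ₂, ε₂, φ)) ≤ Q * |ρ₁ - ρ₂| := by
  obtain ⟨Q₁, hQ₁, h1⟩ := exists_abs_le_of_periodic (f := fun φ => G.C φ - k) G.ω_pos
    (G.continuous_C.sub continuous_const) (fun φ => by simp only [G.periodic_C φ])
  obtain ⟨Q₂, hQ₂, h2⟩ := exists_abs_le_of_periodic (f := fun φ => G.S φ - l) G.ω_pos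
    (G.continuous_S.sub continuous_const) (fun φ => by simp only [G.periodic_S φ])
  refine ⟨max Q₁ Q₂, lt_max_of_lt_left hQ₁, fun ρ₁ ρ₂ ε₁ ε₂ φ => ?_⟩
  simp only [point, Prod.dist_eq, Real.dist_eq, add_sub_add_left_eq_sub, ← mul_sub, abs_mul]
  refine max_le ?_ ?_
  · gcongr
    exact (h1 φ).trans (le_max_left _ _)
  · gcongr
    exact (h2 φ).trans (le_max_right _ _)

namespace RadialEstimates

variable {η L r ε : ℝ}

section

variable (h : P.RadialEstimates G η L r) (hε : ε ∈ Icc 0 P.ε₀) (hεr : ε ≤ r)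
include h

lemma one_add_ne_zero {ρ : ℝ} (hρ : |ρ| ≤ r) : 1 + ρ ≠ 0 := by
  have := (abs_le.1 hρ).1
  have := h.r_le
  linarith

include hε hεr

lemma angularVelocity_ne_zero {ρ φ : ℝ} (hρ : |ρ| ≤ r) : P.angularVelocity G (ρ, ε, φ) ≠ 0 := by
  have := (h.angularVelocity_mem (φ := φ) hρ hε hεr).1
  linarith

lemma contDiffWithinAt_energyRate (hb : InitialRange P.γ P.σ k l b) {ρ φ : ℝ}
    (hρ : |ρ| ≤ r) : ContDiffWithinAt ℝ 1 (P.energyRate G) (slab P.ε₀) (ρ, ε, φ) :=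
  P.contDiffWithinAt_energyRate G (h.point_mem hρ) (mem_slab hε) (P.star_shaped G hb φ).1
    (h.one_add_ne_zero hρ) (h.angularVelocity_ne_zero hε hεr hρ)

omit hεr in
lemma contDiffWithinAt_angularVelocity (hb : InitialRange P.γ P.σ k l b) {ρ φ : ℝ}
    (hρ : |ρ| ≤ r) : ContDiffWithinAt ℝ 1 (P.angularVelocity G) (slab P.ε₀) (ρ, ε, φ) :=
  P.contDiffWithinAt_angularVelocity G (h.point_mem hρ) (mem_slab hε) (P.star_shaped G hb φ).1
    (h.one_add_ne_zero hρ)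

end

end RadialEstimates

variable (P G) in
lemma continuous_normalizedEnergy (hb : InitialRange P.γ P.σ k l b) :
    Continuous fun p : ℝ × ℝ × ℝ => P.normalizedEnergy G p.2.1 p.2.2 p.1 := by
  have h1 := P.continuous_logShift G hb
  have h2 := P.continuous_energyShift G hb
  have h3 := (P.contDiff_energyDiff G).continuous
  unfold normalizedEnergy
  fun_prop

lemma RadialEstimates.continuousOn_normalizedRate {η L r ε₁ : ℝ} (h : P.RadialEstimates G η L r)
    (hb : InitialRange P.γ P.σ k l b) (h1 : ε₁ ≤ P.ε₀) (h2 : ε₁ ≤ r) :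
    ContinuousOn (fun p : ℝ × ℝ × ℝ => P.normalizedRate G p.2.1 p.2.2 p.1)
      (Icc (-r) r ×ˢ Icc 0 ε₁ ×ˢ univ) := by
  have hN : ContinuousOn (P.energyRate G) (Icc (-r) r ×ˢ Icc 0 ε₁ ×ˢ univ) := by
    rintro ⟨ρ, ε, φ⟩ ⟨hρ, hε, -⟩
    have hε' : ε ∈ Icc 0 P.ε₀ := ⟨hε.1, hε.2.trans h1⟩
    exact (h.contDiffWithinAt_energyRate hε' (hε.2.trans h2) hb
      (abs_le.2 hρ)).continuousWithinAt.mono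
      (prod_mono (subset_univ _) (prod_mono (Icc_subset_Icc_right h1) subset_rfl))
  have h3 := P.continuous_logShift G hb
  have h4 := P.continuous_energyShift G hb
  have h5 := (P.contDiff_energyDiff G).continuous
  have h6 := P.continuous_R G hb
  have h7 := P.continuous_κ G hb
  have h8 := P.continuous_normalizedEnergy G hb
  have e1 : Continuous fun p : ℝ × ℝ × ℝ => Real.exp (-p.2.1 * P.logShift G p.2.2) := by fun_prop
  have e2 : Continuous fun p : ℝ × ℝ × ℝ => P.R G p.2.2 := by fun_prop
  have e3 : Continuous fun p : ℝ × ℝ × ℝ => P.κ G p.2.2 *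
      (P.energyDiff G p - p.2.1 * P.energyShift G p.2.2) := by fun_prop
  exact (Continuous.continuousOn (by fun_prop)).mul ((continuousOn_const.mul h8.continuousOn).add
    (e1.continuousOn.mul ((hN.sub e2.continuousOn).sub e3.continuousOn)))

variable (P G) in
lemma normalizedRate_add (hb : P.IsAdmissible G) (ρ ε φ : ℝ) :
    P.normalizedRate G ε (φ + G.ω) ρ = P.normalizedRate G ε φ ρ := by
  simp only [normalizedRate, remainder, P.normalizedEnergy_add G ρ ε φ hb, energyDiff_add,
    energyRate_add, P.periodic_logShift G hb φ, P.periodic_energyShift G hb φ, P.periodic_R G φ,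
    P.periodic_κ G φ]

variable (P G) in
/-- A periodic solution of the equation in polar coordinates. -/
structure IsRadialCycle (r δ ε : ℝ) (Υ : ℝ → ℝ) : Prop where
  periodic : Function.Periodic Υ G.ω
  abs_lt : ∀ φ, |Υ φ| < r
  energy_lt : ∀ φ, |P.normalizedEnergy G ε φ (Υ φ)| < δ
  hasDerivAt : ∀ φ, HasDerivAt Υ (P.slope G (Υ φ, ε, φ)) φ

namespace IsTrapping

variable {s η L r δ c C B ε₁ : ℝ}

lemma sign' (T : P.IsTrapping G s η L r δ c C B ε₁) : s = 1 ∨ s = -1 :=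
  T.sign.imp And.left And.left

lemma mul_self (T : P.IsTrapping G s η L r δ c C B ε₁) : s * s = 1 := by
  rcases T.sign' with rfl | rfl <;> norm_num

lemma mul_mul_self (T : P.IsTrapping G s η L r δ c C B ε₁) (φ : ℝ) : s * (s * φ) = φ := by
  rw [← mul_assoc, T.mul_self, one_mul]

lemma abs_sign (T : P.IsTrapping G s η L r δ c C B ε₁) : |s| = 1 := by
  rcases T.sign' with rfl | rfl <;> norm_num

lemma mem_Icc (T : P.IsTrapping G s η L r δ c C B ε₁) {ε : ℝ} (h0 : 0 ≤ ε) (h1 : ε ≤ ε₁) :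
    ε ∈ Icc 0 P.ε₀ := ⟨h0, h1.trans T.ε₁_le⟩

/-- Reversal of the angle in a solution. -/
lemma hasDerivAt_comp_sign {ε φ : ℝ} {ρ : ℝ → ℝ}
    (hρ : HasDerivAt ρ (P.slope G (ρ (s * φ), ε, s * φ)) (s * φ)) :
    HasDerivAt (fun φ => ρ (s * φ)) (s * P.slope G (ρ (s * φ), ε, s * φ)) φ := by
  have := hρ.comp φ ((hasDerivAt_id φ).const_mul s)
  exact this.congr_deriv (by rw [mul_one, mul_comm])

/-- Since `lam = ε |K| / 2` and `μ = B ε²`, the bound `lam |w| ≤ μ` makes `w`, and with it `Υ`, of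
order `ε`. -/
lemma exists_isRadialCycle (T : P.IsTrapping G s η L r δ c C B ε₁) (hK : P.K G ≠ 0) :
    ∃ D > 0, ∀ ε, 0 < ε → ε ≤ ε₁ → ∃ Υ, P.IsRadialCycle G r δ ε Υ ∧ ∀ φ, |Υ φ| ≤ D * ε := by
  have hK' : 0 < |P.K G| := abs_pos.2 hK
  have hB := T.B_pos
  have hc := T.c_pos
  refine ⟨(2 * B / |P.K G| + B) / c, by positivity, fun ε h0 h1 => ?_⟩
  have hT := T.trapping h0 h1
  obtain ⟨Υ, h2, h3, -, h5, h6⟩ := hT.exists_periodic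
  have hss := T.mul_mul_self
  have key : P.IsRadialCycle G r δ ε fun φ => Υ (s * φ) := by
    refine ⟨fun φ => add_period_of_sign T.sign' h2 φ, fun φ => h3 _, fun φ => ?_, fun φ => ?_⟩
    · have := (h6 (s * φ)).trans_lt hT.μ_lt
      rw [hss] at this
      exact lt_of_mul_lt_mul_left this hT.lam_pos.le
    · have h7 := (h5 (s * φ)).comp φ ((hasDerivAt_id φ).const_mul s)
      refine h7.congr_deriv ?_
      rw [hss, mul_one, mul_right_comm, T.mul_self, one_mul]
  refine ⟨_, key, fun φ => ?_⟩
  have h7 := h6 (s * φ)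
  have h8 := hT.lower_W (s * φ) (Υ (s * φ)) 0 (h3 _).le (by simpa using hT.r_pos.le)
  rw [hss] at h7 h8
  have h9 := T.zero_le (φ := φ) h0.le h1
  have h10 : |P.normalizedEnergy G ε φ (Υ (s * φ))| ≤ 2 * B / |P.K G| * ε := by
    rw [div_mul_eq_mul_div, le_div_iff₀ hK']
    refine le_of_mul_le_mul_left ?_ (half_pos h0)
    calc _ = ε * (|P.K G| / 2) * |P.normalizedEnergy G ε φ (Υ (s * φ))| := by ring
      _ ≤ ε * (B * ε) := h7
      _ = _ := by ring
  have h11 := abs_sub (P.normalizedEnergy G ε φ (Υ (s * φ))) (P.normalizedEnergy G ε φ 0)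
  rw [sub_zero] at h8
  rw [div_mul_eq_mul_div, le_div_iff₀ hc]
  linarith

section Family

variable {Υ : ℝ → ℝ → ℝ}

/-- The periodic solutions depend continuously on the parameter. -/
lemma exists_abs_sub_le (T : P.IsTrapping G s η L r δ c C B ε₁) (hb : P.IsAdmissible G)
    (hΥ : ∀ ε, 0 < ε → ε ≤ ε₁ → P.IsRadialCycle G r δ ε (Υ ε)) {ε : ℝ} (h0 : 0 < ε)
    (h1 : ε ≤ ε₁) {ν : ℝ} (hν : 0 < ν) :
    ∃ d > 0, ∀ ε', 0 < ε' → ε' ≤ ε₁ → |ε - ε'| < d → ∀ φ, |Υ ε φ - Υ ε' φ| ≤ ν := by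
  have hT := T.trapping h0 h1
  have hlam := hT.lam_pos
  have hc := T.c_pos
  set lam := ε * (|P.K G| / 2)
  obtain ⟨d₁, hd₁, e₁⟩ := eventually_forall_abs_sub_le (r := r) (ε₁ := ε₁) (ε := ε) G.ω_pos
    (P.continuous_normalizedEnergy G hb.1).continuousOn
    (fun ρ ε φ => P.normalizedEnergy_add G ρ ε φ hb) ⟨h0.le, h1⟩
    (ν := c * ν / 4) (by positivity)
  obtain ⟨d₂, hd₂, e₂⟩ := eventually_forall_abs_sub_le (ε := ε) G.ω_pos
    (T.estimates.continuousOn_normalizedRate hb.1 T.ε₁_le T.ε₁_le_r)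
    (fun ρ ε φ => P.normalizedRate_add G hb ρ ε φ) ⟨h0.le, h1⟩
    (ν := c * ν / 2 * lam) (by positivity)
  refine ⟨min d₁ d₂, lt_min hd₁ hd₂, fun ε' h0' h1' hd φ => ?_⟩
  have hY := hΥ ε h0 h1
  have hY' := hΥ ε' h0' h1'
  have hεI := T.mem_Icc h0'.le h1'
  have hεr := h1'.trans T.ε₁_le_r
  -- The trapping field at `ε` is kept fixed and the cycle at `ε'` is inserted as a perturbed
  -- solution; `u` and `v` are chosen so that `v / lam + 2 u = c ν`.
  have key := hT.abs_sub_periodic_le (Υ := fun φ => Υ ε (s * φ)) (Υ' := fun φ => Υ ε' (s * φ))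
    (W' := fun φ ρ => P.normalizedEnergy G ε' (s * φ) ρ)
    (V' := fun φ ρ => s * P.normalizedRate G ε' (s * φ) ρ)
    (u := c * ν / 4) (v := c * ν / 2 * lam)
    (fun φ => (hY.abs_lt _).le)
    (fun φ => hasDerivAt_comp_sign (hY.hasDerivAt _))
    (add_period_of_sign T.sign' hY.periodic)
    (fun φ => (hY'.abs_lt _).le)
    (add_period_of_sign T.sign' hY'.periodic)
    (fun φ ρ => add_period_of_sign T.sign' (f := fun φ => P.normalizedEnergy G ε' φ ρ)
      (fun φ => P.normalizedEnergy_add G ρ ε' φ hb) φ)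
    (fun φ => ?_) (fun φ => ?_) (fun φ => ?_) (s * φ)
  · rw [T.mul_mul_self, mul_div_assoc] at key
    have h2 : c * ν / 2 * lam / lam + 2 * (c * ν / 4) = c * ν := by field_simp; ring
    rw [← mul_div_assoc, h2] at key
    exact le_of_mul_le_mul_left key hc
  · have h3 := P.hasDerivAt_normalizedEnergy_along G hb.1 (ρ := Υ ε') (ε := ε') (φ := s * φ)
      (T.estimates.one_add_ne_zero (hY'.abs_lt _).le)
      (T.estimates.angularVelocity_ne_zero hεI hεr (hY'.abs_lt _).le) (hY'.hasDerivAt _)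
    have h4 := h3.comp φ ((hasDerivAt_id φ).const_mul s)
    exact h4.congr_deriv (by rw [mul_one, mul_comm])
  · exact e₁ ε' ⟨h0'.le, h1'⟩ (hd.trans_le (min_le_left _ _)) _ _ (hY'.abs_lt _).le
  · rw [← mul_sub, abs_mul, T.abs_sign, one_mul]
    exact e₂ ε' ⟨h0'.le, h1'⟩ (hd.trans_le (min_le_right _ _)) _ _ (hY'.abs_lt _).le

lemma continuousOn_family (T : P.IsTrapping G s η L r δ c C B ε₁) (hb : P.IsAdmissible G)
    (hΥ : ∀ ε, 0 < ε → ε ≤ ε₁ → P.IsRadialCycle G r δ ε (Υ ε)) :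
    ContinuousOn (fun x : ℝ × ℝ => Υ x.1 x.2) (Ioc 0 ε₁ ×ˢ univ) := by
  rintro ⟨ε, φ⟩ ⟨⟨h0, h1⟩, -⟩
  rw [ContinuousWithinAt, Metric.tendsto_nhds]
  intro ν hν
  obtain ⟨d, hd, h⟩ := T.exists_abs_sub_le hb hΥ h0 h1 (half_pos (half_pos hν))
  have hc : Continuous (Υ ε) := continuous_iff_continuousAt.2 fun φ =>
    ((hΥ ε h0 h1).hasDerivAt φ).continuousAt
  have e1 : ∀ᶠ x in 𝓝[Ioc 0 ε₁ ×ˢ univ] ((ε, φ) : ℝ × ℝ), dist (Υ ε x.2) (Υ ε φ) < ν / 2 :=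
    nhdsWithin_le_nhds ((hc.comp continuous_snd).continuousAt.eventually
      (Metric.ball_mem_nhds _ (half_pos hν)))
  have e2 : ∀ᶠ x in 𝓝[Ioc 0 ε₁ ×ˢ univ] ((ε, φ) : ℝ × ℝ), dist x.1 ε < d :=
    nhdsWithin_le_nhds (continuous_fst.continuousAt.eventually (Metric.ball_mem_nhds _ hd))
  filter_upwards [e1, e2, self_mem_nhdsWithin] with x h1 h2 h3
  rw [dist_comm, Real.dist_eq] at h2
  have h4 := h x.1 h3.1.1 h3.1.2 h2 x.2
  have h5 := dist_triangle (Υ x.1 x.2) (Υ ε x.2) (Υ ε φ)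
  rw [← Real.dist_eq, dist_comm] at h4
  linarith

end Family

lemma contDiff (T : P.IsTrapping G s η L r δ c C B ε₁) (hb : P.IsAdmissible G) {ε : ℝ}
    {Υ : ℝ → ℝ} (h0 : 0 < ε) (h1 : ε ≤ ε₁) (hΥ : P.IsRadialCycle G r δ ε Υ) :
    ContDiff ℝ 1 Υ := by
  rw [contDiff_one_iff_deriv]
  refine ⟨fun φ => (hΥ.hasDerivAt φ).differentiableAt, ?_⟩
  rw [funext fun φ => (hΥ.hasDerivAt φ).deriv]
  have hc : Continuous Υ := continuous_iff_continuousAt.2 fun φ =>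
    (hΥ.hasDerivAt φ).continuousAt
  have hεI := T.mem_Icc h0.le h1
  refine continuous_iff_continuousAt.2 fun φ => ?_
  have h2 : Tendsto (fun φ : ℝ => ((Υ φ, ε, φ) : ℝ × ℝ × ℝ)) (𝓝 φ)
      (𝓝[slab P.ε₀] (Υ φ, ε, φ)) :=
    tendsto_nhdsWithin_iff.2 ⟨Continuous.tendsto' (by fun_prop) _ _ rfl,
      Eventually.of_forall fun φ => mem_slab hεI⟩
  exact (T.estimates.contDiffWithinAt_slope hb.1 hεI (h1.trans T.ε₁_le_r)
    (hΥ.abs_lt φ).le).continuousWithinAt.tendsto.comp h2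

end IsTrapping

end PerturbedSystem

/-! ### From the radial equation back to orbits in the plane. -/

namespace PerturbedSystem

variable {P : PerturbedSystem} {k l : ℤ} {b : ℝ} {G : CycleParam P.γ k l b}

lemma contDiffAt_field {ε : ℝ} (hε : ε ∈ Icc 0 P.ε₀) {z : ℝ × ℝ} (hz : z ∈ P.domain) :
    ContDiffAt ℝ 1 (P.field ε) z := by
  have hin : ContDiff ℝ 1 fun z : ℝ × ℝ => (z.1, z.2, ε) := by fun_prop
  have hmaps : MapsTo (fun z : ℝ × ℝ => (z.1, z.2, ε)) P.domain
      (Icc (-P.σ) P.σ ×ˢ Icc (-P.σ) P.σ ×ˢ Icc 0 P.ε₀) := fun z hz =>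
    ⟨Ioo_subset_Icc_self hz.1, Ioo_subset_Icc_self hz.2, hε⟩
  have hX₁ := (P.contDiff_X₁.comp hin.contDiffOn hmaps).contDiffAt (P.isOpen_domain.mem_nhds hz)
  have hY₁ := (P.contDiff_Y₁.comp hin.contDiffOn hmaps).contDiffAt (P.isOpen_domain.mem_nhds hz)
  have hX₀ : ContDiffAt ℝ 1 (fun z : ℝ × ℝ => P.X₀ z.1 z.2) z :=
    (P.contDiffAt_X₀ hz).of_le one_le_two
  have hY₀ : ContDiffAt ℝ 1 (fun z : ℝ × ℝ => P.Y₀ z.1 z.2) z :=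
    (P.contDiffAt_Y₀ hz).of_le one_le_two
  have h1 : ContDiffAt ℝ 1 (fun z : ℝ × ℝ => P.γ * (z.2 ^ 3 - z.2)) z := by fun_prop
  have h2 : ContDiffAt ℝ 1 (fun z : ℝ × ℝ => -(z.1 ^ 3 - z.1)) z := by fun_prop
  exact (h1.add (contDiffAt_const.mul (hX₀.add (hX₁.mul contDiffAt_const)))).prodMk
    (h2.add (contDiffAt_const.mul (hY₀.add (hY₁.mul contDiffAt_const))))

variable (P) in
/-- `t ↦ z (s t)` is a solution of the perturbed system for `t ≥ 0`. -/
def IsDirectedSolution (ε s : ℝ) (z : ℝ → ℝ × ℝ) : Prop :=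
  ∀ t, 0 ≤ t → z t ∈ P.domain ∧ HasDerivWithinAt z (s • P.field ε (z t)) (Ici 0) t

/-- The two orbit arcs up to time `t` form a compact subset of the domain, on which the locally
Lipschitz field is Lipschitz. This identifies an arbitrary solution with the one constructed in
polar coordinates. -/
lemma IsDirectedSolution.eq {ε s : ℝ} (hε : ε ∈ Icc 0 P.ε₀) {z w : ℝ → ℝ × ℝ}
    (hz : P.IsDirectedSolution ε s z) (hw : P.IsDirectedSolution ε s w) (h0 : z 0 = w 0) {t : ℝ}
    (ht : 0 ≤ t) : z t = w t := by
  have hzc : ContinuousOn z (Icc 0 t) := fun u hu =>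
    (hz u hu.1).2.continuousWithinAt.mono Icc_subset_Ici_self
  have hwc : ContinuousOn w (Icc 0 t) := fun u hu =>
    (hw u hu.1).2.continuousWithinAt.mono Icc_subset_Ici_self
  set S := z '' Icc 0 t ∪ w '' Icc 0 t with hS
  have hSc : IsCompact S := (isCompact_Icc.image_of_continuousOn hzc).union
    (isCompact_Icc.image_of_continuousOn hwc)
  have hSd : S ⊆ P.domain := by
    rintro _ (⟨u, hu, rfl⟩ | ⟨u, hu, rfl⟩)
    exacts [(hz u hu.1).1, (hw u hu.1).1]
  have hloc : LocallyLipschitzOn S fun z => s • P.field ε z := fun x hx => by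
    have hd : ContDiffAt ℝ 1 (fun z => s • P.field ε z) x :=
      (contDiffAt_field hε (hSd hx)).const_smul s
    obtain ⟨K, u, hu, hK⟩ := hd.exists_lipschitzOnWith
    exact ⟨K, u, mem_nhdsWithin_of_mem_nhds hu, hK⟩
  obtain ⟨K, hK⟩ := hloc.exists_lipschitzOnWith_of_compact hSc
  exact ODE_solution_unique_of_mem_Icc_right (v := fun _ z => s • P.field ε z) (s := fun _ => S)
    (fun _ _ => hK) hzc (fun u hu => (hz u hu.1).2.mono (Ici_subset_Ici.2 hu.1))
    (fun u hu => Or.inl (mem_image_of_mem _ (Ico_subset_Icc_self hu))) hwc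
    (fun u hu => (hw u hu.1).2.mono (Ici_subset_Ici.2 hu.1))
    (fun u hu => Or.inr (mem_image_of_mem _ (Ico_subset_Icc_self hu))) h0 ⟨ht, le_rfl⟩

lemma isDirectedSolution_one {ε : ℝ} {z : ℝ → ℝ × ℝ} :
    P.IsDirectedSolution ε 1 z ↔ P.IsSolutionOn ε (Ici 0) z := by
  simp only [IsDirectedSolution, IsSolutionOn, one_smul, mem_Ici]

lemma IsDirectedSolution.comp_neg {ε : ℝ} {z : ℝ → ℝ × ℝ} (hz : P.IsDirectedSolution ε (-1) z) :
    P.IsSolutionOn ε (Iic 0) fun t => z (-t) := fun t ht => by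
  obtain ⟨h1, h2⟩ := hz (-t) (neg_nonneg.2 ht)
  refine ⟨h1, ?_⟩
  have h3 := h2.scomp t ((hasDerivAt_id t).neg.hasDerivWithinAt (s := Iic 0))
    fun u hu => neg_nonneg.2 hu
  exact h3.congr_deriv (by simp)

lemma IsSolutionOn.comp_neg {ε : ℝ} {z : ℝ → ℝ × ℝ} (hz : P.IsSolutionOn ε (Iic 0) z) :
    P.IsDirectedSolution ε (-1) fun t => z (-t) := fun t ht => by
  obtain ⟨h1, h2⟩ := hz (-t) (neg_nonpos.2 ht)
  refine ⟨h1, ?_⟩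
  have h3 := h2.scomp t ((hasDerivAt_id t).neg.hasDerivWithinAt (s := Ici 0))
    fun u hu => neg_nonpos.2 hu
  exact h3

variable (P) in
/-- Asymptotic stability in the direction of time given by the sign of `s`. -/
def IsDirectedStable (ε s : ℝ) (Γ : Set (ℝ × ℝ)) (δ : ℝ) : Prop :=
  (∀ z₀, Metric.infDist z₀ Γ < δ → ∃ z, z 0 = z₀ ∧ P.IsDirectedSolution ε s z) ∧
  (∀ z, P.IsDirectedSolution ε s z → Metric.infDist (z 0) Γ < δ →
    Tendsto (fun t => Metric.infDist (z t) Γ) atTop (𝓝 0)) ∧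
  (∀ η > 0, ∃ δ' > 0, ∀ z, P.IsDirectedSolution ε s z → Metric.infDist (z 0) Γ < δ' →
    ∀ t ≥ 0, Metric.infDist (z t) Γ < η)

lemma IsDirectedStable.forward {ε δ : ℝ} {Γ : Set (ℝ × ℝ)} (h : P.IsDirectedStable ε 1 Γ δ) :
    P.IsAsymptoticallyStableForward ε Γ δ := by
  simpa only [IsDirectedStable, IsAsymptoticallyStableForward, isDirectedSolution_one] using h

lemma IsDirectedStable.backward {ε δ : ℝ} {Γ : Set (ℝ × ℝ)} (h : P.IsDirectedStable ε (-1) Γ δ) :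
    P.IsAsymptoticallyStableBackward ε Γ δ := by
  obtain ⟨h1, h2, h3⟩ := h
  refine ⟨fun z₀ hz₀ => ?_, fun z hz hz0 => ?_, fun η hη => ?_⟩
  · obtain ⟨z, hz, hs⟩ := h1 z₀ hz₀
    exact ⟨fun t => z (-t), by simpa using hz, hs.comp_neg⟩
  · have := (h2 _ hz.comp_neg (by simpa using hz0)).comp tendsto_neg_atBot_atTop
    simpa [Function.comp_def] using this
  · obtain ⟨δ', hδ', h⟩ := h3 η hη
    refine ⟨δ', hδ', fun z hz hz0 t ht => ?_⟩
    simpa using h _ hz.comp_neg (by simpa using hz0) (-t) (neg_nonneg.2 ht)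

/-- A solution of the equation in polar coordinates, with the time restored, is a solution of the
system. -/
lemma RadialEstimates.hasDerivAt_orbit {η L r ε : ℝ} (h : P.RadialEstimates G η L r)
    (hb : InitialRange P.γ P.σ k l b) (hε : ε ∈ Icc 0 P.ε₀) (hεr : ε ≤ r) {ρ θ : ℝ → ℝ} {t s : ℝ}
    (hr : |ρ (θ t)| ≤ r) (hρ : HasDerivAt ρ (P.slope G (ρ (θ t), ε, θ t)) (θ t))
    (hθ : HasDerivAt θ (s * P.angularVelocity G (ρ (θ t), ε, θ t)) t) :
    HasDerivAt (fun t => P.point G (ρ (θ t), ε, θ t))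
      (s • P.field ε (P.point G (ρ (θ t), ε, θ t))) t := by
  have hΩ := h.angularVelocity_ne_zero hε hεr (φ := θ t) hr
  have h1 := (P.hasDerivAt_point_along G (P.star_shaped G hb (θ t)).1 (h.one_add_ne_zero hr)
    hΩ hρ).scomp t hθ
  refine h1.congr_deriv ?_
  rw [smul_smul, mul_assoc, mul_inv_cancel₀ hΩ, mul_one]
  rfl

variable {s η L r δ c C B ε₁ ε : ℝ} {Υ : ℝ → ℝ}

lemma IsRadialCycle.periodic_curve (hΥ : P.IsRadialCycle G r δ ε Υ) :
    Function.Periodic (G.curve Υ) G.ω := fun φ => by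
  simp only [CycleParam.curve, G.periodic_C φ, G.periodic_S φ, hΥ.periodic φ]

lemma IsRadialCycle.continuous (hΥ : P.IsRadialCycle G r δ ε Υ) : Continuous Υ :=
  continuous_iff_continuousAt.2 fun φ => (hΥ.hasDerivAt φ).continuousAt

lemma RadialEstimates.continuous_angularVelocity (h : P.RadialEstimates G η L r)
    (hb : InitialRange P.γ P.σ k l b) (hε : ε ∈ Icc 0 P.ε₀) {ρ θ : ℝ → ℝ}
    (hρ : Continuous ρ) (hr : ∀ φ, |ρ φ| ≤ r) (hθ : Continuous θ) :
    Continuous fun φ => P.angularVelocity G (ρ φ, ε, θ φ) := by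
  refine continuous_iff_continuousAt.2 fun φ => ?_
  have h1 : Tendsto (fun φ : ℝ => ((ρ φ, ε, θ φ) : ℝ × ℝ × ℝ)) (𝓝 φ)
      (𝓝[slab P.ε₀] (ρ φ, ε, θ φ)) :=
    tendsto_nhdsWithin_iff.2 ⟨Continuous.tendsto' (by fun_prop) _ _ rfl,
      Eventually.of_forall fun φ => mem_slab hε⟩
  exact (h.contDiffWithinAt_angularVelocity hε hb (hr φ)).continuousWithinAt.tendsto.comp h1

lemma IsRadialCycle.isCycle (hΥ : P.IsRadialCycle G r δ ε Υ) (h : P.RadialEstimates G η L r)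
    (hb : InitialRange P.γ P.σ k l b) (hε : ε ∈ Icc 0 P.ε₀) (hεr : ε ≤ r) :
    P.IsCycle ε (range (G.curve Υ)) := by
  have hr : ∀ φ, |Υ φ| ≤ r := fun φ => (hΥ.abs_lt φ).le
  obtain ⟨θ, -, hθ, -, hsurj, -, -, hper⟩ := exists_time_change
    (h.continuous_angularVelocity hb hε hΥ.continuous hr continuous_id) one_half_pos
    (fun φ => (h.angularVelocity_mem (hr φ) hε hεr).1)
    (fun φ => (h.angularVelocity_mem (hr φ) hε hεr).2) 0
  obtain ⟨T, hT, hTθ⟩ := hper G.ω G.ω_pos fun φ => by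
    simp only [id, hΥ.periodic φ, angularVelocity_add]
  have hd : ∀ t, HasDerivAt (fun t => P.point G (Υ (θ t), ε, θ t))
      (P.field ε (P.point G (Υ (θ t), ε, θ t))) t := fun t => by
    have := h.hasDerivAt_orbit hb hε hεr (s := 1) (hr (θ t)) (hΥ.hasDerivAt (θ t))
      (by rw [one_mul]; exact hθ t)
    rwa [one_smul] at this
  refine ⟨fun t => P.point G (Υ (θ t), ε, θ t), T, fun t _ => ⟨h.point_mem (hr _),
    (hd t).hasDerivWithinAt⟩, hT, fun t => ?_, ?_, ?_⟩
  · simp only [hTθ, hΥ.periodic (θ t), point_add]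
  -- A constant solution would make the field vanish, and with it the angular velocity, which is at
  -- least `1/2`.
  · by_contra! hcon
    have h1 := (hd 0).unique (by rw [funext hcon]; exact hasDerivAt_const 0 _)
    refine h.angularVelocity_ne_zero hε hεr (φ := θ 0) (hr (θ 0)) ?_
    simp only [angularVelocity, rhs, h1]
    simp
  · exact hsurj.range_comp (G.curve Υ)

/-- The solutions that start near the cycle are attracted by it. -/
lemma IsTrapping.exists_directedSolution (T : P.IsTrapping G s η L r δ c C B ε₁)
    (hb : P.IsAdmissible G) (h0 : 0 < ε) (h1 : ε ≤ ε₁) (hΥ : P.IsRadialCycle G r δ ε Υ) :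
    ∃ M, ∀ ρ₀ φ₀, |ρ₀| ≤ r → |P.normalizedEnergy G ε φ₀ ρ₀| ≤ δ →
      ∃ z, z 0 = P.point G (ρ₀, ε, φ₀) ∧ P.IsDirectedSolution ε s z ∧
        (∀ t, 0 ≤ t → Metric.infDist (z t) (range (G.curve Υ)) ≤ M * |ρ₀ - Υ φ₀|) ∧
        Tendsto (fun t => Metric.infDist (z t) (range (G.curve Υ))) atTop (𝓝 0) := by
  obtain ⟨Q, hQ, hdist⟩ := P.exists_dist_point_le G
  have h := T.estimates
  have hT := T.trapping h0 h1
  have hε := T.mem_Icc h0.le h1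
  have hεr := h1.trans T.ε₁_le_r
  have hlam := hT.lam_pos
  have hc := T.c_pos
  have hr0 := hT.r_pos
  have hss := T.mul_mul_self
  set lam := ε * (|P.K G| / 2)
  have hC : 0 ≤ C := by
    have e1 := hT.lower_W 0 r 0 (abs_of_pos hr0).le (by simpa using hr0.le)
    have e2 := hT.upper_W 0 r 0 (abs_of_pos hr0).le (by simpa using hr0.le)
    rw [sub_zero, abs_of_pos hr0] at e1 e2
    exact hc.le.trans (le_of_mul_le_mul_right (e1.trans e2) hr0)
  refine ⟨Q * (C / c), fun ρ₀ φ₀ hρ₀ hW₀ => ?_⟩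
  obtain ⟨ρ, hρc, hρ0, hρ⟩ := hT.exists_attracted (Υ := fun φ => Υ (s * φ)) (φ₀ := s * φ₀)
    (fun φ => (hΥ.abs_lt _).le) (fun φ => hasDerivAt_comp_sign (hΥ.hasDerivAt _)) hρ₀
    (by rwa [hss])
  have hρr : ∀ φ, |clamp r (ρ φ)| ≤ r := fun φ => abs_clamp_le hr0.le _
  -- The time change needs an angular velocity bounded for all angles, whereas `ρ` stays in the
  -- strip only from the initial angle on; after that angle the clamp has no effect.
  have hcl : Continuous fun φ => clamp r (ρ φ) := by unfold clamp; fun_prop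
  obtain ⟨θ, hθ0, hθ, hmono, -, htop, -, -⟩ := exists_time_change
    (h.continuous_angularVelocity hb.1 hε hcl hρr
      (continuous_const.mul continuous_id : Continuous fun φ : ℝ => s * φ))
    one_half_pos (fun φ => (h.angularVelocity_mem (hρr φ) hε hεr).1)
    (fun φ => (h.angularVelocity_mem (hρr φ) hε hεr).2) (s * φ₀)
  have hθge : ∀ t, 0 ≤ t → s * φ₀ ≤ θ t := fun t ht => by
    rw [← hθ0]; exact hmono.monotone ht
  have hle : ∀ t, 0 ≤ t → Metric.infDist (P.point G (ρ (θ t), ε, s * θ t)) (range (G.curve Υ)) ≤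
      Q * (C / c * Real.exp (-lam * (θ t - s * φ₀)) * |ρ₀ - Υ φ₀|) := fun t ht => by
    have e1 := (hρ _ (hθge t ht)).2.2
    rw [hss] at e1
    refine (Metric.infDist_le_dist_of_mem (mem_range_self (s * θ t))).trans
      ((hdist _ _ ε ε _).trans ?_)
    gcongr
  refine ⟨fun t => P.point G (ρ (θ t), ε, s * θ t), by simp only [hθ0, hρ0, hss],
    fun t ht => ?_, fun t ht => (hle t ht).trans ?_, ?_⟩
  · obtain ⟨h2, h3, -⟩ := hρ _ (hθge t ht)
    refine ⟨h.point_mem h2, ?_⟩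
    have h4 := h.hasDerivAt_orbit hb.1 hε hεr (ρ := fun φ => ρ (s * φ)) (θ := fun t => s * θ t)
      (s := s) (t := t) (by rwa [hss]) ?_ ?_
    · simp only [hss] at h4
      exact h4.hasDerivWithinAt
    · simp only [hss]
      have h5 : HasDerivAt ρ (s * P.slope G (ρ (θ t), ε, s * θ t)) (s * (s * θ t)) := by
        rw [hss]; exact h3
      refine (h5.comp (s * θ t) ((hasDerivAt_id (s * θ t)).const_mul s)).congr_deriv ?_
      rw [mul_one, mul_right_comm, T.mul_self, one_mul]
    · simp only [hss]
      have := (hθ t).const_mul s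
      rwa [clamp_eq_self h2] at this
  · have e1 : Real.exp (-lam * (θ t - s * φ₀)) ≤ 1 := by
      rw [Real.exp_le_one_iff]
      have := hθge t ht
      have := mul_nonneg hlam.le (sub_nonneg.2 this)
      linarith
    calc _ ≤ Q * (C / c * 1 * |ρ₀ - Υ φ₀|) := by gcongr
      _ = _ := by ring
  · have e1 : Tendsto (fun t => Q * (C / c * Real.exp (-lam * (θ t - s * φ₀)) * |ρ₀ - Υ φ₀|))
        atTop (𝓝 0) := by
      have e2 : Tendsto (fun t => -lam * (θ t - s * φ₀)) atTop atBot :=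
        (tendsto_atTop_add_const_right atTop (-(s * φ₀)) htop).const_mul_atTop_of_neg
          (neg_neg_of_pos hlam)
      have := (((Real.tendsto_exp_atBot.comp e2).const_mul (C / c)).mul_const
        |ρ₀ - Υ φ₀|).const_mul Q
      simpa [Function.comp_def] using this
    refine squeeze_zero' (Eventually.of_forall fun t => Metric.infDist_nonneg) ?_ e1
    filter_upwards [eventually_ge_atTop 0] with t ht using hle t ht

end PerturbedSystem

/-! ### Neighbourhoods of the cycle and asymptotic stability. -/

namespace PerturbedSystem

section PolarCoordinates

variable (P : PerturbedSystem) {k l : ℤ} {b : ℝ} (G : CycleParam P.γ k l b)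

/-- The polar coordinates are regular, hence an open map. -/
lemma map_nhds_point {ρ φ : ℝ} (ε : ℝ) (hα : G.α φ ≠ 0) (hρ : 1 + ρ ≠ 0) :
    map (fun p : ℝ × ℝ => P.point G (p.1, ε, p.2)) (𝓝 (ρ, φ)) = 𝓝 (P.point G (ρ, ε, φ)) := by
  set f : ℝ × ℝ → ℝ × ℝ := fun p => P.point G (p.1, ε, p.2) with hf
  have hfc : ContDiff ℝ 1 f := (P.contDiff_point G).comp (by fun_prop)
  have hs : HasStrictFDerivAt f (fderiv ℝ f (ρ, φ)) (ρ, φ) :=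
    hfc.contDiffAt.hasStrictFDerivAt one_ne_zero
  have h1 : fderiv ℝ f (ρ, φ) (1, 0) = (G.C φ - k, G.S φ - l) := by
    have e1 : HasDerivAt (fun x : ℝ => (x, φ)) ((1, 0) : ℝ × ℝ) ρ :=
      (hasDerivAt_id ρ).prodMk (hasDerivAt_const ρ φ)
    have e2 : HasDerivAt (fun x => P.point G (x, ε, φ)) (G.C φ - k, G.S φ - l) ρ :=
      (P.hasDerivAt_point_ray G ε φ ρ).1.prodMk (P.hasDerivAt_point_ray G ε φ ρ).2
    have e3 : HasDerivAt (fun x => P.point G (x, ε, φ)) _ ρ :=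
      hs.hasFDerivAt.comp_hasDerivAt_of_eq ρ e1 rfl
    exact e3.unique e2
  have h2 : fderiv ℝ f (ρ, φ) (0, 1) = ((1 + ρ) * deriv G.C φ, (1 + ρ) * deriv G.S φ) := by
    have e1 : HasDerivAt (fun x : ℝ => (ρ, x)) ((0, 1) : ℝ × ℝ) φ :=
      (hasDerivAt_const φ ρ).prodMk (hasDerivAt_id φ)
    have hC := G.hasDerivAt_C φ
    have hS := G.hasDerivAt_S φ
    rw [← hC.deriv] at hC
    rw [← hS.deriv] at hS
    have e2 : HasDerivAt (fun x => P.point G (ρ, ε, x))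
        ((1 + ρ) * deriv G.C φ, (1 + ρ) * deriv G.S φ) φ := by
      refine ((hC.add ((hC.sub_const (k : ℝ)).mul_const ρ)).prodMk
        (hS.add ((hS.sub_const (l : ℝ)).mul_const ρ))).congr_deriv ?_
      ext <;> simp only <;> ring
    have e3 : HasDerivAt (fun x => P.point G (ρ, ε, x)) _ φ :=
      hs.hasFDerivAt.comp_hasDerivAt_of_eq φ e1 rfl
    exact e3.unique e2
  refine hs.map_nhds_eq_of_surj (LinearMap.range_eq_top.2 fun w => ?_)
  have hα' : G.α φ = deriv G.C φ * (G.S φ - l) - (G.C φ - k) * deriv G.S φ := rfl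
  -- Cramer's rule: up to sign, the Jacobian of the polar coordinates is `(1 + ρ) α`.
  set x := -(w.1 * deriv G.S φ - w.2 * deriv G.C φ) / G.α φ with hx
  set y := ((G.S φ - l) * w.1 - (G.C φ - k) * w.2) / ((1 + ρ) * G.α φ) with hy
  refine ⟨(x, y), ?_⟩
  have h3 : ((x, y) : ℝ × ℝ) = x • ((1, 0) : ℝ × ℝ) + y • ((0, 1) : ℝ × ℝ) := by ext <;> simp
  have h4 : fderiv ℝ f (ρ, φ) (x, y) = w := by
    rw [h3, map_add, map_smul, map_smul, h1, h2, hx, hy]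
    ext
    · simp only [Prod.fst_add, Prod.smul_fst, smul_eq_mul]
      field_simp
      rw [hα']
      ring
    · simp only [Prod.snd_add, Prod.smul_snd, smul_eq_mul]
      field_simp
      rw [hα']
      ring
  exact h4

/-- A neighbourhood, in the polar coordinates, of a closed curve is a neighbourhood of the curve. -/
lemma exists_forall_infDist_lt (hb : InitialRange P.γ P.σ k l b) (ε : ℝ) {U : Set (ℝ × ℝ)}
    (hU : IsOpen U) (hU1 : ∀ p ∈ U, |p.1| < 1) {ρ : ℝ → ℝ} (hρ : Continuous ρ)
    (hper : Function.Periodic ρ G.ω) (hρU : ∀ φ, (ρ φ, φ) ∈ U) :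
    ∃ η > 0, ∀ z, Metric.infDist z (range (G.curve ρ)) < η →
      ∃ p ∈ U, P.point G (p.1, ε, p.2) = z := by
  have hopen : IsOpen ((fun p : ℝ × ℝ => P.point G (p.1, ε, p.2)) '' U) := by
    rw [isOpen_iff_mem_nhds]
    rintro _ ⟨p, hp, rfl⟩
    have h1 := (abs_lt.1 (hU1 p hp)).1
    rw [← P.map_nhds_point G ε (P.star_shaped G hb p.2).1 (by linarith)]
    exact image_mem_map (hU.mem_nhds hp)
  have hcont : Continuous (G.curve ρ) := by
    have hC := G.continuous_C
    have hS := G.continuous_S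
    unfold CycleParam.curve
    fun_prop
  have hpc : Function.Periodic (G.curve ρ) G.ω := fun φ => by
    simp only [CycleParam.curve, G.periodic_C φ, G.periodic_S φ, hper φ]
  have hcomp : IsCompact (range (G.curve ρ)) := hpc.compact_of_continuous G.ω_pos.ne' hcont
  obtain ⟨η, hη, h⟩ := hcomp.exists_thickening_subset_open hopen (by
    rintro _ ⟨φ, rfl⟩
    exact ⟨(ρ φ, φ), hρU φ, rfl⟩)
  exact ⟨η, hη, fun z hz => h ((Metric.mem_thickening_iff_infDist_lt (range_nonempty _)).2 hz)⟩

end PolarCoordinates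

variable {P : PerturbedSystem} {k l : ℤ} {b : ℝ} {G : CycleParam P.γ k l b}
variable {s η L r δ c C B ε₁ ε : ℝ} {Υ : ℝ → ℝ}

/-- Every neighbourhood of the cycle on which the polar coordinates are admissible belongs to the
domain of attraction. -/
lemma IsTrapping.isDirectedStable (T : P.IsTrapping G s η L r δ c C B ε₁)
    (hb : P.IsAdmissible G) (h0 : 0 < ε) (h1 : ε ≤ ε₁) (hΥ : P.IsRadialCycle G r δ ε Υ) {d : ℝ}
    (hd : ∀ z, Metric.infDist z (range (G.curve Υ)) < d →
      ∃ ρ φ, |ρ| ≤ r ∧ |P.normalizedEnergy G ε φ ρ| ≤ δ ∧ P.point G (ρ, ε, φ) = z) :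
    P.IsDirectedStable ε s (range (G.curve Υ)) d := by
  obtain ⟨M, hM⟩ := T.exists_directedSolution hb h0 h1 hΥ
  have hε := T.mem_Icc h0.le h1
  refine ⟨fun z₀ hz₀ => ?_, fun z hz hz0 => ?_, fun ν hν => ?_⟩
  · obtain ⟨ρ, φ, h2, h3, rfl⟩ := hd z₀ hz₀
    obtain ⟨z, hz, hs, -⟩ := hM ρ φ h2 h3
    exact ⟨z, hz, hs⟩
  · obtain ⟨ρ, φ, h2, h3, h4⟩ := hd _ hz0
    obtain ⟨w, hw0, hw, -, hlim⟩ := hM ρ φ h2 h3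
    refine hlim.congr' ?_
    filter_upwards [eventually_ge_atTop 0] with t ht
    rw [hw.eq hε hz (hw0.trans h4) ht]
  · have hν' : 0 < ν / (|M| + 1) := by positivity
    have hWc := P.continuous_normalizedEnergy G hb.1
    have hΥc := hΥ.continuous
    have hp : Continuous fun p : ℝ × ℝ => ((p.1, ε, p.2) : ℝ × ℝ × ℝ) := by fun_prop
    have hWp : Continuous fun p : ℝ × ℝ => |P.normalizedEnergy G ε p.2 p.1| := (hWc.comp hp).abs
    -- Starting in `U`, a solution stays within `M |ρ₀ - Υ φ₀| < ν` of the cycle; openness of the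
    -- polar coordinates turns `U` into a neighbourhood of the cycle.
    set U : Set (ℝ × ℝ) := {p | |p.1| < r} ∩ ({p | |P.normalizedEnergy G ε p.2 p.1| < δ} ∩
      {p | |p.1 - Υ p.2| < ν / (|M| + 1)})
    have hU : IsOpen U := (isOpen_lt (by fun_prop) continuous_const).inter
      ((isOpen_lt hWp continuous_const).inter (isOpen_lt (by fun_prop) continuous_const))
    have hU1 : ∀ p ∈ U, |p.1| < 1 := fun p hp => by
      have := T.estimates.r_le
      have h2 : |p.1| < r := hp.1
      linarith
    obtain ⟨δ', hδ', h⟩ := P.exists_forall_infDist_lt G hb.1 ε hU hU1 hΥc hΥ.periodic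
      fun φ => ⟨hΥ.abs_lt φ, hΥ.energy_lt φ, by simpa using hν'⟩
    refine ⟨δ', hδ', fun z hz hz0 t ht => ?_⟩
    obtain ⟨p, ⟨h2, h3, h4⟩, h5⟩ := h _ hz0
    obtain ⟨w, hw0, hw, hle, -⟩ := hM p.1 p.2 (le_of_lt h2) (le_of_lt h3)
    rw [← hw.eq hε hz (hw0.trans h5) ht]
    calc _ ≤ M * |p.1 - Υ p.2| := hle t ht
      _ ≤ |M| * (ν / (|M| + 1)) :=
        mul_le_mul (le_abs_self M) (le_of_lt h4) (abs_nonneg _) (abs_nonneg _)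
      _ < (|M| + 1) * (ν / (|M| + 1)) := mul_lt_mul_of_pos_right (lt_add_one _) hν'
      _ = ν := by field_simp

lemma dist_curve_cycle (ε φ : ℝ) (Υ : ℝ → ℝ) {Q : ℝ}
    (hQ : ∀ ρ₁ ρ₂ ε₁ ε₂ φ,
      dist (P.point G (ρ₁, ε₁, φ)) (P.point G (ρ₂, ε₂, φ)) ≤ Q * |ρ₁ - ρ₂|) :
    dist (G.curve Υ φ) (G.cycle φ) ≤ Q * |Υ φ| := by
  have := hQ (Υ φ) 0 ε ε φ
  rwa [point_zero, sub_zero] at this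

/-- The neighbourhood of the generating cycle that is covered by the trapping region. -/
lemma IsTrapping.exists_neighbourhood (T : P.IsTrapping G s η L r δ c C B ε₁)
    (hb : P.IsAdmissible G) : ∃ d > 0, ∃ ε₂ > 0, ∀ ε, 0 < ε → ε ≤ ε₁ → ε ≤ ε₂ → ∀ z,
      Metric.infDist z (range G.cycle) < d →
      ∃ ρ φ, |ρ| ≤ r ∧ |P.normalizedEnergy G ε φ ρ| ≤ δ ∧ P.point G (ρ, ε, φ) = z := by
  have hT := T.trapping T.ε₁_pos le_rfl
  have hr := hT.r_pos
  have hδ := hT.δ_pos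
  have hB := T.B_pos
  -- Half of `δ` is reserved for the variation of `w` with `ρ`, half for `w` at `ρ = 0`. Since `C`
  -- does not depend on `ε`, neither does the resulting neighbourhood.
  have hr' : 0 < min r (δ / (2 * (|C| + 1))) := lt_min hr (by positivity)
  obtain ⟨d, hd, h⟩ := P.exists_forall_infDist_lt G hb.1 0 (ρ := fun _ => 0)
    (U := {p | |p.1| < min r (δ / (2 * (|C| + 1)))}) (isOpen_lt (by fun_prop) continuous_const)
    (fun p hp => by
      have := T.estimates.r_le
      have h2 : |p.1| < r := lt_of_lt_of_le hp (min_le_left _ _)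
      linarith) continuous_const (fun _ => rfl) (fun φ => by simpa using hr')
  refine ⟨d, hd, δ / (2 * B), by positivity, fun ε h0 h1 h2 z hz => ?_⟩
  have hcyc : G.curve (fun _ => 0) = G.cycle := by
    funext φ
    simp [CycleParam.curve, CycleParam.cycle]
  rw [hcyc] at h
  obtain ⟨p, hp, hpz⟩ := h z hz
  have hp1 : |p.1| ≤ r := (le_of_lt hp).trans (min_le_left _ _)
  have hp2 : |p.1| ≤ δ / (2 * (|C| + 1)) := (le_of_lt hp).trans (min_le_right _ _)
  refine ⟨p.1, p.2, hp1, ?_, hpz⟩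
  have e1 := (T.trapping h0 h1).upper_W (s * p.2) p.1 0 hp1 (by simpa using hr.le)
  rw [T.mul_mul_self, sub_zero] at e1
  have e2 := T.zero_le (φ := p.2) h0.le h1
  have e3 := abs_sub_abs_le_abs_sub (P.normalizedEnergy G ε p.2 p.1)
    (P.normalizedEnergy G ε p.2 0)
  have e4 : B * ε ≤ δ / 2 := by
    calc B * ε ≤ B * (δ / (2 * B)) := by gcongr
      _ = δ / 2 := by field_simp
  have e5 : C * |p.1| ≤ δ / 2 := by
    calc C * |p.1| ≤ (|C| + 1) * (δ / (2 * (|C| + 1))) := by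
          gcongr
          exact (le_abs_self C).trans (lt_add_one _).le
      _ = δ / 2 := by field_simp
  linarith

end PerturbedSystem

end GenCycle

/-! ### Assembly of the family of cycles. -/

theorem theorem7 (P : GenCycle.PerturbedSystem) (k l : ℤ) (b : ℝ)
    (G : GenCycle.CycleParam P.γ k l b) (hb : P.IsAdmissible G) :
    ∃ εs : ℝ, 0 < εs ∧ εs ≤ P.ε₀ ∧ ∃ c : ℝ, 0 < c ∧ ∃ Υ : ℝ → ℝ → ℝ,
      (∀ ε ∈ Ioc 0 εs,
        ContDiff ℝ 1 (Υ ε) ∧ Function.Periodic (Υ ε) G.ω ∧ (∀ φ, |Υ ε φ| < 1) ∧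
        ContDiff ℝ 1 (G.curve (Υ ε)) ∧ Function.Periodic (G.curve (Υ ε)) G.ω ∧
        P.IsCycle ε (range (G.curve (Υ ε))) ∧
        (0 < P.K G →
          P.IsAsymptoticallyStableBackward ε (range (G.curve (Υ ε))) (c * ε ^ (3 / 2 : ℝ))) ∧
        (P.K G < 0 →
          P.IsAsymptoticallyStableForward ε (range (G.curve (Υ ε))) (c * ε ^ (3 / 2 : ℝ)))) ∧
      ContinuousOn (fun s : ℝ × ℝ => G.curve (Υ s.1) s.2) (Ioo 0 εs ×ˢ univ) ∧
      TendstoUniformly (fun ε => G.curve (Υ ε)) G.cycle (𝓝[>] 0) := by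
  obtain ⟨s, η, L, r, δ, c, C, B, ε₁, T⟩ := GenCycle.PerturbedSystem.exists_isTrapping hb
  obtain ⟨D, hD, hex⟩ := T.exists_isRadialCycle hb.2.2
  have hex' : ∀ ε, ∃ Υ : ℝ → ℝ, 0 < ε → ε ≤ ε₁ →
      P.IsRadialCycle G r δ ε Υ ∧ ∀ φ, |Υ φ| ≤ D * ε := fun ε => by
    by_cases h : 0 < ε ∧ ε ≤ ε₁
    · obtain ⟨Υ, hΥ⟩ := hex ε h.1 h.2
      exact ⟨Υ, fun _ _ => hΥ⟩
    · exact ⟨0, fun h1 h2 => (h ⟨h1, h2⟩).elim⟩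
  choose Υ hΥ using hex'
  obtain ⟨Q, hQ, hdist⟩ := P.exists_dist_point_le G
  obtain ⟨d, hd, ε₂, hε₂, hcov⟩ := T.exists_neighbourhood hb
  have hε₁ := T.ε₁_pos
  have hC := G.contDiff_C
  have hS := G.contDiff_S
  have hclose : ∀ ε, 0 < ε → ε ≤ ε₁ → ∀ φ, dist (G.curve (Υ ε) φ) (G.cycle φ) ≤ Q * D * ε :=
    fun ε h0 h1 φ => (GenCycle.PerturbedSystem.dist_curve_cycle ε φ (Υ ε) hdist).trans (by
      rw [mul_assoc]
      exact mul_le_mul_of_nonneg_left ((hΥ ε h0 h1).2 φ) hQ.le)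
  obtain ⟨εs, hεs, h1, h2, h3, h4⟩ : ∃ εs > 0, εs ≤ ε₁ ∧ εs ≤ ε₂ ∧ εs ≤ 1 ∧
      Q * D * εs ≤ d / 2 := by
    refine ⟨min ε₁ (min ε₂ (min 1 (d / 2 / (Q * D)))), ?_, min_le_left _ _,
      (min_le_right _ _).trans (min_le_left _ _),
      (min_le_right _ _).trans ((min_le_right _ _).trans (min_le_left _ _)), ?_⟩
    · simp only [gt_iff_lt, lt_min_iff]
      exact ⟨hε₁, hε₂, one_pos, by positivity⟩
    · rw [mul_comm, ← le_div_iff₀ (by positivity)]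
      exact (min_le_right _ _).trans ((min_le_right _ _).trans (min_le_right _ _))
  refine ⟨εs, hεs, h1.trans T.ε₁_le, d / 2, by positivity, Υ, fun ε hε => ?_, ?_, ?_⟩
  · obtain ⟨h0, hε'⟩ := hε
    have hε₁' := hε'.trans h1
    have hY := (hΥ ε h0 hε₁').1
    have hY1 := T.contDiff hb h0 hε₁' hY
    -- Since the cycle is within `d / 2` of the generating one, its `d / 2`-neighbourhood lies in
    -- the covered region; as `ε ≤ 1`, so does the one of radius `(d / 2) ε^(3/2)`.
    have hst : P.IsDirectedStable ε s (range (G.curve (Υ ε))) (d / 2 * ε ^ (3 / 2 : ℝ)) := by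
      refine T.isDirectedStable hb h0 hε₁' hY fun z hz =>
        hcov ε h0 hε₁' (hε'.trans h2) z ?_
      obtain ⟨-, ⟨φ, rfl⟩, hφ⟩ := (Metric.infDist_lt_iff (range_nonempty _)).1 hz
      have e1 : ε ^ (3 / 2 : ℝ) ≤ 1 :=
        Real.rpow_le_one h0.le (hε'.trans h3) (by norm_num)
      have e2 : d / 2 * ε ^ (3 / 2 : ℝ) ≤ d / 2 := mul_le_of_le_one_right (by positivity) e1
      have e3 := hclose ε h0 hε₁' φ
      have e4 : Q * D * ε ≤ d / 2 := (mul_le_mul_of_nonneg_left hε' (by positivity)).trans h4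
      calc Metric.infDist z (range G.cycle) ≤ dist z (G.cycle φ) :=
            Metric.infDist_le_dist_of_mem (mem_range_self φ)
        _ ≤ dist z (G.curve (Υ ε) φ) + dist (G.curve (Υ ε) φ) (G.cycle φ) := dist_triangle _ _ _
        _ < d := by linarith
    refine ⟨hY1, hY.periodic, fun φ => ?_, ?_, hY.periodic_curve,
      hY.isCycle T.estimates hb.1 (T.mem_Icc h0.le hε₁') (hε₁'.trans T.ε₁_le_r),
      fun hK => ?_, fun hK => ?_⟩
    · have := T.estimates.r_le
      have := hY.abs_lt φ
      linarith
    · unfold GenCycle.CycleParam.curve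
      fun_prop
    · rcases T.sign with ⟨-, h⟩ | ⟨rfl, -⟩
      · exact absurd hK h.not_gt
      · exact hst.backward
    · rcases T.sign with ⟨rfl, -⟩ | ⟨-, h⟩
      · exact hst.forward
      · exact absurd hK h.not_gt
  · have hc := (T.continuousOn_family hb fun ε h0 h1 => (hΥ ε h0 h1).1).mono
      (prod_mono_left (Ioo_subset_Ioc_self.trans (Ioc_subset_Ioc_right h1)) :
        Ioo 0 εs ×ˢ (univ : Set ℝ) ⊆ Ioc 0 ε₁ ×ˢ univ)
    have hCc := G.continuous_C
    have hSc := G.continuous_S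
    unfold GenCycle.CycleParam.curve
    fun_prop
  · rw [Metric.tendstoUniformly_iff]
    intro ν hν
    have hpos : 0 < min ε₁ (ν / (Q * D)) := lt_min hε₁ (by positivity)
    filter_upwards [Ioo_mem_nhdsGT hpos] with ε hε φ
    rw [dist_comm]
    refine (hclose ε hε.1 (hε.2.le.trans (min_le_left _ _)) φ).trans_lt ?_
    rw [mul_comm, ← lt_div_iff₀ (by positivity)]
    exact hε.2.trans_le (min_le_right _ _)
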